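/- **Theorem (network MSD performance).** Consider a connected network of $N$ agents with symmetric nonnegative weights $A=[a_{k\ell}]$ and Laplacian $L=\mathrm{diag}\{\sum_\ell a_{k\ell}\}-A$, and let $v_1,\dots,v_N$ be orthonormal eigenvectors of $L$ with eigenvalues $\lambda_1,\dots,\lambda_N$. Write $\mathcal L=L\otimes I_M$. Agent $k$ has a twice differentiable cost $J_k:\mathbb R^M\to\mathbb R$ with $0<\lambda_{k,\min}I_M\le\nabla^2J_k(w)\le\lambda_{k,\max}I_M$ for all $w$. For $\eta\ge0$ let $\mathcal W^o_\eta=\mathrm{col}\{w^o_{1,\eta},\dots,w^o_{N,\eta}\}$ be the minimizer of $\sum_kJ_k(w_k)+\frac\eta2\mathcal W^\top\mathcal L\mathcal W$, and put $H_{k,\eta}=\nabla^2J_k(w^o_{k,\eta})$. For a step-size $\mu>0$ consider the multitask diffusion strategy $$\psi_{k,i}=w_{k,i-1}-\mu\,\widehat{\nabla J_k}(w_{k,i-1}),\qquad w_{k,i}=\psi_{k,i}-\mu\eta\sum_{\ell}a_{k\ell}(\psi_{k,i}-\psi_{\ell,i}),\qquad i\ge1,$$ where $\widehat{\nabla J_k}$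 is the random approximate gradient at iteration $i$ and the initial vectors $w_{k,0}$ have finite fourth moments. Let $s_{k,i}(w)=\nabla J_k(w)-\widehat{\nabla J_k}(w)$ be the gradient noise, $\mathcal F_{i}$ the $\sigma$-algebra generated by all $w_{\ell,j}$ with $j\le i$, and $\mathcal W_i=\mathrm{col}\{w_{1,i},\dots,w_{N,i}\}$. Let $\beta_k,\sigma_{s,k},\bar\beta_k,\bar\sigma_{s,k}$ be constants that do not depend on $\mu$ and $\eta$. There is a constant $C$, independent of $\mu$ and $\eta$, such that the following holds for every $\eta\ge0$ for which the conditions below hold, the conditions on the noise being imposed for all step-sizes $\mu>0$ with $0\le\mu\eta\le2/\lambda_{\max}(L)$ and $\mu\eta\le\min_k 1/\sum_\ell a_{k\ell}$, and all $i\ge 1$: 1. (Gradient noise) for all $\mathcal F_{i-1}$-measurable random vectors $w,w'$ with finite fourth moments, $s_{k,i}(w)$ has a finite fourth moment, $\mathbb E[s_{k,i}(w)|\mathcal F_{i-1}]=0$, $\mathbb E[\|s_{k,i}(w)\|^2|\mathcal F_{i-1}]\le\beta_k^2\|w\|^2+\sigma_{s,k}^2$, $\mathbb E[s_{k,i}(w)s_{\ell,i}(w')^\top|\mathcal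 F_{i-1}]=0$ for $k\ne\ell$, and $\mathbb E[\|s_{k,i}(w)\|^4|\mathcal F_{i-1}]\le\bar\beta_k^4\|w\|^4+\bar\sigma_{s,k}^4$. 2. (Smooth Hessians) $\|\nabla^2J_k(w^o_{k,\eta}+\Delta)-H_{k,\eta}\|\le\kappa\|\Delta\|$ whenever $\|\Delta\|\le\epsilon$, for some $\kappa\ge0$ and $\epsilon>0$. 3. (Limiting noise covariance) with $R_{s,k,i}(w)=\mathbb E[s_{k,i}(w)s_{k,i}(w)^\top|\mathcal F_{i-1}]$, the matrices $R_{s,k,i}(w^o_{k,\eta})$ converge in probability, as $i\to\infty$, to a constant matrix $R_{s,k,\eta}$. 4. (Smooth noise covariance) for some constants $\kappa'\ge0$, $\epsilon'>0$, $0<\theta\le4$ that do not depend on $\mu$ and $i$: $\|R_{s,k,i}(w)-R_{s,k,i}(w^o_{k,\eta})\|\le\kappa'\|w-w^o_{k,\eta}\|^\theta$ almost surely, for every $\mathcal F_{i-1}$-measurable $w$ with $\|w-w^o_{k,\eta}\|\le\epsilon'$. The steady-state network mean-square deviation $$\mathrm{MSD}=\mu\lim_{\mu\to0^+}\Big(\limsup_{i\to\infty}\frac1\mu\,\mathbb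 E\Big[\frac1N\|\mathcal W^o_\eta-\mathcal W_i\|^2\Big]\Big)$$ exists (the limit, taken for the fixed value of $\eta$, is finite) and $$\mathrm{MSD}=\frac{\mu}{2N}\sum_{m=1}^N\mathrm{Tr}\Big(\Big(\sum_{k=1}^N[v_m]_k^2H_{k,\eta}+\eta\lambda_mI\Big)^{-1}\Big(\sum_{k=1}^N[v_m]_k^2R_{s,k,\eta}\Big)\Big)+\frac{O(\mu)}{O(1)+O(\eta)},$$ where the last term is bounded in absolute value by $C\mu/(1+\eta)$. -/

import Mathlib

open MeasureTheory Filter Topology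

namespace MultitaskDiffusion

/-- Parameter vectors: `ℝ^M` with the Euclidean norm. -/
abbrev Vec (M : ℕ) : Type := EuclideanSpace ℝ (Fin M)

section Network

variable {N : ℕ}

/-- The graph Laplacian `L = D - A` of a weighted adjacency matrix `A`. -/
def laplacian (A : Matrix (Fin N) (Fin N) ℝ) : Matrix (Fin N) (Fin N) ℝ :=
  Matrix.diagonal (fun k => ∑ l, A k l) - A

/-- `A` is the symmetric adjacency matrix of a connected network: the entries are nonnegative,
two distinct agents are joined by an edge exactly when their weight is positive, and the
resulting graph is connected (in particular it has at least one agent). -/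
structure IsConnectedNetwork (A : Matrix (Fin N) (Fin N) ℝ) : Prop where
  symm : A.IsSymm
  nonneg : ∀ k l, 0 ≤ A k l
  connected : (SimpleGraph.fromRel (fun k l : Fin N => 0 < A k l)).Connected

/-- `v 0, …, v (N-1)` are orthonormal eigenvectors of `L` with eigenvalues `lam m`. There are `N`
of them in `ℝ^N`, so they form an orthonormal basis: `L = V Λ Vᵀ`. -/
structure IsEigenbasis (L : Matrix (Fin N) (Fin N) ℝ) (lam : Fin N → ℝ)
    (v : Fin N → EuclideanSpace ℝ (Fin N)) : Prop where
  orthonormal : Orthonormal ℝ v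
  eigen : ∀ m k, ∑ l, L k l * v m l = lam m * v m k

/-- The condition on the combination matrix `I - μ η L`:
`0 ≤ μ η ≤ 2 / λ_max(L)` and `μ η ≤ min_k 1 / ∑_l a_{kl}`, written without division
(so that the bounds are void when a denominator vanishes). -/
structure CombinationCondition (A : Matrix (Fin N) (Fin N) ℝ) (lam : Fin N → ℝ)
    (μ η : ℝ) : Prop where
  nonneg : 0 ≤ μ * η
  stability : ∀ m, μ * η * lam m ≤ 2
  positivity : ∀ k, μ * η * ∑ l, A k l ≤ 1

end Network

section Costs

variable {N M : ℕ}

/-- The Hessian matrix `∇²f(w)`, i.e. the matrix of the derivative of the gradient. -/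
noncomputable def hessian (f : Vec M → ℝ) (w : Vec M) : Matrix (Fin M) (Fin M) ℝ :=
  (Matrix.toEuclideanCLM (n := Fin M) (𝕜 := ℝ)).symm (fderiv ℝ (gradient f) w)

/-- The spectral norm (2-induced norm) of a matrix. -/
noncomputable def opNorm (B : Matrix (Fin M) (Fin M) ℝ) : ℝ :=
  ‖Matrix.toEuclideanCLM (n := Fin M) (𝕜 := ℝ) B‖

/-- Each cost is twice differentiable, and `0 < λ_{k,min} I ≤ ∇²J_k(w) ≤ λ_{k,max} I` in the
Loewner order, uniformly in `w`. -/
structure StronglyConvexCosts (J : Fin N → Vec M → ℝ) (lmin lmax : Fin N → ℝ) : Prop where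
  differentiable : ∀ k, Differentiable ℝ (J k)
  twice_differentiable : ∀ k, Differentiable ℝ (gradient (J k))
  lmin_pos : ∀ k, 0 < lmin k
  lower : ∀ k w, (hessian (J k) w - lmin k • (1 : Matrix (Fin M) (Fin M) ℝ)).PosSemidef
  upper : ∀ k w, (lmax k • (1 : Matrix (Fin M) (Fin M) ℝ) - hessian (J k) w).PosSemidef

/-- The regularized global cost `∑_k J_k(w_k) + (η/2) Wᵀ (L ⊗ I_M) W`, for
`W = col{w_1, …, w_N}`. -/
noncomputable def regularizedCost (A : Matrix (Fin N) (Fin N) ℝ) (J : Fin N → Vec M → ℝ) (η : ℝ)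
    (W : Fin N → Vec M) : ℝ :=
  ∑ k, J k (W k) + η / 2 * ∑ k, ∑ l, laplacian A k l * inner ℝ (W k) (W l)

/-- The Hessians are Lipschitz near the reference points `Wo k`. -/
def HessianLocallyLipschitz (J : Fin N → Vec M → ℝ) (Wo : Fin N → Vec M) : Prop :=
  ∃ κ ε : ℝ, 0 ≤ κ ∧ 0 < ε ∧ ∀ k, ∀ Δ : Vec M, ‖Δ‖ ≤ ε →
    opNorm (hessian (J k) (Wo k + Δ) - hessian (J k) (Wo k)) ≤ κ * ‖Δ‖

end Costs

section Algorithm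

variable {N M : ℕ} {Ω : Type*}

/-- The multitask diffusion strategy with step-size `μ` and regularization strength `η`.
`ghat k i ω w` is the stochastic approximation of `∇J_k(w)` that is used at iteration `i ≥ 1`
(for instance `∇Q_k(w; x_{k,i}(ω))`), and `w0` is the initialization. -/
noncomputable def iterate (A : Matrix (Fin N) (Fin N) ℝ)
    (ghat : Fin N → ℕ → Ω → Vec M → Vec M) (w0 : Fin N → Ω → Vec M) (μ η : ℝ) :
    ℕ → Fin N → Ω → Vec M
  | 0 => w0
  | i + 1 => fun k ω =>
      let ψ : Fin N → Vec M := fun l =>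
        iterate A ghat w0 μ η i l ω - μ • ghat l (i + 1) ω (iterate A ghat w0 μ η i l ω)
      ψ k - (μ * η) • ∑ l, A k l • (ψ k - ψ l)

/-- The gradient noise `s_{k,i}(w) = ∇J_k(w) - ĝ_{k,i}(w)`. -/
noncomputable def gradNoise (J : Fin N → Vec M → ℝ) (ghat : Fin N → ℕ → Ω → Vec M → Vec M)
    (k : Fin N) (i : ℕ) (ω : Ω) (w : Vec M) : Vec M :=
  gradient (J k) w - ghat k i ω w

/-- The `σ`-algebra `F_i` generated by all iterates `w_{l,j}` with `j ≤ i`. -/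
@[reducible] noncomputable def past (A : Matrix (Fin N) (Fin N) ℝ) (ghat : Fin N → ℕ → Ω → Vec M → Vec M)
    (w0 : Fin N → Ω → Vec M) (μ η : ℝ) (i : ℕ) : MeasurableSpace Ω :=
  ⨆ (j : ℕ) (_ : j ≤ i) (l : Fin N),
    MeasurableSpace.comap (iterate A ghat w0 μ η j l) inferInstance

end Algorithm

section Noise

variable {N M : ℕ} {Ω : Type*} [MeasurableSpace Ω]

/-- The moment conditions on a noise process `s` relative to `F`. They are imposed, at every
iteration `i + 1`, on all `F_i`-measurable random vectors with finite fourth moment; `memLp`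
says that the moments below are finite. -/
structure GradientNoiseConditions (P : Measure Ω) (s : Fin N → ℕ → Ω → Vec M → Vec M)
    (F : ℕ → MeasurableSpace Ω) (β σ β' σ' : Fin N → ℝ) : Prop where
  memLp : ∀ k i, ∀ w : Ω → Vec M, Measurable[F i] w → MemLp w 4 P →
    MemLp (fun ω => s k (i + 1) ω (w ω)) 4 P
  mean_zero : ∀ k i, ∀ w : Ω → Vec M, Measurable[F i] w → MemLp w 4 P →
    P[fun ω => s k (i + 1) ω (w ω) | F i] =ᵐ[P] 0
  second_moment : ∀ k i, ∀ w : Ω → Vec M, Measurable[F i] w → MemLp w 4 P →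
    P[fun ω => ‖s k (i + 1) ω (w ω)‖ ^ 2 | F i]
      ≤ᵐ[P] fun ω => β k ^ 2 * ‖w ω‖ ^ 2 + σ k ^ 2
  uncorrelated : ∀ k l i, k ≠ l → ∀ w w' : Ω → Vec M,
    Measurable[F i] w → MemLp w 4 P → Measurable[F i] w' → MemLp w' 4 P → ∀ a b : Fin M,
    P[fun ω => s k (i + 1) ω (w ω) a * s l (i + 1) ω (w' ω) b | F i] =ᵐ[P] 0
  fourth_moment : ∀ k i, ∀ w : Ω → Vec M, Measurable[F i] w → MemLp w 4 P →
    P[fun ω => ‖s k (i + 1) ω (w ω)‖ ^ 4 | F i]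
      ≤ᵐ[P] fun ω => β' k ^ 4 * ‖w ω‖ ^ 4 + σ' k ^ 4

/-- The conditional covariance `E[s(w) s(w)ᵀ | m]` of a random field `s` at a random vector `w`. -/
noncomputable def noiseCov (P : Measure Ω) (s : Ω → Vec M → Vec M) (m : MeasurableSpace Ω)
    (w : Ω → Vec M) (ω : Ω) : Matrix (Fin M) (Fin M) ℝ :=
  Matrix.of fun a b => (P[fun ω' => s ω' (w ω') a * s ω' (w ω') b | m]) ω

/-- `R k` is the limit, as `i → ∞`, of the conditional noise covariance at the fixed point `Wo k`.
Convergence in probability of every entry is all that is asked. -/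
def IsLimitNoiseCov (P : Measure Ω) (s : Fin N → ℕ → Ω → Vec M → Vec M)
    (F : ℕ → MeasurableSpace Ω) (Wo : Fin N → Vec M)
    (R : Fin N → Matrix (Fin M) (Fin M) ℝ) : Prop :=
  ∀ k a b, TendstoInMeasure P
    (fun (i : ℕ) (ω : Ω) => noiseCov P (s k (i + 1)) (F i) (fun _ => Wo k) ω a b) atTop
    (fun _ => R k a b)

/-- The conditional noise covariance is Hölder continuous with exponent `θ` and constant `κ` on
the `ε`-balls around the points `Wo k`, at all `F_i`-measurable random vectors. -/
def NoiseCovHolder (P : Measure Ω) (s : Fin N → ℕ → Ω → Vec M → Vec M)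
    (F : ℕ → MeasurableSpace Ω) (Wo : Fin N → Vec M) (κ ε θ : ℝ) : Prop :=
  ∀ k i, ∀ w : Ω → Vec M, Measurable[F i] w → (∀ ω, ‖w ω - Wo k‖ ≤ ε) →
    ∀ᵐ ω ∂P, opNorm (noiseCov P (s k (i + 1)) (F i) w ω
      - noiseCov P (s k (i + 1)) (F i) (fun _ => Wo k) ω) ≤ κ * ‖w ω - Wo k‖ ^ θ

/-- `limsup_{i → ∞} (1/μ) E[(1/N) ‖Wo - w_i‖²]`, an extended nonnegative number. -/
noncomputable def scaledSteadyStateMSE (P : Measure Ω) (A : Matrix (Fin N) (Fin N) ℝ)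
    (ghat : Fin N → ℕ → Ω → Vec M → Vec M) (w0 : Fin N → Ω → Vec M) (Wo : Fin N → Vec M)
    (η μ : ℝ) : ENNReal :=
  limsup (fun i : ℕ => ENNReal.ofReal (1 / μ) *
    ∫⁻ ω, ENNReal.ofReal (1 / (N : ℝ) * ∑ k, ‖Wo k - iterate A ghat w0 μ η i k ω‖ ^ 2) ∂P) atTop

/-- The network mean-square deviation exists and equals `MSD = μ * c`, where
`c = lim_{μ → 0⁺} limsup_{i → ∞} (1/μ) E[(1/N) ‖Wo - w_i‖²]` is finite. -/
def HasMSD (P : Measure Ω) (A : Matrix (Fin N) (Fin N) ℝ)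
    (ghat : Fin N → ℕ → Ω → Vec M → Vec M) (w0 : Fin N → Ω → Vec M) (Wo : Fin N → Vec M)
    (η c : ℝ) : Prop :=
  0 ≤ c ∧ Tendsto (fun μ : ℝ => scaledSteadyStateMSE P A ghat w0 Wo η μ) (𝓝[>] 0)
    (𝓝 (ENNReal.ofReal c))

end Noise

/-- The sum over the Laplacian modes
`∑_m Tr((∑_k [v_m]_k² H_k + η λ_m I)⁻¹ (∑_k [v_m]_k² R_k))`. -/
noncomputable def modeSum {N M : ℕ} (lam : Fin N → ℝ) (v : Fin N → EuclideanSpace ℝ (Fin N))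
    (η : ℝ) (H R : Fin N → Matrix (Fin M) (Fin M) ℝ) : ℝ :=
  ∑ m, Matrix.trace
    ((∑ k, (v m k) ^ 2 • H k + (η * lam m) • (1 : Matrix (Fin M) (Fin M) ℝ))⁻¹
      * ∑ k, (v m k) ^ 2 • R k)

end MultitaskDiffusion

/-!
The error `e = W_i - Wo` of the algorithm satisfies the recursion
`e' = e - μ Φ e + μ² Ψ e + μ (1 - μ S) ξ`, where `S = η ℒ`, the drift
`Φ e = ∇J(Wo + e) - ∇J(Wo) + S e` is strongly monotone and differentiable at `0` with symmetric
derivative `𝓗 = diag(H_k) + η ℒ`, and the noise `ξ` is a martingale difference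
(`netError_succ`, `StronglyConvexCosts.exists_isDrift`, `exists_isNoisyRecursion`).

Strong monotonicity makes the second moment of the error eventually `O(μ)` and the fourth moment
eventually `O(μ²)` (`IsDrift.eventually_moments_le`). Hence the quadratic remainder of the drift is
negligible at the scale `μ`. For a unit eigenvector `u` of `𝓗` with eigenvalue `θ`, the quantity
`a_i = E⟨u, e_i⟩²` satisfies the scalar recursion
`a_{i+1} = (1 - μ θ)² a_i + μ² r + o(μ²)`, where `r` is the limiting noise variance along `u`; so
`a_i / μ` is eventually close to `r / (2 θ)`
(`IsDrift.eventually_abs_integral_norm_sq_sub_le`). The noise variance along `u` converges to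
`⟨u, R u⟩`, up to the mean-square error: convergence in probability of the conditional covariances
at the minimizer is enough, because they are bounded, and the Hölder condition, which is available
for bounded arguments only, is applied to a truncation of the iterates
(`eventually_abs_integral_inner_netNoise_sq_sub_le`). Summing over an eigenbasis shows that the mean
square deviation exists and equals `μ / (2 N)` times `∑_j ⟨u_j, R u_j⟩ / θ_j = Tr(R 𝓗⁻¹)`.

It remains to compare `Tr(R 𝓗⁻¹)` with the sum over the Laplacian modes, which is the same trace
with `𝓗⁻¹` replaced by the inverses of the compressions of `𝓗` to the modes `v_m ⊗ ℝ^M`. Since the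
network is connected, zero is a simple eigenvalue of the Laplacian, so all modes but one see a
coercivity of order `1 + η`; the compressed and the exact solutions of `𝓗 q = v_m ⊗ e_a` then
differ by `O(1 / (1 + η))` (`one_add_mul_norm_sub_modeEmb_le`, `exists_abs_sum_sub_modeSum_le`). The
constants are uniform in `η` because the minimizers, and with them the limiting covariances, are
bounded uniformly in `η` (`StronglyConvexCosts.norm_minimizer_le`).
-/

namespace MultitaskDiffusion

/-! ### Scalar contractive recursions -/

lemma eventually_le_of_recursion {a : ℕ → ℝ} {q d δ : ℝ} (hq : 0 < q) (hq1 : q ≤ 1) (hδ : 0 < δ)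
    (h : ∀ᶠ i in atTop, a (i + 1) ≤ (1 - q) * a i + d) : ∀ᶠ i in atTop, a i ≤ d / q + δ := by
  obtain ⟨i₀, hi₀⟩ := eventually_atTop.1 h
  have key : ∀ n, a (i₀ + n) - d / q ≤ (1 - q) ^ n * (a i₀ - d / q) := by
    intro n
    induction n with
    | zero => simp
    | succ n ih =>
      have h1 := hi₀ (i₀ + n) (by omega)
      have h2 : (1 - q) * (a (i₀ + n) - d / q) ≤ (1 - q) * ((1 - q) ^ n * (a i₀ - d / q)) :=
        mul_le_mul_of_nonneg_left ih (by linarith)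
      have h3 : (1 - q) * (d / q) = d / q - d := by field_simp
      rw [← add_assoc, pow_succ']
      linarith
  have hlim : Tendsto (fun n : ℕ => (1 - q) ^ n * (a i₀ - d / q)) atTop (𝓝 0) := by
    simpa using (tendsto_pow_atTop_nhds_zero_of_lt_one (by linarith) (by linarith :
      1 - q < 1)).mul_const (a i₀ - d / q)
  obtain ⟨n₀, hn₀⟩ := eventually_atTop.1 (hlim.eventually_lt_const hδ)
  refine eventually_atTop.2 ⟨i₀ + n₀, fun i hi => ?_⟩
  have h1 := key (i - i₀)
  have h2 := hn₀ (i - i₀) (by omega)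
  rw [show i₀ + (i - i₀) = i by omega] at h1
  linarith

lemma eventually_abs_sub_le_of_recursion {a : ℕ → ℝ} {q d ε δ : ℝ} (hq : 0 < q) (hq1 : q ≤ 1)
    (hδ : 0 < δ) (h : ∀ᶠ i in atTop, |a (i + 1) - ((1 - q) * a i + d)| ≤ ε) :
    ∀ᶠ i in atTop, |a i - d / q| ≤ ε / q + δ := by
  have h1 := eventually_le_of_recursion (a := a) (d := d + ε) hq hq1 hδ
    (h.mono fun i hi => by linarith [(abs_le.1 hi).2])
  have h2 := eventually_le_of_recursion (a := fun i => - a i) (d := -d + ε) hq hq1 hδ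
    (h.mono fun i hi => by linarith [(abs_le.1 hi).1])
  filter_upwards [h1, h2] with i h1 h2
  rw [add_div] at h1 h2
  rw [neg_div] at h2
  exact abs_le.2 ⟨by linarith, by linarith⟩

/-! ### The deterministic part of one step -/

section Drift

variable {E : Type*} [NormedAddCommGroup E] [InnerProductSpace ℝ E]

/-- The deterministic part `e ↦ e - μ Φ(e) + μ² Ψ(e)` of one step of the error recursion. -/
def driftStep (Φ Ψ : E → E) (μ : ℝ) (e : E) : E := e - μ • Φ e + μ ^ 2 • Ψ e

/-- A drift `Φ` that is strongly monotone with respect to its zero `0`, grows at most linearly and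
has the linearization `Hop` at `0`, with a remainder that is globally quadratic, together with a
perturbation `Ψ` of at most linear growth. -/
structure IsDrift (Φ Ψ : E → E) (Hop : E →L[ℝ] E) (ν K : ℝ) : Prop where
  continuous_drift : Continuous Φ
  continuous_pert : Continuous Ψ
  pos : 0 < ν
  one_le : 1 ≤ K
  monotone : ∀ e, ν * ‖e‖ ^ 2 ≤ inner ℝ (Φ e) e
  drift_le : ∀ e, ‖Φ e‖ ≤ K * ‖e‖
  pert_le : ∀ e, ‖Ψ e‖ ≤ K * (‖e‖ + 1)
  remainder_le : ∀ e, ‖Φ e - Hop e‖ ≤ K * ‖e‖ ^ 2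

variable {Φ Ψ : E → E} {Hop : E →L[ℝ] E} {ν K : ℝ}

lemma IsDrift.continuous_driftStep (h : IsDrift Φ Ψ Hop ν K) (μ : ℝ) :
    Continuous (driftStep Φ Ψ μ) := by
  have := h.continuous_drift
  have := h.continuous_pert
  unfold driftStep
  fun_prop

/-- The drift step contracts the squared norm at the rate `μ ν`. The additive term is `O(μ³)`, of
smaller order than the noise variance: the perturbation is of second order, and half of the
contraction absorbs its product with the error. -/
lemma IsDrift.norm_driftStep_sq_le (h : IsDrift Φ Ψ Hop ν K) :
    ∃ C μ₁ : ℝ, 0 ≤ C ∧ 0 < μ₁ ∧ μ₁ ≤ 1 ∧ ∀ μ, 0 < μ → μ < μ₁ → ∀ e,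
      ‖driftStep Φ Ψ μ e‖ ^ 2 ≤ (1 - μ * ν) * ‖e‖ ^ 2 + C * μ ^ 3 := by
  have hν := h.pos
  have hK := h.one_le
  refine ⟨2 * K ^ 2 / ν + 4 * K ^ 2, min 1 (ν / (4 * K + 12 * K ^ 2)), by positivity,
    by positivity, min_le_left _ _, fun μ hμ hμ1 e => ?_⟩
  have hμ2 : μ ≤ 1 := (hμ1.le.trans (min_le_left _ _))
  have hμ3 : μ * (4 * K + 12 * K ^ 2) ≤ ν :=
    (le_div_iff₀ (by positivity)).1 (hμ1.le.trans (min_le_right _ _))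
  set x := ‖e‖ with hx
  have hx0 : 0 ≤ x := norm_nonneg e
  have e1 : ‖driftStep Φ Ψ μ e‖ ^ 2 = x ^ 2 - 2 * μ * inner ℝ (Φ e) e + 2 * μ ^ 2 * inner ℝ (Ψ e) e
      + ‖-(μ • Φ e) + μ ^ 2 • Ψ e‖ ^ 2 := by
    rw [driftStep, show e - μ • Φ e + μ ^ 2 • Ψ e = e + (-(μ • Φ e) + μ ^ 2 • Ψ e) by abel,
      norm_add_sq_real, inner_add_right, inner_neg_right, inner_smul_right, inner_smul_right,
      real_inner_comm e, real_inner_comm e]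
    ring
  have e2 : inner ℝ (Ψ e) e ≤ K * (x + 1) * x :=
    (real_inner_le_norm _ _).trans (mul_le_mul_of_nonneg_right (h.pert_le e) hx0)
  have e3 : ‖-(μ • Φ e) + μ ^ 2 • Ψ e‖ ≤ μ * (K * x) + μ ^ 2 * (K * (x + 1)) := by
    refine (norm_add_le _ _).trans (add_le_add ?_ ?_)
    · rw [norm_neg, norm_smul, Real.norm_of_nonneg hμ.le]
      exact mul_le_mul_of_nonneg_left (h.drift_le e) hμ.le
    · rw [norm_smul, Real.norm_of_nonneg (by positivity)]
      exact mul_le_mul_of_nonneg_left (h.pert_le e) (by positivity)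
  have e4 : ‖-(μ • Φ e) + μ ^ 2 • Ψ e‖ ^ 2 ≤ (μ * (K * x) + μ ^ 2 * (K * (x + 1))) ^ 2 :=
    pow_le_pow_left₀ (norm_nonneg _) e3 2
  have e5 : (μ * (K * x) + μ ^ 2 * (K * (x + 1))) ^ 2
      ≤ 2 * μ ^ 2 * K ^ 2 * x ^ 2 + 4 * μ ^ 4 * K ^ 2 * (x ^ 2 + 1) := by
    nlinarith [sq_nonneg (μ * (K * x) - μ ^ 2 * (K * (x + 1))), sq_nonneg (μ ^ 2 * K * (x - 1))]
  have e6 : 2 * μ ^ 2 * K * x ≤ μ * ν / 2 * x ^ 2 + 2 * K ^ 2 / ν * μ ^ 3 := by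
    have : μ * ν / 2 * x ^ 2 + 2 * K ^ 2 / ν * μ ^ 3 - 2 * μ ^ 2 * K * x
        = μ / (2 * ν) * (ν * x - 2 * K * μ) ^ 2 := by field_simp; ring
    nlinarith [show 0 ≤ μ / (2 * ν) * (ν * x - 2 * K * μ) ^ 2 by positivity]
  have e7 : μ ^ 4 ≤ μ ^ 2 := pow_le_pow_of_le_one hμ.le hμ2 (by norm_num)
  have e8 : μ ^ 4 ≤ μ ^ 3 := pow_le_pow_of_le_one hμ.le hμ2 (by norm_num)
  have e9 : μ * (μ * (4 * K + 12 * K ^ 2)) * x ^ 2 ≤ μ * ν * x ^ 2 := by gcongr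
  have e10 : 4 * μ ^ 4 * K ^ 2 * (x ^ 2 + 1) ≤ 4 * K ^ 2 * (μ ^ 2 * x ^ 2 + μ ^ 3) := by
    have : μ ^ 4 * x ^ 2 ≤ μ ^ 2 * x ^ 2 := by gcongr
    nlinarith [sq_nonneg K]
  have e11 : μ * (ν * x ^ 2) ≤ μ * inner ℝ (Φ e) e :=
    mul_le_mul_of_nonneg_left (h.monotone e) hμ.le
  have e12 : μ ^ 2 * inner ℝ (Ψ e) e ≤ μ ^ 2 * (K * (x + 1) * x) :=
    mul_le_mul_of_nonneg_left e2 (by positivity)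
  rw [e1]
  nlinarith

/-- Along an eigenvector of the linearization the drift step is, to leading order, multiplication
by `1 - μ θ`. -/
lemma IsDrift.abs_inner_driftStep_sq_sub_le (h : IsDrift Φ Ψ Hop ν K) {ρ : ℝ} (hρ : 0 < ρ) :
    ∃ C : ℝ, 0 ≤ C ∧ ∀ (u : E) (θ : ℝ), ‖u‖ = 1 → 0 ≤ θ →
      (∀ e, inner ℝ u (Hop e) = θ * inner ℝ u e) →
      ∀ μ, 0 < μ → μ ≤ 1 → μ * θ ≤ 1 → ∀ e,
      |inner ℝ u (driftStep Φ Ψ μ e) ^ 2 - (1 - μ * θ) ^ 2 * inner ℝ u e ^ 2|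
        ≤ ρ * (μ ^ 2 + μ * ‖e‖ ^ 2) + C * (μ * ‖e‖ ^ 4 + μ ^ 2 * ‖e‖ ^ 2 + μ ^ 3) := by
  have hν := h.pos
  have hK := h.one_le
  refine ⟨K ^ 2 / ρ + 2 * K + 3 * K ^ 2, by positivity, fun u θ hu hθ hH μ hμ hμ1 hμθ e => ?_⟩
  set x := ‖e‖ with hx
  have hx0 : 0 ≤ x := norm_nonneg e
  set d := inner ℝ u (-(μ • (Φ e - Hop e)) + μ ^ 2 • Ψ e) with hd
  set a := (1 - μ * θ) * inner ℝ u e with ha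
  have e1 : inner ℝ u (driftStep Φ Ψ μ e) = a + d := by
    simp only [driftStep, hd, ha, inner_add_right, inner_sub_right, inner_neg_right,
      inner_smul_right, hH]
    ring
  have e2 : |d| ≤ μ * (K * x ^ 2) + μ ^ 2 * (K * (x + 1)) := by
    refine (abs_real_inner_le_norm _ _).trans ?_
    rw [hu, one_mul]
    refine (norm_add_le _ _).trans (add_le_add ?_ ?_)
    · rw [norm_neg, norm_smul, Real.norm_of_nonneg hμ.le]
      exact mul_le_mul_of_nonneg_left (h.remainder_le e) hμ.le
    · rw [norm_smul, Real.norm_of_nonneg (by positivity)]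
      exact mul_le_mul_of_nonneg_left (h.pert_le e) (by positivity)
  have e3 : |a| ≤ x := by
    rw [ha, abs_mul, abs_of_nonneg (by linarith : 0 ≤ 1 - μ * θ)]
    have : |inner ℝ u e| ≤ x := by
      simpa [hu] using abs_real_inner_le_norm u e
    have h0 := abs_nonneg (inner ℝ u e)
    have h1 : 0 ≤ μ * θ := by positivity
    nlinarith
  have e4 : |inner ℝ u (driftStep Φ Ψ μ e) ^ 2 - (1 - μ * θ) ^ 2 * inner ℝ u e ^ 2|
      ≤ 2 * x * |d| + |d| ^ 2 := by
    rw [e1, show (a + d) ^ 2 - (1 - μ * θ) ^ 2 * inner ℝ u e ^ 2 = 2 * a * d + d ^ 2 by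
      rw [ha]; ring]
    refine (abs_add_le _ _).trans ?_
    rw [abs_mul, abs_mul, abs_two, abs_pow]
    have := mul_le_mul_of_nonneg_right e3 (abs_nonneg d)
    linarith
  refine e4.trans ?_
  set D := μ * (K * x ^ 2) + μ ^ 2 * (K * (x + 1)) with hD
  have e5 : 2 * x * |d| + |d| ^ 2 ≤ 2 * x * D + D ^ 2 := by gcongr
  refine e5.trans ?_
  have e6 : D ^ 2 ≤ 3 * K ^ 2 * (μ ^ 2 * x ^ 4 + μ ^ 4 * x ^ 2 + μ ^ 4) := by
    have : D = K * (μ * x ^ 2 + μ ^ 2 * x + μ ^ 2) := by rw [hD]; ring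
    rw [this, mul_pow, mul_comm (3 : ℝ), mul_assoc]
    gcongr
    nlinarith [sq_nonneg (μ * x ^ 2 - μ ^ 2 * x), sq_nonneg (μ * x ^ 2 - μ ^ 2),
      sq_nonneg (μ ^ 2 * x - μ ^ 2)]
  have e7 : 3 * K ^ 2 * (μ ^ 2 * x ^ 4 + μ ^ 4 * x ^ 2 + μ ^ 4)
      ≤ 3 * K ^ 2 * (μ * x ^ 4 + μ ^ 2 * x ^ 2 + μ ^ 3) := by
    have h1 : μ ^ 2 ≤ μ := by nlinarith
    have h2 : μ ^ 4 ≤ μ ^ 2 := pow_le_pow_of_le_one hμ.le hμ1 (by norm_num)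
    have h3 : μ ^ 4 ≤ μ ^ 3 := pow_le_pow_of_le_one hμ.le hμ1 (by norm_num)
    gcongr
  -- Both odd powers are split by the arithmetic-geometric mean inequality with weight `ρ / K`.
  have e8 : 2 * K * x ^ 3 ≤ ρ * x ^ 2 + K ^ 2 / ρ * x ^ 4 := by
    have : ρ * x ^ 2 + K ^ 2 / ρ * x ^ 4 - 2 * K * x ^ 3 = 1 / ρ * (x * (ρ - K * x)) ^ 2 := by
      field_simp; ring
    nlinarith [show 0 ≤ 1 / ρ * (x * (ρ - K * x)) ^ 2 by positivity]
  have e9 : 2 * K * x ≤ ρ + K ^ 2 / ρ * x ^ 2 := by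
    have : ρ + K ^ 2 / ρ * x ^ 2 - 2 * K * x = 1 / ρ * (ρ - K * x) ^ 2 := by
      field_simp; ring
    nlinarith [show 0 ≤ 1 / ρ * (ρ - K * x) ^ 2 by positivity]
  have e10 : 2 * x * D = μ * (2 * K * x ^ 3) + μ ^ 2 * (2 * K * x) + 2 * K * (μ ^ 2 * x ^ 2) := by
    rw [hD]; ring
  have e11 := mul_le_mul_of_nonneg_left e8 hμ.le
  have e12 := mul_le_mul_of_nonneg_left e9 (by positivity : 0 ≤ μ ^ 2)
  have e13 : 0 ≤ (K ^ 2 / ρ + 2 * K) * μ ^ 3 := by positivity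
  have e14 : 0 ≤ 2 * K * (μ * x ^ 4) := by positivity
  rw [e10]
  linarith

end Drift

/-! ### Moments of the error recursion -/

section Moments

variable {Ω : Type*} [MeasurableSpace Ω] {P : Measure Ω}
variable {E : Type*} [NormedAddCommGroup E] [InnerProductSpace ℝ E]

/-- The error process `e` of a stochastic recursion `e' = T e + μ (ξ - μ S ξ)` whose noise `ξ` is a
martingale difference: it is uncorrelated with functions of the current error, and its second and
fourth moments are controlled by those of the error. The conditional expectations given the past
enter only through their consequences for expectations against functions of the current error. -/
structure IsNoisyRecursion (P : Measure Ω) (T : E → E) (S : E →L[ℝ] E) (μ b : ℝ)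
    (e ξ : ℕ → Ω → E) : Prop where
  memLp_error : ∀ i, MemLp (e i) 4 P
  memLp_noise : ∀ i, MemLp (ξ i) 4 P
  step : ∀ i ω, e (i + 1) ω = T (e i ω) + μ • (ξ i ω - μ • S (ξ i ω))
  orthogonal : ∀ i (f : E → E), Continuous f → (∃ C, ∀ x, ‖f x‖ ≤ C * (1 + ‖x‖ ^ 3)) →
    ∫ ω, inner ℝ (f (e i ω)) (ξ i ω) ∂P = 0
  second_moment : ∀ i (g : E → ℝ), Continuous g → (∀ x, 0 ≤ g x) →
    (∃ C, ∀ x, g x ≤ C * (1 + ‖x‖ ^ 2)) →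
    ∫ ω, g (e i ω) * ‖ξ i ω‖ ^ 2 ∂P ≤ ∫ ω, g (e i ω) * (b * (‖e i ω‖ ^ 2 + 1)) ∂P
  fourth_moment : ∀ i, ∫ ω, ‖ξ i ω‖ ^ 4 ∂P ≤ ∫ ω, b * (‖e i ω‖ ^ 4 + 1) ∂P

lemma integrable_norm_pow_four {F : Type*} [NormedAddCommGroup F] [IsFiniteMeasure P]
    {f : Ω → F} (hf : MemLp f 4 P) : Integrable (fun ω => ‖f ω‖ ^ 4) P := by
  simpa using hf.integrable_norm_pow (by norm_num : (4 : ℕ) ≠ 0)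

variable {T : E → E} {S : E →L[ℝ] E} {μ b : ℝ} {e ξ : ℕ → Ω → E}

lemma norm_sub_smul_apply_le (S : E →L[ℝ] E) (hμ : 0 < μ) (hμ1 : μ ≤ 1) (y : E) :
    ‖y - μ • S y‖ ≤ (1 + ‖S‖) * ‖y‖ := by
  refine (norm_sub_le _ _).trans ?_
  rw [norm_smul, Real.norm_of_nonneg hμ.le]
  have h1 := S.le_opNorm y
  have h2 : μ * ‖S y‖ ≤ 1 * ‖S y‖ := by gcongr
  linarith

lemma inner_sub_smul_apply_comm (hS : (S : E →ₗ[ℝ] E).IsSymmetric) (x y : E) :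
    inner ℝ x (y - μ • S y) = inner ℝ (x - μ • S x) y := by
  have : inner ℝ (S x) y = inner ℝ x (S y) := hS x y
  rw [inner_sub_left, inner_sub_right, inner_smul_left, inner_smul_right, this]
  simp

lemma IsNoisyRecursion.norm_step_sq (h : IsNoisyRecursion P T S μ b e ξ)
    (hS : (S : E →ₗ[ℝ] E).IsSymmetric) (i : ℕ) (ω : Ω) :
    ‖e (i + 1) ω‖ ^ 2 = ‖T (e i ω)‖ ^ 2
      + 2 * μ * inner ℝ (T (e i ω) - μ • S (T (e i ω))) (ξ i ω)
      + μ ^ 2 * ‖ξ i ω - μ • S (ξ i ω)‖ ^ 2 := by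
  rw [h.step, norm_add_sq_real, inner_smul_right, inner_sub_smul_apply_comm hS, norm_smul, mul_pow,
    Real.norm_eq_abs, sq_abs]
  ring

variable [IsProbabilityMeasure P]

/-- Continuous functions of error and noise of at most quartic growth are integrable. -/
lemma IsNoisyRecursion.integrable_of_le
    (h : IsNoisyRecursion P T S μ b e ξ) (i : ℕ) {f : E → E → ℝ} (hf : Continuous f.uncurry)
    (C : ℝ) (hC : ∀ x y, |f x y| ≤ C * (1 + ‖x‖ ^ 4 + ‖y‖ ^ 4)) :
    Integrable (fun ω => f (e i ω) (ξ i ω)) P := by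
  have h1 := integrable_norm_pow_four (h.memLp_error i)
  have h2 := integrable_norm_pow_four (h.memLp_noise i)
  refine ((((integrable_const (1 : ℝ)).add h1).add h2).const_mul C).mono' ?_
    (Eventually.of_forall fun ω => hC _ _)
  exact hf.comp_aestronglyMeasurable
    ((h.memLp_error i).aestronglyMeasurable.prodMk (h.memLp_noise i).aestronglyMeasurable)

lemma sq_le_one_add_pow_four (x : ℝ) : x ^ 2 ≤ 1 + x ^ 4 := by nlinarith [sq_nonneg (x ^ 2 - 1)]

lemma IsNoisyRecursion.integrable_error_sq (h : IsNoisyRecursion P T S μ b e ξ) (i : ℕ) :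
    Integrable (fun ω => ‖e i ω‖ ^ 2) P :=
  h.integrable_of_le i (f := fun x _ => ‖x‖ ^ 2) (by unfold Function.uncurry; fun_prop) 1
    fun x y => by
      rw [abs_of_nonneg (by positivity)]
      nlinarith [sq_le_one_add_pow_four ‖x‖, pow_nonneg (norm_nonneg y) 4]

lemma IsNoisyRecursion.integrable_noise_sq (h : IsNoisyRecursion P T S μ b e ξ) (i : ℕ) :
    Integrable (fun ω => ‖ξ i ω‖ ^ 2) P :=
  h.integrable_of_le i (f := fun _ y => ‖y‖ ^ 2) (by unfold Function.uncurry; fun_prop) 1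
    fun x y => by
      rw [abs_of_nonneg (by positivity)]
      nlinarith [sq_le_one_add_pow_four ‖y‖, pow_nonneg (norm_nonneg x) 4]

lemma IsNoisyRecursion.integral_noise_sq_le (h : IsNoisyRecursion P T S μ b e ξ) (i : ℕ) :
    ∫ ω, ‖ξ i ω‖ ^ 2 ∂P ≤ b * (∫ ω, ‖e i ω‖ ^ 2 ∂P + 1) := by
  have h1 := h.second_moment i (fun _ => 1) continuous_const (fun _ => zero_le_one)
    ⟨1, fun x => by nlinarith [sq_nonneg ‖x‖]⟩
  simp only [one_mul] at h1
  rwa [integral_const_mul, integral_add (h.integrable_error_sq i) (integrable_const _),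
    integral_const, probReal_univ, one_smul] at h1

/-- A noisy step whose deterministic part contracts the squared norm by `1 - q` up to an additive
constant `c`. -/
structure HasContractiveStep (T : E → E) (S : E →L[ℝ] E) (μ q c : ℝ) : Prop where
  continuous : Continuous T
  symmetric : (S : E →ₗ[ℝ] E).IsSymmetric
  pos : 0 < μ
  le_one : μ ≤ 1
  rate_nonneg : 0 ≤ q
  rate_le_one : q ≤ 1
  const_nonneg : 0 ≤ c
  norm_sq_le : ∀ x, ‖T x‖ ^ 2 ≤ (1 - q) * ‖x‖ ^ 2 + c

variable {q c : ℝ}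

lemma HasContractiveStep.norm_sq_le' (hT : HasContractiveStep T S μ q c) (x : E) :
    ‖T x‖ ^ 2 ≤ ‖x‖ ^ 2 + c := by
  nlinarith [hT.norm_sq_le x, mul_nonneg hT.rate_nonneg (sq_nonneg ‖x‖)]

lemma HasContractiveStep.norm_le (hT : HasContractiveStep T S μ q c) (x : E) :
    ‖T x‖ ≤ (1 + c) * (1 + ‖x‖) := by
  have hc := hT.const_nonneg
  refine le_of_sq_le_sq ?_ (by positivity)
  have h1 := hT.norm_sq_le' x
  have h2 : 0 ≤ c * ‖x‖ := by positivity
  have h3 : 0 ≤ c ^ 2 * (1 + ‖x‖) ^ 2 := by positivity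
  have h4 : 0 ≤ c * ‖x‖ ^ 2 := by positivity
  nlinarith [norm_nonneg x]

lemma HasContractiveStep.continuous_adj (hT : HasContractiveStep T S μ q c) :
    Continuous fun x => T x - μ • S (T x) := by
  have := hT.continuous
  fun_prop

lemma HasContractiveStep.norm_adj_le (hT : HasContractiveStep T S μ q c) (x : E) :
    ‖T x - μ • S (T x)‖ ≤ (1 + ‖S‖) * ((1 + c) * (1 + ‖x‖)) :=
  (norm_sub_smul_apply_le S hT.pos hT.le_one _).trans
    (mul_le_mul_of_nonneg_left (hT.norm_le x) (by positivity))

/-- The recursion for the mean-square error. The noise contributes only its variance, since the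
cross term vanishes by orthogonality. -/
lemma IsNoisyRecursion.integral_sq_step_le (h : IsNoisyRecursion P T S μ b e ξ)
    (hT : HasContractiveStep T S μ q c) (i : ℕ) :
    ∫ ω, ‖e (i + 1) ω‖ ^ 2 ∂P ≤ (1 - q) * ∫ ω, ‖e i ω‖ ^ 2 ∂P + c
      + μ ^ 2 * (1 + ‖S‖) ^ 2 * (b * (∫ ω, ‖e i ω‖ ^ 2 ∂P + 1)) := by
  have hμ := hT.pos
  have hc := hT.const_nonneg
  have i1 := h.integrable_error_sq i
  have i2 := h.integrable_noise_sq i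
  have i3 : Integrable (fun ω => inner ℝ (T (e i ω) - μ • S (T (e i ω))) (ξ i ω)) P := by
    refine h.integrable_of_le i (f := fun x y => inner ℝ (T x - μ • S (T x)) y) ?_
      ((1 + ‖S‖) * (1 + c) * 4) fun x y => ?_
    · have := hT.continuous
      unfold Function.uncurry; fun_prop
    · refine (abs_real_inner_le_norm _ _).trans ?_
      refine (mul_le_mul_of_nonneg_right (hT.norm_adj_le x) (norm_nonneg y)).trans ?_
      rw [show (1 + ‖S‖) * ((1 + c) * (1 + ‖x‖)) * ‖y‖
        = (1 + ‖S‖) * (1 + c) * ((1 + ‖x‖) * ‖y‖) by ring, mul_assoc _ (4 : ℝ)]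
      refine mul_le_mul_of_nonneg_left ?_ (by positivity)
      nlinarith [sq_nonneg (‖x‖ - ‖y‖), sq_le_one_add_pow_four ‖x‖, sq_le_one_add_pow_four ‖y‖,
        sq_nonneg (‖y‖ - 1), pow_nonneg (norm_nonneg x) 4, pow_nonneg (norm_nonneg y) 4]
  have o1 := h.orthogonal i _ hT.continuous_adj ⟨(1 + ‖S‖) * (1 + c) * 2, fun x => by
    refine (hT.norm_adj_le x).trans ?_
    rw [← mul_assoc, mul_assoc (_ * _) 2]
    gcongr
    have := norm_nonneg x
    nlinarith [mul_nonneg this (sq_nonneg (‖x‖ - 1)), sq_nonneg (‖x‖ - 1)]⟩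
  have hpt : ∀ ω, ‖e (i + 1) ω‖ ^ 2 ≤ ((1 - q) * ‖e i ω‖ ^ 2 + c)
      + 2 * μ * inner ℝ (T (e i ω) - μ • S (T (e i ω))) (ξ i ω)
      + μ ^ 2 * (1 + ‖S‖) ^ 2 * ‖ξ i ω‖ ^ 2 := by
    intro ω
    rw [h.norm_step_sq hT.symmetric, mul_assoc (μ ^ 2), ← mul_pow (1 + ‖S‖)]
    have := hT.norm_sq_le (e i ω)
    have := norm_sub_smul_apply_le S hT.pos hT.le_one (ξ i ω)
    gcongr
  calc ∫ ω, ‖e (i + 1) ω‖ ^ 2 ∂P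
      ≤ ∫ ω, (((1 - q) * ‖e i ω‖ ^ 2 + c)
      + 2 * μ * inner ℝ (T (e i ω) - μ • S (T (e i ω))) (ξ i ω)
      + μ ^ 2 * (1 + ‖S‖) ^ 2 * ‖ξ i ω‖ ^ 2) ∂P :=
        integral_mono (h.integrable_error_sq _)
          ((((i1.const_mul _).fun_add (integrable_const _)).fun_add (i3.const_mul _)).fun_add
            (i2.const_mul _)) hpt
    _ = (1 - q) * ∫ ω, ‖e i ω‖ ^ 2 ∂P + c + μ ^ 2 * (1 + ‖S‖) ^ 2 * ∫ ω, ‖ξ i ω‖ ^ 2 ∂P := by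
        rw [integral_add (((i1.const_mul _).fun_add (integrable_const _)).fun_add (i3.const_mul _))
            (i2.const_mul _),
          integral_add ((i1.const_mul _).fun_add (integrable_const _)) (i3.const_mul _),
          integral_add (i1.const_mul _) (integrable_const _), integral_const_mul,
          integral_const_mul, integral_const_mul, o1]
        simp
    _ ≤ _ := by
        gcongr
        exact h.integral_noise_sq_le i

/-- The recursion for the mean fourth power of the error. When the mean-square error is `O(μ)` and
`c = O(μ³)`, all terms other than the fourth moment are `O(μ³)`; a contraction rate of order `μ`
then leaves `O(μ²)` in the steady state. -/
lemma IsNoisyRecursion.integral_pow_four_step_le (h : IsNoisyRecursion P T S μ b e ξ) (hb : 0 ≤ b)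
    (hT : HasContractiveStep T S μ q c) (i : ℕ) :
    ∫ ω, ‖e (i + 1) ω‖ ^ 4 ∂P ≤ (1 - q) * ∫ ω, ‖e i ω‖ ^ 4 ∂P
      + (2 * c * ∫ ω, ‖e i ω‖ ^ 2 ∂P + c ^ 2)
      + 8 * μ ^ 2 * (1 + ‖S‖) ^ 2 * (b * (∫ ω, ‖e i ω‖ ^ 4 ∂P
          + (1 + c) * ∫ ω, ‖e i ω‖ ^ 2 ∂P + c))
      + 3 * μ ^ 4 * (1 + ‖S‖) ^ 4 * (b * (∫ ω, ‖e i ω‖ ^ 4 ∂P + 1)) := by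
  have hμ := hT.pos
  have hc := hT.const_nonneg
  have hq := hT.rate_nonneg
  have hq1 := hT.rate_le_one
  have i1 := h.integrable_error_sq i
  have i4 := integrable_norm_pow_four (h.memLp_error i)
  have j4 := integrable_norm_pow_four (h.memLp_noise i)
  have hTc := hT.continuous
  have i3 : Integrable (fun ω => inner ℝ (‖T (e i ω)‖ ^ 2 • (T (e i ω) - μ • S (T (e i ω))))
      (ξ i ω)) P := by
    refine h.integrable_of_le i (f := fun x y => inner ℝ (‖T x‖ ^ 2 • (T x - μ • S (T x))) y) ?_
      ((1 + c) ^ 2 * ((1 + ‖S‖) * (1 + c)) * 8) fun x y => ?_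
    · unfold Function.uncurry; fun_prop
    · refine (abs_real_inner_le_norm _ _).trans ?_
      rw [norm_smul, norm_pow, norm_norm]
      have h1 : ‖T x‖ ^ 2 * ‖T x - μ • S (T x)‖ * ‖y‖ ≤
          ((1 + c) * (1 + ‖x‖)) ^ 2 * ((1 + ‖S‖) * ((1 + c) * (1 + ‖x‖))) * ‖y‖ := by
        gcongr
        exacts [hT.norm_le x, hT.norm_adj_le x]
      refine h1.trans ?_
      rw [show ((1 + c) * (1 + ‖x‖)) ^ 2 * ((1 + ‖S‖) * ((1 + c) * (1 + ‖x‖))) * ‖y‖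
        = (1 + c) ^ 2 * ((1 + ‖S‖) * (1 + c)) * ((1 + ‖x‖) ^ 3 * ‖y‖) by ring,
        mul_assoc _ (8 : ℝ)]
      refine mul_le_mul_of_nonneg_left ?_ (by positivity)
      have hx := norm_nonneg x
      have hy := norm_nonneg y
      set a := 1 + ‖x‖
      have h2 : a ^ 3 * ‖y‖ ≤ 3 / 4 * a ^ 4 + 1 / 4 * ‖y‖ ^ 4 := by
        have : 3 / 4 * a ^ 4 + 1 / 4 * ‖y‖ ^ 4 - a ^ 3 * ‖y‖
          = 1 / 4 * (a - ‖y‖) ^ 2 * (2 * a ^ 2 + (a + ‖y‖) ^ 2) := by ring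
        nlinarith [show 0 ≤ 1 / 4 * (a - ‖y‖) ^ 2 * (2 * a ^ 2 + (a + ‖y‖) ^ 2) by positivity]
      have h3 : a ^ 2 ≤ 2 * (1 + ‖x‖ ^ 2) := by
        show (1 + ‖x‖) ^ 2 ≤ _
        nlinarith [sq_nonneg (‖x‖ - 1)]
      have h4 : (a ^ 2) ^ 2 ≤ (2 * (1 + ‖x‖ ^ 2)) ^ 2 := by gcongr
      nlinarith [sq_nonneg (‖x‖ ^ 2 - 1), pow_nonneg hy 4]
  have o1 := h.orthogonal i (fun x => ‖T x‖ ^ 2 • (T x - μ • S (T x))) (by fun_prop)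
    ⟨(1 + c) ^ 2 * ((1 + ‖S‖) * (1 + c)) * 4, fun x => by
      rw [norm_smul, norm_pow, norm_norm]
      have h1 : ‖T x‖ ^ 2 * ‖T x - μ • S (T x)‖ ≤
          ((1 + c) * (1 + ‖x‖)) ^ 2 * ((1 + ‖S‖) * ((1 + c) * (1 + ‖x‖))) := by
        gcongr
        exacts [hT.norm_le x, hT.norm_adj_le x]
      refine h1.trans ?_
      rw [show ((1 + c) * (1 + ‖x‖)) ^ 2 * ((1 + ‖S‖) * ((1 + c) * (1 + ‖x‖)))
        = (1 + c) ^ 2 * ((1 + ‖S‖) * (1 + c)) * (1 + ‖x‖) ^ 3 by ring, mul_assoc _ (4 : ℝ)]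
      gcongr
      have hx := norm_nonneg x
      nlinarith [mul_nonneg (by linarith : 0 ≤ 1 + ‖x‖) (sq_nonneg (‖x‖ - 1))]⟩
  have i5 : Integrable (fun ω => ‖T (e i ω)‖ ^ 2 * ‖ξ i ω‖ ^ 2) P := by
    refine h.integrable_of_le i (f := fun x y => ‖T x‖ ^ 2 * ‖y‖ ^ 2)
      (by unfold Function.uncurry; fun_prop) (1 + c) fun x y => ?_
    rw [abs_of_nonneg (by positivity)]
    have h1 : ‖T x‖ ^ 2 * ‖y‖ ^ 2 ≤ ((1 + c) * (1 + ‖x‖ ^ 2)) * ‖y‖ ^ 2 := by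
      gcongr
      nlinarith [hT.norm_sq_le' x, mul_nonneg hc (sq_nonneg ‖x‖)]
    refine h1.trans ?_
    rw [mul_assoc]
    gcongr
    nlinarith [sq_nonneg (‖x‖ ^ 2 - ‖y‖ ^ 2), sq_nonneg (‖y‖ ^ 2 - 1),
      sq_nonneg (‖x‖ ^ 2)]
  have s1 := h.second_moment i (fun x => ‖T x‖ ^ 2) (by fun_prop) (fun x => by positivity)
    ⟨1 + c, fun x => by nlinarith [hT.norm_sq_le' x, mul_nonneg hc (sq_nonneg ‖x‖)]⟩
  have i6 : Integrable (fun ω => ‖T (e i ω)‖ ^ 2 * (b * (‖e i ω‖ ^ 2 + 1))) P := by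
    refine h.integrable_of_le i (f := fun x _ => ‖T x‖ ^ 2 * (b * (‖x‖ ^ 2 + 1)))
      (by unfold Function.uncurry; fun_prop) ((1 + c) * b * 2) fun x y => ?_
    rw [abs_of_nonneg (by positivity)]
    have h1 : ‖T x‖ ^ 2 * (b * (‖x‖ ^ 2 + 1))
        ≤ ((1 + c) * (1 + ‖x‖ ^ 2)) * (b * (‖x‖ ^ 2 + 1)) := by
      gcongr
      nlinarith [hT.norm_sq_le' x, mul_nonneg hc (sq_nonneg ‖x‖)]
    refine h1.trans ?_
    rw [show ((1 + c) * (1 + ‖x‖ ^ 2)) * (b * (‖x‖ ^ 2 + 1))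
      = (1 + c) * b * (1 + ‖x‖ ^ 2) ^ 2 by ring, mul_assoc _ (2 : ℝ)]
    gcongr
    nlinarith [sq_nonneg (‖x‖ ^ 2 - 1), sq_nonneg (‖y‖ ^ 2)]
  have s2 : ∫ ω, ‖T (e i ω)‖ ^ 2 * (b * (‖e i ω‖ ^ 2 + 1)) ∂P
      ≤ b * (∫ ω, ‖e i ω‖ ^ 4 ∂P + (1 + c) * ∫ ω, ‖e i ω‖ ^ 2 ∂P + c) := by
    have : ∀ ω, ‖T (e i ω)‖ ^ 2 * (b * (‖e i ω‖ ^ 2 + 1))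
        ≤ b * (‖e i ω‖ ^ 4 + (1 + c) * ‖e i ω‖ ^ 2 + c) := by
      intro ω
      have h1 := mul_le_mul_of_nonneg_right (hT.norm_sq_le' (e i ω))
        (by positivity : 0 ≤ b * (‖e i ω‖ ^ 2 + 1))
      linarith
    refine (integral_mono i6
      (((i4.fun_add (i1.const_mul _)).fun_add (integrable_const _)).const_mul b)
      this).trans ?_
    rw [integral_const_mul, integral_add (i4.fun_add (i1.const_mul _)) (integrable_const _),
      integral_add i4 (i1.const_mul _), integral_const_mul]
    simp
  have s3 : ∫ ω, ‖ξ i ω‖ ^ 4 ∂P ≤ b * (∫ ω, ‖e i ω‖ ^ 4 ∂P + 1) := by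
    have := h.fourth_moment i
    rwa [integral_const_mul, integral_add i4 (integrable_const _), integral_const, probReal_univ,
      one_smul] at this
  -- The squared norm of the step is squared; the terms of odd order in the noise other than the
  -- linear one, which integrates to zero, are absorbed by Young's inequality.
  have hpt : ∀ ω, ‖e (i + 1) ω‖ ^ 4 ≤ ((1 - q) * ‖e i ω‖ ^ 4 + (2 * c * ‖e i ω‖ ^ 2 + c ^ 2))
      + 4 * μ * inner ℝ (‖T (e i ω)‖ ^ 2 • (T (e i ω) - μ • S (T (e i ω)))) (ξ i ω)
      + 8 * μ ^ 2 * (1 + ‖S‖) ^ 2 * (‖T (e i ω)‖ ^ 2 * ‖ξ i ω‖ ^ 2)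
      + 3 * μ ^ 4 * (1 + ‖S‖) ^ 4 * ‖ξ i ω‖ ^ 4 := by
    intro ω
    have e1 : ‖e (i + 1) ω‖ ^ 4 = (‖e (i + 1) ω‖ ^ 2) ^ 2 := by ring
    have e2 := h.norm_step_sq hT.symmetric i ω
    have e3 := norm_sub_smul_apply_le S hT.pos hT.le_one (ξ i ω)
    rw [inner_smul_left, ← inner_sub_smul_apply_comm hT.symmetric]
    rw [← inner_sub_smul_apply_comm hT.symmetric] at e2
    have e4 := abs_real_inner_le_norm (T (e i ω)) (ξ i ω - μ • S (ξ i ω))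
    have e5 := hT.norm_sq_le (e i ω)
    simp only [RCLike.conj_to_real]
    set t := ‖T (e i ω)‖
    set x := ‖e i ω‖
    set y := ‖ξ i ω‖
    set z := ‖ξ i ω - μ • S (ξ i ω)‖
    set w := inner ℝ (T (e i ω)) (ξ i ω - μ • S (ξ i ω))
    have ht : 0 ≤ t := norm_nonneg _
    have hz : 0 ≤ z := norm_nonneg _
    have f1 : (t ^ 2 + 2 * μ * w + μ ^ 2 * z ^ 2) ^ 2
        ≤ t ^ 4 + 4 * μ * (t ^ 2 * w) + 8 * μ ^ 2 * (t ^ 2 * z ^ 2) + 3 * μ ^ 4 * z ^ 4 := by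
      have g1 : w ^ 2 ≤ (t * z) ^ 2 := sq_le_sq' (abs_le.1 e4).1 (abs_le.1 e4).2
      have g2 : (t * z) * (μ * z ^ 2) * 2 ≤ (t * z) ^ 2 + (μ * z ^ 2) ^ 2 := by
        nlinarith [sq_nonneg (t * z - μ * z ^ 2)]
      have g3 : w * (μ * z ^ 2) ≤ (t * z) * (μ * z ^ 2) := by
        have := (abs_le.1 e4).2
        gcongr
      have g4 := mul_le_mul_of_nonneg_left g1 (by positivity : 0 ≤ 4 * μ ^ 2)
      have g5 := mul_le_mul_of_nonneg_left g2 (by positivity : 0 ≤ 2 * μ ^ 2)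
      have g6 := mul_le_mul_of_nonneg_left g3 (by positivity : 0 ≤ 4 * μ ^ 2)
      nlinarith
    have f2 : t ^ 4 ≤ (1 - q) * x ^ 4 + (2 * c * x ^ 2 + c ^ 2) := by
      have g1 : (t ^ 2) ^ 2 ≤ ((1 - q) * x ^ 2 + c) ^ 2 := by gcongr
      have g2 : 0 ≤ q * (1 - q) * x ^ 4 :=
        mul_nonneg (mul_nonneg hq (by linarith)) (by positivity)
      have g3 : 0 ≤ q * (c * x ^ 2) := by positivity
      nlinarith
    have f3 : z ^ 2 ≤ (1 + ‖S‖) ^ 2 * y ^ 2 := by rw [← mul_pow]; gcongr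
    have f4 : z ^ 4 ≤ (1 + ‖S‖) ^ 4 * y ^ 4 := by rw [← mul_pow]; gcongr
    have f5 := mul_le_mul_of_nonneg_left f3 (by positivity : 0 ≤ 8 * μ ^ 2 * t ^ 2)
    have f6 := mul_le_mul_of_nonneg_left f4 (by positivity : 0 ≤ 3 * μ ^ 4)
    rw [e1, e2]
    linarith
  calc ∫ ω, ‖e (i + 1) ω‖ ^ 4 ∂P
      ≤ ∫ ω, (((1 - q) * ‖e i ω‖ ^ 4 + (2 * c * ‖e i ω‖ ^ 2 + c ^ 2))
      + 4 * μ * inner ℝ (‖T (e i ω)‖ ^ 2 • (T (e i ω) - μ • S (T (e i ω)))) (ξ i ω)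
      + 8 * μ ^ 2 * (1 + ‖S‖) ^ 2 * (‖T (e i ω)‖ ^ 2 * ‖ξ i ω‖ ^ 2)
      + 3 * μ ^ 4 * (1 + ‖S‖) ^ 4 * ‖ξ i ω‖ ^ 4) ∂P :=
        integral_mono (integrable_norm_pow_four (h.memLp_error _))
          (((((i4.const_mul _).fun_add ((i1.const_mul _).fun_add (integrable_const _))).fun_add
            (i3.const_mul _)).fun_add (i5.const_mul _)).fun_add (j4.const_mul _)) hpt
    _ = (1 - q) * ∫ ω, ‖e i ω‖ ^ 4 ∂P + (2 * c * ∫ ω, ‖e i ω‖ ^ 2 ∂P + c ^ 2)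
      + 8 * μ ^ 2 * (1 + ‖S‖) ^ 2 * ∫ ω, ‖T (e i ω)‖ ^ 2 * ‖ξ i ω‖ ^ 2 ∂P
      + 3 * μ ^ 4 * (1 + ‖S‖) ^ 4 * ∫ ω, ‖ξ i ω‖ ^ 4 ∂P := by
        rw [integral_add ((((i4.const_mul _).fun_add
            ((i1.const_mul _).fun_add (integrable_const _))).fun_add (i3.const_mul _)).fun_add
            (i5.const_mul _)) (j4.const_mul _),
          integral_add (((i4.const_mul _).fun_add
            ((i1.const_mul _).fun_add (integrable_const _))).fun_add (i3.const_mul _)) (i5.const_mul _),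
          integral_add ((i4.const_mul _).fun_add ((i1.const_mul _).fun_add (integrable_const _)))
            (i3.const_mul _),
          integral_add (i4.const_mul _) ((i1.const_mul _).fun_add (integrable_const _)),
          integral_add (i1.const_mul _) (integrable_const _), integral_const_mul,
          integral_const_mul, integral_const_mul, integral_const_mul, integral_const_mul, o1]
        simp
    _ ≤ _ := by
        exact add_le_add (add_le_add le_rfl (mul_le_mul_of_nonneg_left (s1.trans s2)
          (by positivity))) (mul_le_mul_of_nonneg_left s3 (by positivity))

end Moments

/-! ### Steady state for small step-sizes -/

section SteadyState

variable {Ω : Type*} [MeasurableSpace Ω] {P : Measure Ω} [IsProbabilityMeasure P]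
variable {E : Type*} [NormedAddCommGroup E] [InnerProductSpace ℝ E]
variable {Φ Ψ : E → E} {Hop S : E →L[ℝ] E} {ν K b : ℝ}

lemma IsDrift.hasContractiveStep (h : IsDrift Φ Ψ Hop ν K) (hS : (S : E →ₗ[ℝ] E).IsSymmetric) :
    ∃ C μ₁ : ℝ, 0 ≤ C ∧ 0 < μ₁ ∧ μ₁ ≤ 1 ∧ ∀ μ, 0 < μ → μ < μ₁ →
      HasContractiveStep (driftStep Φ Ψ μ) S μ (μ * ν) (C * μ ^ 3) := by
  obtain ⟨C, μ₁, hC, hμ₁, hμ₁', H⟩ := h.norm_driftStep_sq_le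
  have hν := h.pos
  refine ⟨C, min μ₁ (1 / ν), hC, by positivity, (min_le_left _ _).trans hμ₁', fun μ hμ hμ' => ?_⟩
  refine ⟨h.continuous_driftStep μ, hS, hμ, (hμ'.le.trans (min_le_left _ _)).trans hμ₁',
    by positivity, (le_div_iff₀ hν).1 (hμ'.le.trans (min_le_right _ _)), by positivity,
    H μ hμ (hμ'.trans_le (min_le_left _ _))⟩

/-- For small step-sizes the mean-square error is eventually `O(μ)` and the mean fourth power of
the error is eventually `O(μ²)`. -/
lemma IsDrift.eventually_moments_le (h : IsDrift Φ Ψ Hop ν K)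
    (hS : (S : E →ₗ[ℝ] E).IsSymmetric) (hb : 0 ≤ b) :
    ∃ D μ₁ : ℝ, 0 ≤ D ∧ 0 < μ₁ ∧ μ₁ ≤ 1 ∧ ∀ μ, 0 < μ → μ < μ₁ → ∀ e ξ : ℕ → Ω → E,
      IsNoisyRecursion P (driftStep Φ Ψ μ) S μ b e ξ →
      ∀ᶠ i in atTop, ∫ ω, ‖e i ω‖ ^ 2 ∂P ≤ D * μ ∧ ∫ ω, ‖e i ω‖ ^ 4 ∂P ≤ D * μ ^ 2 := by
  obtain ⟨C, μ₁, hC, hμ₁, hμ₁', H⟩ := h.hasContractiveStep hS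
  have hν := h.pos
  set B := (1 + ‖S‖) ^ 2 * b with hB
  set B' := (1 + ‖S‖) ^ 4 * b with hB'
  have hB0 : 0 ≤ B := by positivity
  have hB0' : 0 ≤ B' := by positivity
  set D₂ := 2 * (C + B) / ν + 1 with hD₂
  have hD0 : 0 ≤ D₂ := by positivity
  set D₃ := 2 * C * D₂ + C ^ 2 + 8 * B * ((1 + C) * D₂ + C) + 3 * B' with hD₃
  have hD3 : 0 ≤ D₃ := by positivity
  set D₄ := 2 * D₃ / ν + 1 with hD₄
  have hD4 : 0 ≤ D₄ := by positivity
  refine ⟨D₂ + D₄, min μ₁ (ν / (2 * (8 * B + 3 * B' + 1))), by positivity, by positivity,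
    (min_le_left _ _).trans hμ₁', fun μ hμ hμ' e ξ hN => ?_⟩
  have hT := H μ hμ (hμ'.trans_le (min_le_left _ _))
  have hμ1 := hT.le_one
  have hq : 0 < μ * ν / 2 := by positivity
  have hq1 : μ * ν / 2 ≤ 1 := by linarith [hT.rate_le_one]
  have hμν : μ * (8 * B + 3 * B' + 1) ≤ ν / 2 := by
    have := (le_div_iff₀ (by positivity)).1 (hμ'.le.trans (min_le_right _ _))
    linarith
  have p2 (i) : 0 ≤ ∫ ω, ‖e i ω‖ ^ 2 ∂P := integral_nonneg fun ω => by positivity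
  have p4 (i) : 0 ≤ ∫ ω, ‖e i ω‖ ^ 4 ∂P := integral_nonneg fun ω => by positivity
  have h32 : μ ^ 3 ≤ μ ^ 2 := pow_le_pow_of_le_one hμ.le hμ1 (by norm_num)
  have h43 : μ ^ 4 ≤ μ ^ 3 := pow_le_pow_of_le_one hμ.le hμ1 (by norm_num)
  have h53 : μ ^ 5 ≤ μ ^ 3 := pow_le_pow_of_le_one hμ.le hμ1 (by norm_num)
  have h63 : μ ^ 6 ≤ μ ^ 3 := pow_le_pow_of_le_one hμ.le hμ1 (by norm_num)
  have h42 : μ ^ 4 ≤ μ ^ 2 := pow_le_pow_of_le_one hμ.le hμ1 (by norm_num)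
  have hμB : μ * (8 * B + 3 * B') ≤ ν / 2 := by linarith
  have hμB1 : μ * B ≤ ν / 2 := by nlinarith [mul_nonneg hμ.le hB0, mul_nonneg hμ.le hB0']
  have r2 : ∀ᶠ i in atTop, ∫ ω, ‖e (i + 1) ω‖ ^ 2 ∂P
      ≤ (1 - μ * ν / 2) * ∫ ω, ‖e i ω‖ ^ 2 ∂P + (C + B) * μ ^ 2 := by
    refine Eventually.of_forall fun i => (hN.integral_sq_step_le hT i).trans ?_
    have h1 := mul_le_mul_of_nonneg_right (mul_le_mul_of_nonneg_left hμB1 hμ.le) (p2 i)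
    have h2 := mul_le_mul_of_nonneg_left h32 hC
    set m := ∫ ω, ‖e i ω‖ ^ 2 ∂P
    have : μ ^ 2 * (1 + ‖S‖) ^ 2 * (b * (m + 1)) = μ * (μ * B) * m + B * μ ^ 2 := by
      rw [hB]; ring
    rw [this]
    linarith
  have e2 := eventually_le_of_recursion (a := fun i => ∫ ω, ‖e i ω‖ ^ 2 ∂P) hq hq1 hμ r2
  have e2' : ∀ᶠ i in atTop, ∫ ω, ‖e i ω‖ ^ 2 ∂P ≤ D₂ * μ := by
    refine e2.mono fun i hi => hi.trans_eq ?_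
    rw [hD₂]; field_simp
  have r4 : ∀ᶠ i in atTop, ∫ ω, ‖e (i + 1) ω‖ ^ 4 ∂P
      ≤ (1 - μ * ν / 2) * ∫ ω, ‖e i ω‖ ^ 4 ∂P + D₃ * μ ^ 3 := by
    refine e2'.mono fun i hi => (hN.integral_pow_four_step_le hb hT i).trans ?_
    have q2 := p2 i
    have q4 := p4 i
    set m := ∫ ω, ‖e i ω‖ ^ 2 ∂P
    set n := ∫ ω, ‖e i ω‖ ^ 4 ∂P
    have a1 : 8 * μ ^ 2 * (1 + ‖S‖) ^ 2 * (b * (n + (1 + C * μ ^ 3) * m + C * μ ^ 3))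
        = 8 * B * μ ^ 2 * n + 8 * B * (μ ^ 2 * m + C * μ ^ 5 * m + C * μ ^ 5) := by rw [hB]; ring
    have a2 : 3 * μ ^ 4 * (1 + ‖S‖) ^ 4 * (b * (n + 1)) = 3 * B' * μ ^ 4 * n + 3 * B' * μ ^ 4 := by
      rw [hB']; ring
    have a3 : μ ^ 2 * m ≤ D₂ * μ ^ 3 := by
      have := mul_le_mul_of_nonneg_left hi (by positivity : 0 ≤ μ ^ 2)
      linarith
    have a4 : μ ^ 3 * m ≤ D₂ * μ ^ 3 := by
      have := mul_le_mul_of_nonneg_right h32 q2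
      linarith
    have a5 : μ ^ 5 * m ≤ D₂ * μ ^ 3 := by
      have := mul_le_mul_of_nonneg_right h53 q2
      linarith
    have a6 : 8 * B * μ ^ 2 * n + 3 * B' * μ ^ 4 * n ≤ μ * ν / 2 * n := by
      have : 3 * B' * μ ^ 4 * n ≤ 3 * B' * μ ^ 2 * n := by gcongr
      have := mul_le_mul_of_nonneg_right (mul_le_mul_of_nonneg_left hμB hμ.le) q4
      linarith
    have a7 : 8 * B * (μ ^ 2 * m + C * μ ^ 5 * m + C * μ ^ 5)
        ≤ 8 * B * (D₂ * μ ^ 3 + C * (D₂ * μ ^ 3) + C * μ ^ 3) := by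
      rw [mul_assoc C]
      gcongr
    have a8 : C * (μ ^ 3 * m) ≤ C * (D₂ * μ ^ 3) := by gcongr
    have a9 : C ^ 2 * μ ^ 6 ≤ C ^ 2 * μ ^ 3 := by gcongr
    have a10 : 3 * B' * μ ^ 4 ≤ 3 * B' * μ ^ 3 := by gcongr
    rw [a1, a2, hD₃]
    linarith
  have e4 := eventually_le_of_recursion (a := fun i => ∫ ω, ‖e i ω‖ ^ 4 ∂P) hq hq1
    (by positivity : 0 < μ ^ 2) r4
  filter_upwards [e2', e4] with i h2 h4
  constructor
  · refine h2.trans ?_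
    gcongr
    linarith
  · have : D₃ * μ ^ 3 / (μ * ν / 2) + μ ^ 2 = D₄ * μ ^ 2 := by rw [hD₄]; field_simp
    rw [this] at h4
    refine h4.trans ?_
    gcongr
    linarith

lemma inner_sq_le_norm_sq {u : E} (hu : ‖u‖ = 1) (x : E) : inner ℝ u x ^ 2 ≤ ‖x‖ ^ 2 := by
  rw [sq_le_sq, abs_norm]
  simpa [hu] using abs_real_inner_le_norm u x

section Step

variable {T : E → E} {μ q c : ℝ} {e ξ : ℕ → Ω → E}

lemma IsNoisyRecursion.integrable_inner_error_sq (h : IsNoisyRecursion P T S μ b e ξ) (i : ℕ)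
    {u : E} (hu : ‖u‖ = 1) : Integrable (fun ω => inner ℝ u (e i ω) ^ 2) P :=
  h.integrable_of_le i (f := fun x _ => inner ℝ u x ^ 2) (by unfold Function.uncurry; fun_prop) 1
    fun x y => by
      rw [abs_of_nonneg (by positivity)]
      linarith [inner_sq_le_norm_sq hu x, sq_le_one_add_pow_four ‖x‖, pow_nonneg (norm_nonneg y) 4]

lemma IsNoisyRecursion.integrable_inner_noise_sq (h : IsNoisyRecursion P T S μ b e ξ) (i : ℕ)
    {u : E} (hu : ‖u‖ = 1) : Integrable (fun ω => inner ℝ u (ξ i ω) ^ 2) P :=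
  h.integrable_of_le i (f := fun _ y => inner ℝ u y ^ 2) (by unfold Function.uncurry; fun_prop) 1
    fun x y => by
      rw [abs_of_nonneg (by positivity)]
      linarith [inner_sq_le_norm_sq hu y, sq_le_one_add_pow_four ‖y‖, pow_nonneg (norm_nonneg x) 4]

lemma IsNoisyRecursion.integrable_inner_step_sq (h : IsNoisyRecursion P T S μ b e ξ)
    (hT : HasContractiveStep T S μ q c) (i : ℕ) {u : E} (hu : ‖u‖ = 1) :
    Integrable (fun ω => inner ℝ u (T (e i ω)) ^ 2) P := by
  have hTc := hT.continuous
  have hc := hT.const_nonneg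
  refine h.integrable_of_le i (f := fun x _ => inner ℝ u (T x) ^ 2)
    (by unfold Function.uncurry; fun_prop) (1 + c) fun x y => ?_
  rw [abs_of_nonneg (by positivity)]
  have h3 := sq_le_one_add_pow_four ‖x‖
  have h4 := hT.norm_sq_le' x
  have h5 : 0 ≤ (1 + c) * ‖y‖ ^ 4 := by positivity
  have h6 : 0 ≤ c * ‖x‖ ^ 4 := by positivity
  linarith [inner_sq_le_norm_sq hu (T x)]

/-- One step of the recursion for the mean square of the error along a unit vector `u`. -/
lemma IsNoisyRecursion.abs_integral_inner_sq_step_sub_le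
    (h : IsNoisyRecursion P T S μ b e ξ) (hT : HasContractiveStep T S μ q c) (i : ℕ)
    {u : E} (hu : ‖u‖ = 1) :
    |∫ ω, inner ℝ u (e (i + 1) ω) ^ 2 ∂P - ∫ ω, inner ℝ u (T (e i ω)) ^ 2 ∂P
        - μ ^ 2 * ∫ ω, inner ℝ u (ξ i ω) ^ 2 ∂P|
      ≤ μ ^ 3 * (2 * ‖S‖ + ‖S‖ ^ 2) * (b * (∫ ω, ‖e i ω‖ ^ 2 ∂P + 1)) := by
  have hμ := hT.pos
  have hμ1 := hT.le_one
  have hc := hT.const_nonneg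
  have hTc := hT.continuous
  have hadj : ‖u - μ • S u‖ ≤ 1 + ‖S‖ := by
    simpa [hu] using norm_sub_smul_apply_le S hμ hμ1 u
  have i0 (j) := h.integrable_inner_error_sq j hu
  have i1 := h.integrable_inner_noise_sq i hu
  have i2 := h.integrable_inner_step_sq hT i hu
  have gr (x : E) : ‖inner ℝ u (T x) • (u - μ • S u)‖ ≤ (1 + c) * (1 + ‖S‖) * (1 + ‖x‖) := by
    rw [norm_smul]
    have h1 : ‖inner ℝ u (T x)‖ ≤ (1 + c) * (1 + ‖x‖) := by
      refine le_trans ?_ (hT.norm_le x)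
      simpa [hu] using norm_inner_le_norm (𝕜 := ℝ) u (T x)
    calc _ ≤ ((1 + c) * (1 + ‖x‖)) * (1 + ‖S‖) := by gcongr
      _ = _ := by ring
  have i3 : Integrable (fun ω => inner ℝ (inner ℝ u (T (e i ω)) • (u - μ • S u)) (ξ i ω)) P := by
    refine h.integrable_of_le i (f := fun x y => inner ℝ (inner ℝ u (T x) • (u - μ • S u)) y)
      (by unfold Function.uncurry; fun_prop) ((1 + c) * (1 + ‖S‖) * 4) fun x y => ?_
    refine (abs_real_inner_le_norm _ _).trans ?_
    refine (mul_le_mul_of_nonneg_right (gr x) (norm_nonneg y)).trans ?_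
    rw [mul_assoc _ _ ‖y‖, mul_assoc _ (4 : ℝ)]
    refine mul_le_mul_of_nonneg_left ?_ (by positivity)
    nlinarith [sq_nonneg (‖x‖ - ‖y‖), sq_le_one_add_pow_four ‖x‖, sq_le_one_add_pow_four ‖y‖,
      sq_nonneg (‖y‖ - 1), pow_nonneg (norm_nonneg x) 4, pow_nonneg (norm_nonneg y) 4]
  have o1 := h.orthogonal i (fun x => inner ℝ u (T x) • (u - μ • S u)) (by fun_prop)
    ⟨(1 + c) * (1 + ‖S‖) * 2, fun x => by
      refine (gr x).trans ?_
      rw [mul_assoc _ (2 : ℝ)]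
      refine mul_le_mul_of_nonneg_left ?_ (by positivity)
      have := norm_nonneg x
      nlinarith [mul_nonneg this (sq_nonneg (‖x‖ - 1)), sq_nonneg (‖x‖ - 1)]⟩
  have i5 := h.integrable_noise_sq i
  have hpt : ∀ ω, |inner ℝ u (e (i + 1) ω) ^ 2 - inner ℝ u (T (e i ω)) ^ 2
      - μ ^ 2 * inner ℝ u (ξ i ω) ^ 2
      - 2 * μ * inner ℝ (inner ℝ u (T (e i ω)) • (u - μ • S u)) (ξ i ω)|
      ≤ μ ^ 3 * (2 * ‖S‖ + ‖S‖ ^ 2) * ‖ξ i ω‖ ^ 2 := by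
    intro ω
    set y := ξ i ω
    rw [h.step, inner_add_right, inner_smul_right, inner_smul_left, inner_sub_smul_apply_comm
      hT.symmetric]
    simp only [RCLike.conj_to_real]
    set a := inner ℝ u y
    set d := inner ℝ (S u) y
    have e1 : inner ℝ (u - μ • S u) y = a - μ * d := by
      rw [inner_sub_left, inner_smul_left]; simp [a, d]
    have ha : |a| ≤ ‖y‖ := by simpa [hu] using abs_real_inner_le_norm u y
    have hd : |d| ≤ ‖S‖ * ‖y‖ := by
      refine (abs_real_inner_le_norm _ _).trans ?_
      gcongr
      simpa [hu] using S.le_opNorm u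
    rw [e1, show (inner ℝ u (T (e i ω)) + μ * (a - μ * d)) ^ 2 - inner ℝ u (T (e i ω)) ^ 2
      - μ ^ 2 * a ^ 2 - 2 * μ * (inner ℝ u (T (e i ω)) * (a - μ * d))
      = μ ^ 3 * (-(2 * a * d) + μ * d ^ 2) by ring, abs_mul, abs_of_nonneg (by positivity :
        0 ≤ μ ^ 3), mul_assoc (μ ^ 3)]
    refine mul_le_mul_of_nonneg_left ?_ (by positivity)
    refine (abs_add_le _ _).trans ?_
    rw [abs_neg, abs_mul, abs_mul, abs_two, abs_mul, abs_of_nonneg hμ.le, abs_pow]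
    have h1 : |a| * |d| ≤ ‖y‖ * (‖S‖ * ‖y‖) := by gcongr
    have h2 : μ * |d| ^ 2 ≤ 1 * (‖S‖ * ‖y‖) ^ 2 := by gcongr
    nlinarith
  have key : ∫ ω, inner ℝ u (e (i + 1) ω) ^ 2 ∂P - ∫ ω, inner ℝ u (T (e i ω)) ^ 2 ∂P
      - μ ^ 2 * ∫ ω, inner ℝ u (ξ i ω) ^ 2 ∂P
      = ∫ ω, (inner ℝ u (e (i + 1) ω) ^ 2 - inner ℝ u (T (e i ω)) ^ 2
      - μ ^ 2 * inner ℝ u (ξ i ω) ^ 2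
      - 2 * μ * inner ℝ (inner ℝ u (T (e i ω)) • (u - μ • S u)) (ξ i ω)) ∂P := by
    have k1 : Integrable (fun ω => inner ℝ u (e (i + 1) ω) ^ 2 - inner ℝ u (T (e i ω)) ^ 2) P :=
      (i0 (i + 1)).sub i2
    have k2 : Integrable (fun ω => inner ℝ u (e (i + 1) ω) ^ 2 - inner ℝ u (T (e i ω)) ^ 2
      - μ ^ 2 * inner ℝ u (ξ i ω) ^ 2) P := k1.sub (i1.const_mul _)
    rw [integral_sub k2 (i3.const_mul _), integral_sub k1 (i1.const_mul _),
      integral_sub (i0 (i + 1)) i2,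
      integral_const_mul, integral_const_mul, o1]
    simp
  rw [key]
  refine (norm_integral_le_of_norm_le (i5.const_mul _) 
    (Eventually.of_forall fun ω => (Real.norm_eq_abs _).trans_le (hpt ω))).trans ?_
  rw [integral_const_mul]
  exact mul_le_mul_of_nonneg_left (h.integral_noise_sq_le i) (by positivity)

/-- The linearization of the drift step along an eigenvector, in expectation. -/
lemma IsNoisyRecursion.abs_integral_inner_step_sq_sub_le (h : IsNoisyRecursion P T S μ b e ξ)
    (hT : HasContractiveStep T S μ q c) (i : ℕ) {u : E} (hu : ‖u‖ = 1) {ρ C γ : ℝ}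
    (H : ∀ x, |inner ℝ u (T x) ^ 2 - γ * inner ℝ u x ^ 2|
      ≤ ρ * (μ ^ 2 + μ * ‖x‖ ^ 2) + C * (μ * ‖x‖ ^ 4 + μ ^ 2 * ‖x‖ ^ 2 + μ ^ 3)) :
    |∫ ω, inner ℝ u (T (e i ω)) ^ 2 ∂P - γ * ∫ ω, inner ℝ u (e i ω) ^ 2 ∂P|
      ≤ ρ * (μ ^ 2 + μ * ∫ ω, ‖e i ω‖ ^ 2 ∂P) + C * (μ * ∫ ω, ‖e i ω‖ ^ 4 ∂P
        + μ ^ 2 * ∫ ω, ‖e i ω‖ ^ 2 ∂P + μ ^ 3) := by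
  have i0 := h.integrable_inner_error_sq i hu
  have i2 := h.integrable_inner_step_sq hT i hu
  have j2 := h.integrable_error_sq i
  have j4 := integrable_norm_pow_four (h.memLp_error i)
  have k1 : Integrable (fun ω => ρ * (μ ^ 2 + μ * ‖e i ω‖ ^ 2)) P :=
    ((integrable_const _).fun_add (j2.const_mul μ)).const_mul ρ
  have k2 : Integrable (fun ω => μ * ‖e i ω‖ ^ 4 + μ ^ 2 * ‖e i ω‖ ^ 2) P :=
    (j4.const_mul μ).fun_add (j2.const_mul (μ ^ 2))
  have k3 : Integrable (fun ω => C * (μ * ‖e i ω‖ ^ 4 + μ ^ 2 * ‖e i ω‖ ^ 2 + μ ^ 3)) P :=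
    (k2.fun_add (integrable_const _)).const_mul C
  rw [← integral_const_mul, ← integral_sub i2 (i0.const_mul _)]
  refine (norm_integral_le_of_norm_le (k1.fun_add k3)
    (Eventually.of_forall fun ω => (Real.norm_eq_abs _).trans_le (H (e i ω)))).trans_eq ?_
  rw [integral_add k1 k3, integral_const_mul, integral_const_mul,
    integral_add (integrable_const _) (j2.const_mul μ), integral_add k2 (integrable_const _),
    integral_add (j4.const_mul μ) (j2.const_mul (μ ^ 2)), integral_const_mul,
    integral_const_mul, integral_const_mul]
  simp

end Step

variable {μ₀ : ℝ} {e ξ : ℝ → ℕ → Ω → E}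

set_option maxHeartbeats 1000000 in
/-- Along a unit eigenvector `u` of the linearized drift, with eigenvalue `θ`, the mean square of
the error settles at `μ r / (2 θ)` to leading order, where `r` is the limiting noise variance
along `u`. -/
lemma IsDrift.eventually_abs_integral_inner_sq_sub_le (h : IsDrift Φ Ψ Hop ν K)
    (hH : (Hop : E →ₗ[ℝ] E).IsSymmetric) (hS : (S : E →ₗ[ℝ] E).IsSymmetric) (hb : 0 ≤ b)
    (hμ₀ : 0 < μ₀)
    (hN : ∀ μ, 0 < μ → μ < μ₀ → IsNoisyRecursion P (driftStep Φ Ψ μ) S μ b (e μ) (ξ μ))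
    {u : E} {θ r : ℝ} (hu : ‖u‖ = 1) (hθ : 0 < θ) (hHu : Hop u = θ • u)
    (hr : ∀ ρ > 0, ∃ C, ∀ μ, 0 < μ → μ < μ₀ → ∀ᶠ i in atTop,
      |∫ ω, inner ℝ u (ξ μ i ω) ^ 2 ∂P - r| ≤ ρ + C * ∫ ω, ‖e μ i ω‖ ^ 2 ∂P)
    {ε : ℝ} (hε : 0 < ε) :
    ∃ μ₁ > 0, ∀ μ, 0 < μ → μ < μ₁ → ∀ᶠ i in atTop,
      |(∫ ω, inner ℝ u (e μ i ω) ^ 2 ∂P) / μ - r / (2 * θ)| ≤ ε := by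
  obtain ⟨C₁, μ₁, -, hμ₁, hμ₁', hcon⟩ := h.hasContractiveStep hS
  obtain ⟨D, μ₂, hD, hμ₂, -, hmom⟩ := h.eventually_moments_le (P := P) hS hb
  -- The recursion may be perturbed by `2 ε' μ²` in each step.
  set ε' := ε / (2 * (2 / θ + 1)) with hε'
  have hε0 : 0 < ε' := by positivity
  set ρ := ε' / (2 + D) with hρ
  have hρ0 : 0 < ρ := by positivity
  obtain ⟨C₃, hC₃, hlin⟩ := h.abs_inner_driftStep_sq_sub_le hρ0
  obtain ⟨C₄, hC₄⟩ := hr ρ hρ0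
  set L := C₃ * (2 * D + 1) + |C₄| * D + (2 * ‖S‖ + ‖S‖ ^ 2) * (b * (D + 1)) with hL
  have hL0 : 0 ≤ L := by positivity
  refine ⟨min (min μ₀ (min μ₁ μ₂)) (min (1 / θ) (min (ε' / (L + 1)) (ε / (|r| + 1)))),
    by positivity, fun μ hμ hμlt => ?_⟩
  obtain ⟨⟨hlt0, hlt1, hlt2⟩, hltθ, hltL, hltr⟩ :
      (μ < μ₀ ∧ μ < μ₁ ∧ μ < μ₂) ∧ μ < 1 / θ ∧ μ < ε' / (L + 1) ∧ μ < ε / (|r| + 1) := by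
    simpa only [lt_min_iff] using hμlt
  have hT := hcon μ hμ hlt1
  have hμ1 := hT.le_one
  have hN' := hN μ hμ hlt0
  have hμθ : μ * θ ≤ 1 := ((lt_div_iff₀ hθ).1 hltθ).le
  have hLε : μ * (L + 1) < ε' := (lt_div_iff₀ (by positivity)).1 hltL
  have hrε : μ * (|r| + 1) < ε := (lt_div_iff₀ (by positivity)).1 hltr
  have hHinner (x : E) : inner ℝ u (Hop x) = θ * inner ℝ u x := by
    have : inner ℝ (Hop u) x = inner ℝ u (Hop x) := hH u x
    rw [← this, hHu, inner_smul_left]; simp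
  have hlin' := hlin u θ hu hθ.le hHinner μ hμ hμ1 hμθ
  -- `1 - q = (1 - μ θ)²`
  set q := μ * θ * (2 - μ * θ) with hq
  have hq0 : μ * θ ≤ q := by
    rw [hq]; nlinarith [show 0 < μ * θ by positivity]
  have hqpos : 0 < q := lt_of_lt_of_le (by positivity) hq0
  have hq1 : q ≤ 1 := by rw [hq]; nlinarith [sq_nonneg (1 - μ * θ)]
  have hrec : ∀ᶠ i in atTop, |∫ ω, inner ℝ u (e μ (i + 1) ω) ^ 2 ∂P
      - ((1 - q) * ∫ ω, inner ℝ u (e μ i ω) ^ 2 ∂P + μ ^ 2 * r)| ≤ 2 * ε' * μ ^ 2 := by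
    filter_upwards [hmom μ hμ hlt2 (e μ) (ξ μ) hN', hC₄ μ hμ hlt0] with i ⟨hm2, hm4⟩ hvar
    have s1 := hN'.abs_integral_inner_sq_step_sub_le hT i hu
    have s2 := hN'.abs_integral_inner_step_sq_sub_le hT i hu hlin'
    rw [show (1 - μ * θ) ^ 2 = 1 - q by rw [hq]; ring] at s2
    have p2 : 0 ≤ ∫ ω, ‖e μ i ω‖ ^ 2 ∂P := integral_nonneg fun ω => by positivity
    set m := ∫ ω, ‖e μ i ω‖ ^ 2 ∂P
    set n := ∫ ω, ‖e μ i ω‖ ^ 4 ∂P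
    set p := ∫ ω, inner ℝ u (e μ i ω) ^ 2 ∂P
    set p' := ∫ ω, inner ℝ u (e μ (i + 1) ω) ^ 2 ∂P
    set t := ∫ ω, inner ℝ u (driftStep Φ Ψ μ (e μ i ω)) ^ 2 ∂P
    set w := ∫ ω, inner ℝ u (ξ μ i ω) ^ 2 ∂P
    have b1 : |p' - ((1 - q) * p + μ ^ 2 * r)| ≤ |p' - t - μ ^ 2 * w| + |t - (1 - q) * p|
        + μ ^ 2 * |w - r| := by
      rw [show p' - ((1 - q) * p + μ ^ 2 * r) = (p' - t - μ ^ 2 * w) + (t - (1 - q) * p)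
        + μ ^ 2 * (w - r) by ring]
      refine (abs_add_three _ _ _).trans_eq ?_
      rw [abs_mul, abs_of_nonneg (by positivity : 0 ≤ μ ^ 2)]
    have b2 : ρ * (μ ^ 2 + μ * m) ≤ ρ * (μ ^ 2 + μ * (D * μ)) := by gcongr
    have b3 : C₃ * (μ * n + μ ^ 2 * m + μ ^ 3)
        ≤ C₃ * (μ * (D * μ ^ 2) + μ ^ 2 * (D * μ) + μ ^ 3) := by gcongr
    have b4 : μ ^ 2 * |w - r| ≤ μ ^ 2 * (ρ + |C₄| * (D * μ)) := by
      have : C₄ * m ≤ |C₄| * (D * μ) :=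
        mul_le_mul (le_abs_self _) hm2 p2 (abs_nonneg _)
      gcongr
      linarith
    have b5 : μ ^ 3 * (2 * ‖S‖ + ‖S‖ ^ 2) * (b * (m + 1))
        ≤ μ ^ 3 * (2 * ‖S‖ + ‖S‖ ^ 2) * (b * (D + 1)) := by
      gcongr
      nlinarith
    have b6 : ρ * (2 + D) = ε' := by rw [hρ]; field_simp
    have b7 : μ ^ 2 * (μ * L) ≤ μ ^ 2 * ε' := by
      gcongr
      linarith
    have b8 : μ ^ 2 * (μ * L) = C₃ * (μ * (D * μ ^ 2) + μ ^ 2 * (D * μ) + μ ^ 3)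
        + μ ^ 2 * (|C₄| * (D * μ)) + μ ^ 3 * (2 * ‖S‖ + ‖S‖ ^ 2) * (b * (D + 1)) := by
      rw [hL]; ring
    have b9 : ρ * (μ ^ 2 + μ * (D * μ)) + μ ^ 2 * ρ = ε' * μ ^ 2 := by rw [← b6]; ring
    linarith
  filter_upwards [eventually_abs_sub_le_of_recursion
    (a := fun i => ∫ ω, inner ℝ u (e μ i ω) ^ 2 ∂P) hqpos hq1 (by positivity : 0 < ε' * μ) hrec]
    with i hi
  have c1 : 2 * ε' * μ ^ 2 / q ≤ 2 * ε' * μ / θ := by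
    rw [div_le_div_iff₀ hqpos hθ]
    have : 2 * ε' * μ * (μ * θ) ≤ 2 * ε' * μ * q := by gcongr
    linarith
  have c2 : |μ ^ 2 * r / q - μ * r / (2 * θ)| ≤ μ * (μ * |r| / 2) := by
    have h2 : (1 : ℝ) ≤ 2 - μ * θ := by linarith
    have h3 : 2 - μ * θ ≠ 0 := by linarith
    rw [show μ ^ 2 * r / q - μ * r / (2 * θ) = μ * (μ * r / 2) / (2 - μ * θ) by
      rw [hq]; field_simp; ring, abs_div, abs_of_pos (by linarith : 0 < 2 - μ * θ), abs_mul,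
      abs_div, abs_mul, abs_two, abs_of_pos hμ]
    exact div_le_self (by positivity) h2
  have c3 : (∫ ω, inner ℝ u (e μ i ω) ^ 2 ∂P) / μ - r / (2 * θ)
      = ((∫ ω, inner ℝ u (e μ i ω) ^ 2 ∂P - μ ^ 2 * r / q)
        + (μ ^ 2 * r / q - μ * r / (2 * θ))) / μ := by
    field_simp; ring
  rw [c3, abs_div, abs_of_pos hμ, div_le_iff₀ hμ]
  refine (abs_add_le _ _).trans ?_
  have c4 : ε' * (2 / θ + 1) = ε / 2 := by rw [hε']; field_simp
  have c5 : 2 * ε' * μ / θ + ε' * μ = ε / 2 * μ := by rw [← c4]; ring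
  have c6 : μ * (μ * |r| / 2) ≤ ε / 2 * μ := by nlinarith
  linarith

/-- The steady-state mean-square error is `μ ∑ j, r j / (2 * θ j)` to leading order in the step-size,
where `θ j` are the eigenvalues of the linearized drift and `r j` the limiting noise variances
along its eigenvectors. -/
theorem IsDrift.eventually_abs_integral_norm_sq_sub_le (h : IsDrift Φ Ψ Hop ν K)
    (hH : (Hop : E →ₗ[ℝ] E).IsSymmetric) (hS : (S : E →ₗ[ℝ] E).IsSymmetric) (hb : 0 ≤ b)
    (hμ₀ : 0 < μ₀)
    (hN : ∀ μ, 0 < μ → μ < μ₀ → IsNoisyRecursion P (driftStep Φ Ψ μ) S μ b (e μ) (ξ μ))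
    {ι : Type*} [Fintype ι] (u : OrthonormalBasis ι ℝ E) {θ r : ι → ℝ} (hθ : ∀ j, 0 < θ j)
    (hHu : ∀ j, Hop (u j) = θ j • u j)
    (hr : ∀ j, ∀ ρ > 0, ∃ C, ∀ μ, 0 < μ → μ < μ₀ → ∀ᶠ i in atTop,
      |∫ ω, inner ℝ (u j) (ξ μ i ω) ^ 2 ∂P - r j| ≤ ρ + C * ∫ ω, ‖e μ i ω‖ ^ 2 ∂P)
    {ε : ℝ} (hε : 0 < ε) :
    ∃ μ₁ > 0, ∀ μ, 0 < μ → μ < μ₁ → ∀ᶠ i in atTop,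
      |(∫ ω, ‖e μ i ω‖ ^ 2 ∂P) / μ - ∑ j, r j / (2 * θ j)| ≤ ε := by
  have hε' : 0 < ε / (Fintype.card ι + 1) := by positivity
  choose μ₁ hμ₁ H using fun j => h.eventually_abs_integral_inner_sq_sub_le hH hS hb hμ₀ hN
    (u.norm_eq_one j) (hθ j) (hHu j) (hr j) hε'
  obtain ⟨μ₂, hμ₂, hle⟩ : ∃ μ₂ > 0, ∀ j, μ₂ ≤ μ₁ j := by
    rcases isEmpty_or_nonempty ι with hι | hι
    · exact ⟨1, one_pos, fun j => (hι.false j).elim⟩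
    · obtain ⟨j₀, hj₀⟩ := Finite.exists_min μ₁
      exact ⟨μ₁ j₀, hμ₁ j₀, hj₀⟩
  refine ⟨min μ₀ μ₂, by positivity, fun μ hμ hlt => ?_⟩
  filter_upwards [eventually_all.2 fun j =>
    H j μ hμ ((hlt.trans_le (min_le_right _ _)).trans_le (hle j))] with i hi
  have hN' := hN μ hμ (hlt.trans_le (min_le_left _ _))
  have i0 (j) := hN'.integrable_inner_error_sq i (u.norm_eq_one j)
  have e1 : ∫ ω, ‖e μ i ω‖ ^ 2 ∂P = ∑ j, ∫ ω, inner ℝ (u j) (e μ i ω) ^ 2 ∂P := by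
    rw [← integral_finsetSum _ fun j _ => i0 j]
    refine integral_congr_ae (Eventually.of_forall fun ω => ?_)
    simp only
    rw [← u.sum_sq_norm_inner_right]
    simp
  rw [e1, Finset.sum_div, ← Finset.sum_sub_distrib]
  refine (Finset.abs_sum_le_sum_abs _ _).trans ((Finset.sum_le_card_nsmul _ _ _
    fun j _ => hi j).trans ?_)
  rw [nsmul_eq_mul, Finset.card_univ, ← mul_div_assoc, div_le_iff₀ (by positivity)]
  nlinarith

end SteadyState

/-! ### The individual costs -/

section Costs

variable {N M : ℕ} {J : Fin N → Vec M → ℝ} {lmin lmax : Fin N → ℝ}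

lemma toEuclideanCLM_hessian (f : Vec M → ℝ) (w : Vec M) :
    Matrix.toEuclideanCLM (n := Fin M) (𝕜 := ℝ) (hessian f w) = fderiv ℝ (gradient f) w :=
  StarAlgEquiv.apply_symm_apply _ _

lemma isPositive_toEuclideanCLM {B : Matrix (Fin M) (Fin M) ℝ} (hB : B.PosSemidef) :
    (Matrix.toEuclideanCLM (n := Fin M) (𝕜 := ℝ) B).IsPositive := by
  rw [← ContinuousLinearMap.isPositive_toLinearMap_iff,
    Matrix.coe_toEuclideanCLM_eq_toEuclideanLin, Matrix.isPositive_toEuclideanLin_iff]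
  exact hB

lemma toEuclideanCLM_smul_one (c : ℝ) :
    Matrix.toEuclideanCLM (n := Fin M) (𝕜 := ℝ) (c • (1 : Matrix (Fin M) (Fin M) ℝ))
      = c • ContinuousLinearMap.id ℝ (Vec M) := by
  rw [map_smul, map_one]; rfl

namespace StronglyConvexCosts

lemma isSymmetric (hJ : StronglyConvexCosts J lmin lmax) (k : Fin N) (w : Vec M) :
    (fderiv ℝ (gradient (J k)) w : Vec M →ₗ[ℝ] Vec M).IsSymmetric := by
  have h1 := (isPositive_toEuclideanCLM (hJ.lower k w)).isSymmetric
  rw [map_sub, toEuclideanCLM_hessian, toEuclideanCLM_smul_one] at h1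
  intro x y
  have := h1 x y
  simp only [ContinuousLinearMap.toLinearMap_sub, ContinuousLinearMap.toLinearMap_smul,
    LinearMap.sub_apply, LinearMap.smul_apply, ContinuousLinearMap.coe_coe,
    ContinuousLinearMap.id_apply, inner_sub_left, inner_sub_right, inner_smul_left,
    inner_smul_right, RCLike.conj_to_real] at this
  exact sub_left_inj.1 this

lemma inner_fderiv_ge (hJ : StronglyConvexCosts J lmin lmax) (k : Fin N) (w x : Vec M) :
    lmin k * ‖x‖ ^ 2 ≤ inner ℝ (fderiv ℝ (gradient (J k)) w x) x := by
  have h1 := (isPositive_toEuclideanCLM (hJ.lower k w)).inner_nonneg_left x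
  rw [map_sub, toEuclideanCLM_hessian, toEuclideanCLM_smul_one] at h1
  simp only [_root_.sub_apply, _root_.smul_apply,
    ContinuousLinearMap.id_apply, inner_sub_left, inner_smul_left, real_inner_self_eq_norm_sq,
    RCLike.conj_to_real] at h1
  linarith

lemma inner_fderiv_le (hJ : StronglyConvexCosts J lmin lmax) (k : Fin N) (w x : Vec M) :
    inner ℝ (fderiv ℝ (gradient (J k)) w x) x ≤ lmax k * ‖x‖ ^ 2 := by
  have h1 := (isPositive_toEuclideanCLM (hJ.upper k w)).inner_nonneg_left x
  rw [map_sub, toEuclideanCLM_hessian, toEuclideanCLM_smul_one] at h1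
  simp only [_root_.sub_apply, _root_.smul_apply,
    ContinuousLinearMap.id_apply, inner_sub_left, inner_smul_left, real_inner_self_eq_norm_sq,
    RCLike.conj_to_real] at h1
  linarith

/-- The bound is `|λ_{k,max}| + 1` and not `λ_{k,max}` because for `M = 0` nothing forces
`λ_{k,max}` to be positive. -/
lemma norm_fderiv_le (hJ : StronglyConvexCosts J lmin lmax) (k : Fin N) (w : Vec M) :
    ‖fderiv ℝ (gradient (J k)) w‖ ≤ |lmax k| + 1 := by
  set H := fderiv ℝ (gradient (J k)) w with hH
  set L := |lmax k| + 1 with hL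
  have hL0 : 0 < L := by positivity
  have hle (x : Vec M) : inner ℝ (H x) x ≤ L * ‖x‖ ^ 2 :=
    (hJ.inner_fderiv_le k w x).trans (by gcongr; linarith [le_abs_self (lmax k)])
  refine ContinuousLinearMap.opNorm_le_bound _ hL0.le fun x => ?_
  -- Cauchy-Schwarz for the form of `H`: evaluate it at `x - L⁻¹ • H x`.
  have h0 : 0 ≤ inner ℝ (H (x - L⁻¹ • H x)) (x - L⁻¹ • H x) :=
    le_trans (mul_nonneg (hJ.lmin_pos k).le (sq_nonneg _)) (hJ.inner_fderiv_ge k w _)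
  have h1 : inner ℝ (H (H x)) x = ‖H x‖ ^ 2 := by
    rw [← real_inner_self_eq_norm_sq]; exact hJ.isSymmetric k w (H x) x
  have h2 := hle (H x)
  simp only [map_sub, map_smul, inner_sub_left, inner_sub_right, inner_smul_left,
    inner_smul_right, RCLike.conj_to_real, real_inner_self_eq_norm_sq, h1] at h0
  have h3 : L⁻¹ * (L⁻¹ * inner ℝ (H (H x)) (H x)) ≤ L⁻¹ * ‖H x‖ ^ 2 := by
    rw [show L⁻¹ * ‖H x‖ ^ 2 = L⁻¹ * (L⁻¹ * (L * ‖H x‖ ^ 2)) by field_simp]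
    gcongr
  have h4 : L⁻¹ * ‖H x‖ ^ 2 ≤ L * ‖x‖ ^ 2 := by linarith [hle x]
  refine le_of_sq_le_sq ?_ (by positivity)
  rw [mul_pow, sq L, mul_assoc]
  have := mul_le_mul_of_nonneg_left h4 hL0.le
  rwa [← mul_assoc, mul_inv_cancel₀ hL0.ne', one_mul] at this

lemma norm_gradient_sub_le (hJ : StronglyConvexCosts J lmin lmax) (k : Fin N) (w w' : Vec M) :
    ‖gradient (J k) w - gradient (J k) w'‖ ≤ (|lmax k| + 1) * ‖w - w'‖ :=
  Convex.norm_image_sub_le_of_norm_fderiv_le (𝕜 := ℝ) (s := Set.univ)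
    (fun x _ => hJ.twice_differentiable k x) (fun x _ => hJ.norm_fderiv_le k x) convex_univ
    (Set.mem_univ _) (Set.mem_univ _)

lemma inner_gradient_sub_ge (hJ : StronglyConvexCosts J lmin lmax) (k : Fin N) (w w' : Vec M) :
    lmin k * ‖w - w'‖ ^ 2 ≤ inner ℝ (gradient (J k) w - gradient (J k) w') (w - w') := by
  set g : ℝ → ℝ := fun t => inner ℝ (gradient (J k) (w' + t • (w - w'))) (w - w') with hg
  have hderiv (t : ℝ) : HasDerivAt g
      (inner ℝ (fderiv ℝ (gradient (J k)) (w' + t • (w - w')) (w - w')) (w - w')) t := by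
    have h1 : HasDerivAt (fun t : ℝ => w' + t • (w - w')) (w - w') t := by
      simpa using ((hasDerivAt_id t).smul_const (w - w')).const_add w'
    have h2 := (hJ.twice_differentiable k (w' + t • (w - w'))).hasFDerivAt.comp_hasDerivAt t h1
    have h3 := h2.inner ℝ (hasDerivAt_const t (w - w'))
    rwa [inner_zero_right, zero_add] at h3
  obtain ⟨t, -, ht⟩ := exists_hasDerivAt_eq_slope g _ one_pos
    (fun t _ => (hderiv t).continuousAt.continuousWithinAt) (fun t _ => hderiv t)
  have := hJ.inner_fderiv_ge k (w' + t • (w - w')) (w - w')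
  rw [ht] at this
  simpa [hg, inner_sub_left] using this

/-- A globally quadratic bound for the remainder of the gradient: near the reference point it comes
from the local Lipschitz property of the Hessian, far away from the linear growth of the
gradient. -/
lemma exists_norm_gradient_remainder_le (hJ : StronglyConvexCosts J lmin lmax)
    {Wo : Fin N → Vec M} (hW : HessianLocallyLipschitz J Wo) :
    ∃ κ : ℝ, 0 ≤ κ ∧ ∀ k Δ, ‖gradient (J k) (Wo k + Δ) - gradient (J k) (Wo k)
      - fderiv ℝ (gradient (J k)) (Wo k) Δ‖ ≤ κ * ‖Δ‖ ^ 2 := by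
  obtain ⟨κ, ε, hκ, hε, H⟩ := hW
  set L := ∑ k, (|lmax k| + 1) with hL
  have hL0 : 0 ≤ L := Finset.sum_nonneg fun k _ => by positivity
  have hLk (k) : |lmax k| + 1 ≤ L := Finset.single_le_sum
    (f := fun k => |lmax k| + 1) (fun k _ => by positivity) (Finset.mem_univ k)
  refine ⟨κ + 2 * L / ε, by positivity, fun k Δ => ?_⟩
  rcases le_total ‖Δ‖ ε with hΔ | hΔ
  · have h1 := Convex.norm_image_sub_le_of_norm_fderiv_le' (𝕜 := ℝ) (f := gradient (J k))
      (s := Metric.closedBall (Wo k) ‖Δ‖) (x := Wo k) (y := Wo k + Δ) (C := κ * ‖Δ‖)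
      (φ := fderiv ℝ (gradient (J k)) (Wo k))
      (fun x _ => hJ.twice_differentiable k x) (fun x hx => ?_) (convex_closedBall _ _)
      (by simp) (by simp)
    · rw [add_sub_cancel_left] at h1
      refine h1.trans ?_
      rw [mul_assoc, ← sq]
      gcongr
      linarith [show 0 ≤ 2 * L / ε by positivity]
    · rw [mem_closedBall_iff_norm] at hx
      have h2 := H k (x - Wo k) (hx.trans hΔ)
      rw [opNorm, map_sub, toEuclideanCLM_hessian, toEuclideanCLM_hessian,
        add_sub_cancel] at h2
      exact h2.trans (by gcongr)
  · have h1 := hJ.norm_gradient_sub_le k (Wo k + Δ) (Wo k)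
    have h2 := (fderiv ℝ (gradient (J k)) (Wo k)).le_of_opNorm_le (hJ.norm_fderiv_le k (Wo k)) Δ
    rw [add_sub_cancel_left] at h1
    have h3 : (|lmax k| + 1) * ‖Δ‖ ≤ L * ‖Δ‖ := by gcongr; exact hLk k
    have h4 : 2 * L * ‖Δ‖ ≤ (κ + 2 * L / ε) * ‖Δ‖ ^ 2 := by
      have : 2 * L / ε * (ε * ‖Δ‖) ≤ 2 * L / ε * (‖Δ‖ * ‖Δ‖) := by gcongr
      rw [show 2 * L / ε * (ε * ‖Δ‖) = 2 * L * ‖Δ‖ by field_simp] at this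
      nlinarith [mul_nonneg hκ (sq_nonneg ‖Δ‖)]
    linarith [norm_sub_le (gradient (J k) (Wo k + Δ) - gradient (J k) (Wo k))
      (fderiv ℝ (gradient (J k)) (Wo k) Δ)]

end StronglyConvexCosts

end Costs

/-! ### The network space and the Laplacian -/

/-- Network vectors `col{w_1, …, w_N}`, with the Euclidean norm of `ℝ^{NM}`. -/
abbrev NetVec (N M : ℕ) : Type := PiLp 2 (fun _ : Fin N => Vec M)

section Network

variable {N M : ℕ}

lemma NetVec.norm_sq (x : NetVec N M) : ‖x‖ ^ 2 = ∑ k, ‖x k‖ ^ 2 := PiLp.norm_sq_eq_of_L2 _ x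

lemma NetVec.inner_eq (x y : NetVec N M) : inner ℝ x y = ∑ k, inner ℝ (x k) (y k) :=
  PiLp.inner_apply x y

lemma NetVec.norm_apply_le (x : NetVec N M) (k : Fin N) : ‖x k‖ ≤ ‖x‖ := PiLp.norm_apply_le x k

lemma NetVec.norm_le_of_forall {x y : NetVec N M} {c : ℝ} (hc : 0 ≤ c)
    (h : ∀ k, ‖x k‖ ≤ c * ‖y k‖) : ‖x‖ ≤ c * ‖y‖ := by
  refine le_of_sq_le_sq ?_ (by positivity)
  rw [mul_pow, NetVec.norm_sq, NetVec.norm_sq, Finset.mul_sum]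
  refine Finset.sum_le_sum fun k _ => ?_
  rw [← mul_pow]
  exact pow_le_pow_left₀ (norm_nonneg _) (h k) 2

/-- The block diagonal operator with blocks `D k`. -/
noncomputable def blockOp (D : Fin N → Vec M →L[ℝ] Vec M) : NetVec N M →L[ℝ] NetVec N M where
  toFun x := WithLp.toLp 2 fun k => D k (x k)
  map_add' x y := by ext k : 1; simp
  map_smul' c x := by ext k : 1; simp
  cont := by fun_prop

@[simp] lemma blockOp_apply (D : Fin N → Vec M →L[ℝ] Vec M) (x : NetVec N M) (k : Fin N) :
    blockOp D x k = D k (x k) := rfl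

/-- The operator `L ⊗ I_M` on network vectors, for the Laplacian `L`. -/
noncomputable def lapOp (A : Matrix (Fin N) (Fin N) ℝ) : NetVec N M →L[ℝ] NetVec N M where
  toFun x := WithLp.toLp 2 fun k => ∑ l, laplacian A k l • x l
  map_add' x y := by ext k : 1; simp [Finset.sum_add_distrib]
  map_smul' c x := by ext k : 1; simp [Finset.smul_sum, smul_comm c]
  cont := by fun_prop

lemma lapOp_apply (A : Matrix (Fin N) (Fin N) ℝ) (x : NetVec N M) (k : Fin N) :
    lapOp A x k = ∑ l, laplacian A k l • x l := rfl

lemma sum_laplacian_smul {V : Type*} [AddCommGroup V] [Module ℝ V] (A : Matrix (Fin N) (Fin N) ℝ)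
    (x : Fin N → V) (k : Fin N) :
    ∑ l, laplacian A k l • x l = ∑ l, A k l • (x k - x l) := by
  simp only [laplacian, Matrix.sub_apply, sub_smul, Finset.sum_sub_distrib, smul_sub,
    Matrix.diagonal_apply, ite_smul, zero_smul, Finset.sum_ite_eq, Finset.mem_univ, if_true,
    Finset.sum_smul]

lemma laplacian_symm {A : Matrix (Fin N) (Fin N) ℝ} (hA : A.IsSymm) (k l : Fin N) :
    laplacian A k l = laplacian A l k := by
  simp only [laplacian, Matrix.sub_apply, Matrix.diagonal_apply, hA.apply l k]
  by_cases h : k = l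
  · subst h; rfl
  · simp [h, Ne.symm h]

/-- The Laplacian quadratic form as a sum of squares over the edges. -/
lemma sum_laplacian_inner_eq {V : Type*} [NormedAddCommGroup V] [InnerProductSpace ℝ V]
    {A : Matrix (Fin N) (Fin N) ℝ} (hA : A.IsSymm) (x : Fin N → V) :
    ∑ k, inner ℝ (∑ l, laplacian A k l • x l) (x k)
      = 1 / 2 * ∑ k, ∑ l, A k l * ‖x k - x l‖ ^ 2 := by
  have h1 : ∑ k, inner ℝ (∑ l, laplacian A k l • x l) (x k)
      = ∑ k, ∑ l, A k l * inner ℝ (x k - x l) (x k) := by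
    refine Finset.sum_congr rfl fun k _ => ?_
    rw [sum_laplacian_smul, sum_inner]
    exact Finset.sum_congr rfl fun l _ => by rw [inner_smul_left]; simp
  have h2 : ∑ k, ∑ l, A k l * inner ℝ (x k - x l) (x k)
      = ∑ k, ∑ l, A k l * inner ℝ (x l - x k) (x l) := by
    rw [Finset.sum_comm]
    exact Finset.sum_congr rfl fun k _ => Finset.sum_congr rfl fun l _ => by rw [hA.apply k l]
  have h3 : ∑ k, ∑ l, A k l * ‖x k - x l‖ ^ 2 = ∑ k, ∑ l, A k l * inner ℝ (x k - x l) (x k)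
      + ∑ k, ∑ l, A k l * inner ℝ (x l - x k) (x l) := by
    rw [← Finset.sum_add_distrib]
    refine Finset.sum_congr rfl fun k _ => ?_
    rw [← Finset.sum_add_distrib]
    refine Finset.sum_congr rfl fun l _ => ?_
    rw [← mul_add, ← real_inner_self_eq_norm_sq, inner_sub_right, ← neg_sub (x k) (x l),
      inner_neg_left, sub_eq_add_neg]
  rw [h1, h3, ← h2]
  ring

lemma isSymmetric_lapOp {A : Matrix (Fin N) (Fin N) ℝ} (hA : A.IsSymm) :
    ((lapOp A : NetVec N M →L[ℝ] NetVec N M) : NetVec N M →ₗ[ℝ] NetVec N M).IsSymmetric := by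
  intro x y
  simp only [ContinuousLinearMap.coe_coe, NetVec.inner_eq, lapOp_apply, sum_inner, inner_sum,
    inner_smul_left, inner_smul_right, RCLike.conj_to_real]
  rw [Finset.sum_comm]
  exact Finset.sum_congr rfl fun k _ => Finset.sum_congr rfl fun l _ => by
    rw [laplacian_symm hA]

lemma inner_lapOp_nonneg {A : Matrix (Fin N) (Fin N) ℝ} (hA : IsConnectedNetwork A)
    (x : NetVec N M) : 0 ≤ inner ℝ (lapOp A x) x := by
  simp only [NetVec.inner_eq, lapOp_apply]
  rw [sum_laplacian_inner_eq hA.symm]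
  have := hA.nonneg
  exact mul_nonneg (by norm_num) (Finset.sum_nonneg fun k _ => Finset.sum_nonneg fun l _ =>
    mul_nonneg (this k l) (by positivity))

lemma isSymmetric_blockOp {D : Fin N → Vec M →L[ℝ] Vec M}
    (hD : ∀ k, (D k : Vec M →ₗ[ℝ] Vec M).IsSymmetric) :
    (blockOp D : NetVec N M →ₗ[ℝ] NetVec N M).IsSymmetric := by
  intro x y
  simp only [ContinuousLinearMap.coe_coe, NetVec.inner_eq, blockOp_apply]
  exact Finset.sum_congr rfl fun k _ => hD k (x k) (y k)

end Network

/-! ### The minimizer of the regularized cost and the drift of the error recursion -/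

section Minimizer

variable {N M : ℕ} {A : Matrix (Fin N) (Fin N) ℝ} {J : Fin N → Vec M → ℝ} {lmin lmax : Fin N → ℝ}

/-- The stacked gradients `col{∇J_1(w_1), …, ∇J_N(w_N)}`. -/
noncomputable def netGradient (J : Fin N → Vec M → ℝ) (x : NetVec N M) : NetVec N M :=
  WithLp.toLp 2 fun k => gradient (J k) (x k)

/-- The first-order optimality condition for the minimizer of the regularized cost. -/
lemma netGradient_add_lapOp_eq_zero (hA : A.IsSymm) (hJ : ∀ k, Differentiable ℝ (J k)) {η : ℝ}
    {Wo : Fin N → Vec M} (hW : IsMinOn (regularizedCost A J η) Set.univ Wo) :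
    netGradient J (WithLp.toLp 2 Wo) + η • lapOp A (WithLp.toLp 2 Wo) = 0 := by
  set x : NetVec N M := WithLp.toLp 2 Wo with hx
  set g := netGradient J x + η • lapOp A x with hg
  -- The derivative of the cost at the minimizer, in the direction `g`, is `‖g‖²`.
  have hline (k : Fin N) : HasDerivAt (fun t : ℝ => Wo k + t • g k) (g k) 0 := by
    simpa using ((hasDerivAt_id (0 : ℝ)).smul_const (g k)).const_add (Wo k)
  have h1 (k : Fin N) : HasDerivAt (fun t : ℝ => J k (Wo k + t • g k))
      (inner ℝ (gradient (J k) (Wo k)) (g k)) 0 := by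
    have h := (hJ k (Wo k + (0 : ℝ) • g k)).hasGradientAt.hasFDerivAt.comp_hasDerivAt 0 (hline k)
    simp only [zero_smul, add_zero, InnerProductSpace.toDual_apply_apply] at h
    exact h
  have h2 (k l : Fin N) : HasDerivAt
      (fun t : ℝ => laplacian A k l * inner ℝ (Wo k + t • g k) (Wo l + t • g l))
      (laplacian A k l * (inner ℝ (Wo k) (g l) + inner ℝ (g k) (Wo l))) 0 := by
    have h := ((hline k).inner ℝ (hline l)).const_mul (laplacian A k l)
    simpa only [zero_smul, add_zero] using h
  have h3 : HasDerivAt (fun t : ℝ => regularizedCost A J η (fun k => Wo k + t • g k))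
      (∑ k, inner ℝ (gradient (J k) (Wo k)) (g k) + η / 2 * ∑ k, ∑ l, laplacian A k l *
        (inner ℝ (Wo k) (g l) + inner ℝ (g k) (Wo l))) 0 :=
    (HasDerivAt.fun_sum fun k _ => h1 k).add
      ((HasDerivAt.fun_sum fun k _ => HasDerivAt.fun_sum fun l _ => h2 k l).const_mul _)
  have h4 : IsLocalMin (fun t : ℝ => regularizedCost A J η (fun k => Wo k + t • g k)) 0 := by
    refine Eventually.of_forall fun t => ?_
    simpa using hW (Set.mem_univ (fun k => Wo k + t • g k))
  have h5 := h4.hasDerivAt_eq_zero h3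
  have h6 : ∑ k, ∑ l, laplacian A k l * (inner ℝ (Wo k) (g l) + inner ℝ (g k) (Wo l))
      = 2 * inner ℝ (lapOp A x) g := by
    have e1 : ∑ k, ∑ l, laplacian A k l * inner ℝ (Wo k) (g l) = inner ℝ (lapOp A x) g := by
      rw [Finset.sum_comm]
      simp only [NetVec.inner_eq, lapOp_apply, sum_inner, inner_smul_left, RCLike.conj_to_real]
      exact Finset.sum_congr rfl fun k _ => Finset.sum_congr rfl fun l _ => by
        rw [laplacian_symm hA]
    have e2 : ∑ k, ∑ l, laplacian A k l * inner ℝ (g k) (Wo l) = inner ℝ (lapOp A x) g := by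
      simp only [NetVec.inner_eq, lapOp_apply, sum_inner, inner_smul_left, RCLike.conj_to_real]
      exact Finset.sum_congr rfl fun k _ => Finset.sum_congr rfl fun l _ => by
        rw [real_inner_comm]
    simp only [mul_add, Finset.sum_add_distrib, e1, e2]
    ring
  have h7 : ∑ k, inner ℝ (gradient (J k) (Wo k)) (g k) = inner ℝ (netGradient J x) g := by
    rw [NetVec.inner_eq]; rfl
  have h8 : inner ℝ g g = (0 : ℝ) := by
    conv_lhs => rw [hg, inner_add_left, inner_smul_left]
    rw [← h5, h6, h7]
    simp only [RCLike.conj_to_real]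
    ring
  exact inner_self_eq_zero.1 h8

namespace StronglyConvexCosts

lemma exists_uniform_lower (hJ : StronglyConvexCosts J lmin lmax) :
    ∃ ν > 0, ∀ k, ν ≤ lmin k := by
  rcases isEmpty_or_nonempty (Fin N) with h | h
  · exact ⟨1, one_pos, fun k => h.elim k⟩
  · obtain ⟨k₀, hk₀⟩ := Finite.exists_min lmin
    exact ⟨lmin k₀, hJ.lmin_pos k₀, hk₀⟩

lemma inner_netGradient_sub_ge (hJ : StronglyConvexCosts J lmin lmax) {ν : ℝ}
    (hν : ∀ k, ν ≤ lmin k) (x y : NetVec N M) :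
    ν * ‖x - y‖ ^ 2 ≤ inner ℝ (netGradient J x - netGradient J y) (x - y) := by
  rw [NetVec.norm_sq, NetVec.inner_eq, Finset.mul_sum]
  refine Finset.sum_le_sum fun k _ => le_trans ?_ (hJ.inner_gradient_sub_ge k (x k) (y k))
  exact mul_le_mul_of_nonneg_right (hν k) (by positivity)

lemma norm_netGradient_sub_le (hJ : StronglyConvexCosts J lmin lmax) (x y : NetVec N M) :
    ‖netGradient J x - netGradient J y‖ ≤ (∑ k, (|lmax k| + 1)) * ‖x - y‖ := by
  refine NetVec.norm_le_of_forall (Finset.sum_nonneg fun k _ => by positivity) fun k => ?_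
  refine (hJ.norm_gradient_sub_le k (x k) (y k)).trans ?_
  exact mul_le_mul_of_nonneg_right (Finset.single_le_sum
    (f := fun k => |lmax k| + 1) (fun k _ => by positivity) (Finset.mem_univ k)) (norm_nonneg _)

lemma continuous_netGradient (hJ : StronglyConvexCosts J lmin lmax) :
    Continuous (netGradient J) := by
  have := fun k => (hJ.twice_differentiable k).continuous
  unfold netGradient
  fun_prop

/-- The minimizers of the regularized costs are bounded uniformly in `η`. -/
lemma norm_minimizer_le (hJ : StronglyConvexCosts J lmin lmax) (hA : IsConnectedNetwork A) {ν : ℝ}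
    (hν0 : 0 < ν) (hν : ∀ k, ν ≤ lmin k) {η : ℝ} (hη : 0 ≤ η) {Wo : Fin N → Vec M}
    (hW : IsMinOn (regularizedCost A J η) Set.univ Wo) :
    ‖(WithLp.toLp 2 Wo : NetVec N M)‖ ≤ ‖netGradient J 0‖ / ν := by
  set x : NetVec N M := WithLp.toLp 2 Wo
  have h1 := netGradient_add_lapOp_eq_zero hA.symm hJ.differentiable hW
  have h2 := hJ.inner_netGradient_sub_ge hν x 0
  rw [sub_zero, eq_neg_of_add_eq_zero_left h1, inner_sub_left, inner_neg_left,
    inner_smul_left] at h2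
  have h3 := mul_nonneg hη (inner_lapOp_nonneg hA x)
  have h4 := abs_le.1 (abs_real_inner_le_norm (netGradient J 0) x)
  have h5 : ν * ‖x‖ ^ 2 ≤ ‖netGradient J 0‖ * ‖x‖ := by
    simp only [RCLike.conj_to_real] at h2
    linarith [h4.1]
  rw [le_div_iff₀ hν0]
  rcases (norm_nonneg x).eq_or_lt with h0 | h0
  · rw [← h0]; simp
  · refine le_of_mul_le_mul_right ?_ h0
    linarith

end StronglyConvexCosts

/-- The drift `e ↦ ∇J(Wo + e) - ∇J(Wo) + η ℒ e` of the error recursion, where `S = η ℒ`. -/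
noncomputable def netDrift (J : Fin N → Vec M → ℝ) (S : NetVec N M →L[ℝ] NetVec N M)
    (x e : NetVec N M) : NetVec N M :=
  netGradient J (x + e) - netGradient J x + S e

/-- The second-order term of the deterministic part of the error recursion. It includes the bias
that the two-step structure of the algorithm causes. -/
noncomputable def netPert (J : Fin N → Vec M → ℝ) (S : NetVec N M →L[ℝ] NetVec N M)
    (x e : NetVec N M) : NetVec N M :=
  S (netGradient J (x + e) - netGradient J x) - S (S x)

/-- The linearization of the drift: the block diagonal matrix of the Hessians at the reference point
plus `η ℒ`. -/
noncomputable def netHessian (J : Fin N → Vec M → ℝ) (S : NetVec N M →L[ℝ] NetVec N M)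
    (x : NetVec N M) : NetVec N M →L[ℝ] NetVec N M :=
  blockOp (fun k => fderiv ℝ (gradient (J k)) (x k)) + S

lemma StronglyConvexCosts.isSymmetric_netHessian (hJ : StronglyConvexCosts J lmin lmax)
    {S : NetVec N M →L[ℝ] NetVec N M} (hS : (S : NetVec N M →ₗ[ℝ] NetVec N M).IsSymmetric)
    (x : NetVec N M) :
    (netHessian J S x : NetVec N M →ₗ[ℝ] NetVec N M).IsSymmetric :=
  (isSymmetric_blockOp fun k => hJ.isSymmetric k (x k)).add hS

lemma StronglyConvexCosts.inner_netHessian_ge (hJ : StronglyConvexCosts J lmin lmax) {ν : ℝ}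
    (hν : ∀ k, ν ≤ lmin k) {S : NetVec N M →L[ℝ] NetVec N M} (hS : ∀ x, 0 ≤ inner ℝ (S x) x)
    (x y : NetVec N M) : ν * ‖y‖ ^ 2 ≤ inner ℝ (netHessian J S x y) y := by
  have h1 : ν * ‖y‖ ^ 2
      ≤ inner ℝ (blockOp (fun k => fderiv ℝ (gradient (J k)) (x k)) y) y := by
    rw [NetVec.norm_sq, NetVec.inner_eq, Finset.mul_sum]
    refine Finset.sum_le_sum fun k _ => le_trans ?_ (hJ.inner_fderiv_ge k (x k) (y k))
    exact mul_le_mul_of_nonneg_right (hν k) (by positivity)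
  rw [netHessian, _root_.add_apply, inner_add_left]
  linarith [hS y]

/-- For strongly convex costs whose Hessians are Lipschitz near the minimizer, the drift of the
error recursion satisfies the assumptions of the abstract analysis. -/
lemma StronglyConvexCosts.exists_isDrift (hJ : StronglyConvexCosts J lmin lmax) {ν : ℝ}
    (hν0 : 0 < ν) (hν : ∀ k, ν ≤ lmin k) {S : NetVec N M →L[ℝ] NetVec N M}
    (hS : ∀ x, 0 ≤ inner ℝ (S x) x) {Wo : Fin N → Vec M} (hW : HessianLocallyLipschitz J Wo) :
    ∃ K, IsDrift (netDrift J S (WithLp.toLp 2 Wo)) (netPert J S (WithLp.toLp 2 Wo))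
      (netHessian J S (WithLp.toLp 2 Wo)) ν K := by
  obtain ⟨κ, hκ, hrem⟩ := hJ.exists_norm_gradient_remainder_le hW
  set x : NetVec N M := WithLp.toLp 2 Wo with hx
  set L := ∑ k, (|lmax k| + 1) with hL
  have hL0 : 0 ≤ L := Finset.sum_nonneg fun k _ => by positivity
  have hc := hJ.continuous_netGradient
  have hlip (e : NetVec N M) : ‖netGradient J (x + e) - netGradient J x‖ ≤ L * ‖e‖ := by
    simpa using hJ.norm_netGradient_sub_le (x + e) x
  refine ⟨1 + κ + L + ‖S‖ + ‖S‖ * L + ‖S (S x)‖, ?_, ?_, hν0, ?_, fun e => ?_, fun e => ?_,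
    fun e => ?_, fun e => ?_⟩
  · unfold netDrift; fun_prop
  · unfold netPert; fun_prop
  · have : 0 ≤ κ + L + ‖S‖ + ‖S‖ * L + ‖S (S x)‖ := by positivity
    linarith
  · have h1 := hJ.inner_netGradient_sub_ge hν (x + e) x
    rw [add_sub_cancel_left] at h1
    rw [netDrift, inner_add_left]
    linarith [hS e]
  · refine (norm_add_le _ _).trans ?_
    have h1 := hlip e
    have h2 := S.le_opNorm e
    have h3 : 0 ≤ (1 + κ + ‖S‖ * L + ‖S (S x)‖) * ‖e‖ := by positivity
    linarith
  · refine (norm_sub_le _ _).trans ?_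
    have h1 : ‖S (netGradient J (x + e) - netGradient J x)‖ ≤ ‖S‖ * (L * ‖e‖) :=
      (S.le_opNorm _).trans (mul_le_mul_of_nonneg_left (hlip e) (norm_nonneg _))
    have h3 : 0 ≤ (1 + κ + L + ‖S‖) * (‖e‖ + 1) + ‖S‖ * L + ‖S (S x)‖ * ‖e‖ := by positivity
    linarith
  · have h1 : netDrift J S x e - netHessian J S x e = netGradient J (x + e) - netGradient J x
        - blockOp (fun k => fderiv ℝ (gradient (J k)) (x k)) e := by
      rw [netDrift, netHessian, _root_.add_apply]; abel
    have h2 : ‖netGradient J (x + e) - netGradient J x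
        - blockOp (fun k => fderiv ℝ (gradient (J k)) (x k)) e‖ ≤ (κ * ‖e‖) * ‖e‖ := by
      refine NetVec.norm_le_of_forall (by positivity) fun k => ?_
      refine (hrem k (e k)).trans ?_
      rw [sq, mul_assoc]
      gcongr
      exact NetVec.norm_apply_le e k
    rw [h1]
    refine h2.trans ?_
    have h3 : 0 ≤ (1 + L + ‖S‖ + ‖S‖ * L + ‖S (S x)‖) * ‖e‖ ^ 2 := by positivity
    nlinarith

end Minimizer

section Recursion

variable {N M : ℕ} {Ω : Type*} {A : Matrix (Fin N) (Fin N) ℝ} {J : Fin N → Vec M → ℝ}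
  {ghat : Fin N → ℕ → Ω → Vec M → Vec M} {w0 : Fin N → Ω → Vec M} {μ η : ℝ}

/-- The error `W_i - Wo` of the iterates. -/
noncomputable def netError (A : Matrix (Fin N) (Fin N) ℝ)
    (ghat : Fin N → ℕ → Ω → Vec M → Vec M) (w0 : Fin N → Ω → Vec M) (Wo : Fin N → Vec M)
    (μ η : ℝ) (i : ℕ) (ω : Ω) : NetVec N M :=
  WithLp.toLp 2 fun k => iterate A ghat w0 μ η i k ω - Wo k

/-- The stacked gradient noise at the iterates, `col{s_{1,i+1}(w_{1,i}), …, s_{N,i+1}(w_{N,i})}`. -/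
noncomputable def netNoise (A : Matrix (Fin N) (Fin N) ℝ) (J : Fin N → Vec M → ℝ)
    (ghat : Fin N → ℕ → Ω → Vec M → Vec M) (w0 : Fin N → Ω → Vec M)
    (μ η : ℝ) (i : ℕ) (ω : Ω) : NetVec N M :=
  WithLp.toLp 2 fun k => gradNoise J ghat k (i + 1) ω (iterate A ghat w0 μ η i k ω)

/-- One step of the algorithm in network form: a stochastic gradient step followed by
`I - μ η ℒ`. -/
lemma toLp_iterate_succ (i : ℕ) (ω : Ω) (x : NetVec N M)
    (hx : x = WithLp.toLp 2 fun k => iterate A ghat w0 μ η i k ω) :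
    (WithLp.toLp 2 fun k => iterate A ghat w0 μ η (i + 1) k ω : NetVec N M)
      = (x - μ • (netGradient J x - netNoise A J ghat w0 μ η i ω))
        - μ • (η • lapOp A) (x - μ • (netGradient J x - netNoise A J ghat w0 μ η i ω)) := by
  set ψ := x - μ • (netGradient J x - netNoise A J ghat w0 μ η i ω) with hψ
  have hψk (k : Fin N) : ψ k = iterate A ghat w0 μ η i k ω
      - μ • ghat k (i + 1) ω (iterate A ghat w0 μ η i k ω) := by
    simp [hψ, hx, netGradient, netNoise, gradNoise]
  ext k : 1
  change iterate A ghat w0 μ η (i + 1) k ω = ψ k - μ • η • lapOp A ψ k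
  rw [lapOp_apply, sum_laplacian_smul, smul_smul]
  simp only [hψk]
  rfl

/-- The error recursion. By the optimality condition `∇J(Wo) = -S Wo` with `S = η ℒ`, the gradients
at the minimizer, which need not vanish, enter only through the bias `-S (S Wo)` at order `μ²`. -/
lemma netError_succ {Wo : Fin N → Vec M}
    (hW : netGradient J (WithLp.toLp 2 Wo) + η • lapOp A (WithLp.toLp 2 Wo) = 0)
    (i : ℕ) (ω : Ω) :
    netError A ghat w0 Wo μ η (i + 1) ω
      = driftStep (netDrift J (η • lapOp A) (WithLp.toLp 2 Wo))
          (netPert J (η • lapOp A) (WithLp.toLp 2 Wo)) μ (netError A ghat w0 Wo μ η i ω)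
        + μ • (netNoise A J ghat w0 μ η i ω
          - μ • (η • lapOp A : NetVec N M →L[ℝ] NetVec N M) (netNoise A J ghat w0 μ η i ω)) := by
  set x : NetVec N M := WithLp.toLp 2 Wo with hx
  set e := netError A ghat w0 Wo μ η i ω with he
  set ξ := netNoise A J ghat w0 μ η i ω with hξ
  set S : NetVec N M →L[ℝ] NetVec N M := η • lapOp A with hS
  have h1 : x + e = WithLp.toLp 2 fun k => iterate A ghat w0 μ η i k ω := by
    ext k : 1
    simp [hx, he, netError]
  have h2 : netError A ghat w0 Wo μ η (i + 1) ω
      = (WithLp.toLp 2 fun k => iterate A ghat w0 μ η (i + 1) k ω : NetVec N M) - x := rfl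
  have h3 : netGradient J (x + e) = (netGradient J (x + e) - netGradient J x) - S x := by
    rw [eq_neg_of_add_eq_zero_left hW]
    simp [hS]
  rw [h2, toLp_iterate_succ i ω (x + e) h1, ← hξ, ← hS, driftStep, netDrift, netPert]
  set d := netGradient J (x + e) - netGradient J x with hd
  rw [h3]
  simp only [map_sub, map_add, map_smul]
  module

end Recursion

/-! ### The error process is a noisy recursion -/

section ConditionalMoments

variable {Ω : Type*} [mΩ : MeasurableSpace Ω] {P : Measure Ω} [IsProbabilityMeasure P]
  {m : MeasurableSpace Ω}

lemma integral_inner_eq_zero_of_condExp {F : Type*} [NormedAddCommGroup F] [InnerProductSpace ℝ F]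
    [CompleteSpace F] (hm : m ≤ mΩ) {g s : Ω → F} (hg : StronglyMeasurable[m] g)
    (hs : Integrable s P) (hgs : Integrable (fun ω => inner ℝ (g ω) (s ω)) P)
    (h0 : P[s | m] =ᵐ[P] 0) : ∫ ω, inner ℝ (g ω) (s ω) ∂P = 0 := by
  have h1 := condExp_bilin_of_stronglyMeasurable_left (μ := P) (innerSL ℝ) hg hgs hs
  rw [← integral_condExp hm]
  refine (integral_congr_ae (g := fun _ => (0 : ℝ)) ?_).trans (by simp)
  filter_upwards [h1, h0] with ω h1 h0
  exact h1.trans (by rw [h0]; simp)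

lemma integral_mul_le_of_condExp_le (hm : m ≤ mΩ) {f s φ : Ω → ℝ} (hf : StronglyMeasurable[m] f)
    (hf0 : ∀ ω, 0 ≤ f ω) (hs : Integrable s P) (hfs : Integrable (fun ω => f ω * s ω) P)
    (hfφ : Integrable (fun ω => f ω * φ ω) P) (h : P[s | m] ≤ᵐ[P] φ) :
    ∫ ω, f ω * s ω ∂P ≤ ∫ ω, f ω * φ ω ∂P := by
  rw [← integral_condExp hm]
  refine integral_mono_ae integrable_condExp hfφ ?_
  filter_upwards [condExp_mul_of_stronglyMeasurable_left hf hfs hs, h] with ω h1 h2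
  exact h1.trans_le (mul_le_mul_of_nonneg_left h2 (hf0 ω))

end ConditionalMoments

section Iterates

variable {N M : ℕ} {Ω : Type*}
  {A : Matrix (Fin N) (Fin N) ℝ} {J : Fin N → Vec M → ℝ} {lmin lmax : Fin N → ℝ}
  {ghat : Fin N → ℕ → Ω → Vec M → Vec M} {w0 : Fin N → Ω → Vec M} {μ η : ℝ}
  {β σ β' σ' : Fin N → ℝ}

lemma measurable_past_iterate (i : ℕ) (k : Fin N) :
    Measurable[past A ghat w0 μ η i] (iterate A ghat w0 μ η i k) := by
  rw [measurable_iff_comap_le]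
  exact le_iSup₂_of_le i le_rfl (le_iSup (fun l =>
    MeasurableSpace.comap (iterate A ghat w0 μ η i l) inferInstance) k)

lemma measurable_past_netError (Wo : Fin N → Vec M) (i : ℕ) :
    StronglyMeasurable[past A ghat w0 μ η i] (netError A ghat w0 Wo μ η i) := by
  let _ : MeasurableSpace Ω := past A ghat w0 μ η i
  have h : Measurable
      (fun ω => fun k => iterate A ghat w0 μ η i k ω - Wo k) :=
    measurable_pi_lambda _ fun k => (measurable_past_iterate i k).sub_const (Wo k)
  exact ((PiLp.continuous_toLp 2 _).measurable.comp h).stronglyMeasurable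

variable [mΩ : MeasurableSpace Ω] {P : Measure Ω}

lemma measurable_iterate
    (hghat : ∀ k i, Measurable (fun p : Ω × Vec M => ghat k i p.1 p.2))
    (hw0 : ∀ k, Measurable (w0 k)) (i : ℕ) (k : Fin N) :
    Measurable (iterate A ghat w0 μ η i k) := by
  induction i generalizing k with
  | zero => exact hw0 k
  | succ i ih =>
    have h (l : Fin N) : Measurable fun ω => iterate A ghat w0 μ η i l ω
        - μ • ghat l (i + 1) ω (iterate A ghat w0 μ η i l ω) :=
      (ih l).sub (((hghat l (i + 1)).comp (measurable_id.prodMk (ih l))).const_smul μ)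
    exact (h k).sub ((Finset.measurable_sum _ fun l _ =>
      ((h k).sub (h l)).const_smul (A k l)).const_smul (μ * η))

lemma past_le (hghat : ∀ k i, Measurable (fun p : Ω × Vec M => ghat k i p.1 p.2))
    (hw0 : ∀ k, Measurable (w0 k)) (i : ℕ) : past A ghat w0 μ η i ≤ mΩ :=
  iSup₂_le fun j _ => iSup_le fun l => (measurable_iterate hghat hw0 j l).comap_le

variable [IsProbabilityMeasure P]

lemma StronglyConvexCosts.memLp_gradient (hJ : StronglyConvexCosts J lmin lmax) (k : Fin N)
    {w : Ω → Vec M} (hw : MemLp w 4 P) : MemLp (fun ω => gradient (J k) (w ω)) 4 P := by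
  have hc := (hJ.twice_differentiable k).continuous
  refine ((hw.norm.const_mul (|lmax k| + 1)).add (memLp_const ‖gradient (J k) 0‖)).mono'
    (hc.comp_aestronglyMeasurable hw.aestronglyMeasurable) (Eventually.of_forall fun ω => ?_)
  have h1 := hJ.norm_gradient_sub_le k (w ω) 0
  rw [sub_zero] at h1
  have h2 := norm_le_norm_add_norm_sub (gradient (J k) 0) (gradient (J k) (w ω))
  rw [norm_sub_rev] at h2
  simp only [Pi.add_apply]
  linarith

lemma memLp_iterate (hJ : StronglyConvexCosts J lmin lmax)
    (hw0 : ∀ k, MemLp (w0 k) 4 P)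
    (hN : GradientNoiseConditions P (gradNoise J ghat) (past A ghat w0 μ η) β σ β' σ')
    (i : ℕ) (k : Fin N) : MemLp (iterate A ghat w0 μ η i k) 4 P := by
  induction i generalizing k with
  | zero => exact hw0 k
  | succ i ih =>
    have h (l : Fin N) : MemLp (fun ω => iterate A ghat w0 μ η i l ω
        - μ • ghat l (i + 1) ω (iterate A ghat w0 μ η i l ω)) 4 P := by
      have h1 := (hJ.memLp_gradient l (ih l)).sub
        (hN.memLp l i _ (measurable_past_iterate i l) (ih l))
      refine (ih l).sub (MemLp.const_smul (f := fun ω =>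
        ghat l (i + 1) ω (iterate A ghat w0 μ η i l ω)) ?_ μ)
      convert h1 using 2
      simp [gradNoise]
    have h2 : MemLp (fun ω => ∑ l, A k l • ((iterate A ghat w0 μ η i k ω
        - μ • ghat k (i + 1) ω (iterate A ghat w0 μ η i k ω)) - (iterate A ghat w0 μ η i l ω
        - μ • ghat l (i + 1) ω (iterate A ghat w0 μ η i l ω)))) 4 P :=
      memLp_finsetSum _ fun l _ => ((h k).sub (h l)).const_smul (A k l)
    exact (h k).sub (h2.const_smul (μ * η))

lemma memLp_netError (hJ : StronglyConvexCosts J lmin lmax)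
    (hw0 : ∀ k, MemLp (w0 k) 4 P)
    (hN : GradientNoiseConditions P (gradNoise J ghat) (past A ghat w0 μ η) β σ β' σ')
    (Wo : Fin N → Vec M) (i : ℕ) : MemLp (netError A ghat w0 Wo μ η i) 4 P := by
  have h (k : Fin N) : MemLp (fun ω => netError A ghat w0 Wo μ η i ω k) 4 P :=
    (memLp_iterate hJ hw0 hN i k).sub (memLp_const (Wo k))
  exact MemLp.of_eval_piLp h

end Iterates

section Iterates

variable {N M : ℕ} {Ω : Type*} [mΩ : MeasurableSpace Ω] {P : Measure Ω}
  [IsProbabilityMeasure P]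
  {A : Matrix (Fin N) (Fin N) ℝ} {J : Fin N → Vec M → ℝ} {lmin lmax : Fin N → ℝ}
  {ghat : Fin N → ℕ → Ω → Vec M → Vec M} {w0 : Fin N → Ω → Vec M} {μ η : ℝ}
  {β σ β' σ' : Fin N → ℝ}

lemma memLp_netNoise (hJ : StronglyConvexCosts J lmin lmax) (hw0 : ∀ k, MemLp (w0 k) 4 P)
    (hN : GradientNoiseConditions P (gradNoise J ghat) (past A ghat w0 μ η) β σ β' σ') (i : ℕ) :
    MemLp (netNoise A J ghat w0 μ η i) 4 P :=
  MemLp.of_eval_piLp fun k =>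
    hN.memLp k i _ (measurable_past_iterate i k) (memLp_iterate hJ hw0 hN i k)

lemma integrable_norm_sq_of_memLp_four {F : Type*} [NormedAddCommGroup F] {f : Ω → F}
    (hf : MemLp f 4 P) : Integrable (fun ω => ‖f ω‖ ^ 2) P :=
  (hf.mono_exponent (by norm_num : (2 : ENNReal) ≤ 4)).integrable_norm_pow (by norm_num)

lemma integrable_of_le_pow_four {F : Type*} [NormedAddCommGroup F] {e ξ : Ω → F}
    (he : MemLp e 4 P) (hξ : MemLp ξ 4 P) {f : Ω → ℝ} (hf : AEStronglyMeasurable f P) (C : ℝ)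
    (h : ∀ ω, |f ω| ≤ C * (1 + ‖e ω‖ ^ 4 + ‖ξ ω‖ ^ 4)) : Integrable f P :=
  ((((integrable_const (1 : ℝ)).add (integrable_norm_pow_four he)).add
    (integrable_norm_pow_four hξ)).const_mul C).mono' hf (Eventually.of_forall h)

/-- The network noise has conditional mean zero, so it is orthogonal to functions of the current
error. -/
lemma orthogonal_netNoise (hJ : StronglyConvexCosts J lmin lmax)
    (hghat : ∀ k i, Measurable (fun p : Ω × Vec M => ghat k i p.1 p.2))
    (hw0 : ∀ k, Measurable (w0 k) ∧ MemLp (w0 k) 4 P)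
    (hN : GradientNoiseConditions P (gradNoise J ghat) (past A ghat w0 μ η) β σ β' σ')
    (Wo : Fin N → Vec M) (i : ℕ) {f : NetVec N M → NetVec N M} (hf : Continuous f)
    (hC : ∃ C, ∀ x, ‖f x‖ ≤ C * (1 + ‖x‖ ^ 3)) :
    ∫ ω, inner ℝ (f (netError A ghat w0 Wo μ η i ω)) (netNoise A J ghat w0 μ η i ω) ∂P = 0 := by
  obtain ⟨C, hC⟩ := hC
  have hw0' := fun k => (hw0 k).2
  have he := memLp_netError hJ hw0' hN Wo i
  have hξ := memLp_netNoise hJ hw0' hN i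
  have hm := past_le (A := A) (μ := μ) (η := η) hghat (fun k => (hw0 k).1) i
  have hC0 : 0 ≤ C := by
    have := (norm_nonneg _).trans (hC 0)
    simpa using this
  have hfe (k : Fin N) : StronglyMeasurable[past A ghat w0 μ η i]
      (fun ω => f (netError A ghat w0 Wo μ η i ω) k) :=
    ((PiLp.continuous_apply 2 _ k).comp hf).comp_stronglyMeasurable (measurable_past_netError Wo i)
  have hint (k : Fin N) : Integrable (fun ω => inner ℝ (f (netError A ghat w0 Wo μ η i ω) k)
      (netNoise A J ghat w0 μ η i ω k)) P := by
    refine integrable_of_le_pow_four he hξ ?_ (3 * C) fun ω => ?_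
    · exact ((hfe k).mono hm).aestronglyMeasurable.inner
        (hξ.eval_piLp k).aestronglyMeasurable
    · refine (abs_real_inner_le_norm _ _).trans ?_
      have h1 := (NetVec.norm_apply_le (f (netError A ghat w0 Wo μ η i ω)) k).trans (hC _)
      have h2 := NetVec.norm_apply_le (netNoise A J ghat w0 μ η i ω) k
      refine (mul_le_mul h1 h2 (norm_nonneg _) (by positivity)).trans ?_
      have hx := norm_nonneg (netError A ghat w0 Wo μ η i ω)
      have hy := norm_nonneg (netNoise A J ghat w0 μ η i ω)
      set x := ‖netError A ghat w0 Wo μ η i ω‖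
      set y := ‖netNoise A J ghat w0 μ η i ω‖
      have h3 : x ^ 3 * y ≤ x ^ 4 + y ^ 4 := by
        rcases le_total x y with h | h
        · have : x ^ 3 * y ≤ y ^ 3 * y := by gcongr
          nlinarith [pow_nonneg hx 4]
        · have : x ^ 3 * y ≤ x ^ 3 * x := by gcongr
          nlinarith [pow_nonneg hy 4]
      have h4 : y ≤ 1 + y ^ 4 := by nlinarith [sq_nonneg (y ^ 2 - 1), sq_nonneg (y - 1)]
      have h5 : (1 + x ^ 3) * y ≤ 3 * (1 + x ^ 4 + y ^ 4) := by
        nlinarith [pow_nonneg hx 4, pow_nonneg hy 4]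
      nlinarith [mul_le_mul_of_nonneg_left h5 hC0]
  have h1 (k : Fin N) : ∫ ω, inner ℝ (f (netError A ghat w0 Wo μ η i ω) k)
      (netNoise A J ghat w0 μ η i ω k) ∂P = 0 :=
    integral_inner_eq_zero_of_condExp hm (hfe k)
      ((hξ.eval_piLp k).integrable (by norm_num)) (hint k)
      (hN.mean_zero k i _ (measurable_past_iterate i k) (memLp_iterate hJ hw0' hN i k))
  simp only [NetVec.inner_eq]
  rw [integral_finsetSum _ fun k _ => hint k]
  exact Finset.sum_eq_zero fun k _ => h1 k

lemma second_moment_netNoise_le (hJ : StronglyConvexCosts J lmin lmax)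
    (hghat : ∀ k i, Measurable (fun p : Ω × Vec M => ghat k i p.1 p.2))
    (hw0 : ∀ k, Measurable (w0 k) ∧ MemLp (w0 k) 4 P)
    (hN : GradientNoiseConditions P (gradNoise J ghat) (past A ghat w0 μ η) β σ β' σ')
    (Wo : Fin N → Vec M) (i : ℕ) {g : NetVec N M → ℝ} (hg : Continuous g) (hg0 : ∀ x, 0 ≤ g x)
    (hC : ∃ C, ∀ x, g x ≤ C * (1 + ‖x‖ ^ 2)) {b : ℝ}
    (hb : ∑ k, (2 * β k ^ 2 * (1 + ‖Wo k‖ ^ 2) + σ k ^ 2) ≤ b) :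
    ∫ ω, g (netError A ghat w0 Wo μ η i ω) * ‖netNoise A J ghat w0 μ η i ω‖ ^ 2 ∂P
      ≤ ∫ ω, g (netError A ghat w0 Wo μ η i ω)
        * (b * (‖netError A ghat w0 Wo μ η i ω‖ ^ 2 + 1)) ∂P := by
  obtain ⟨C, hC⟩ := hC
  have hw0' := fun k => (hw0 k).2
  have he := memLp_netError hJ hw0' hN Wo i
  have hξ := memLp_netNoise hJ hw0' hN i
  have hm := past_le (A := A) (μ := μ) (η := η) hghat (fun k => (hw0 k).1) i
  set e := netError A ghat w0 Wo μ η i with he_def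
  set ξ := netNoise A J ghat w0 μ η i with hξ_def
  have hC0 : 0 ≤ C := by
    have := (hg0 0).trans (hC 0)
    simpa using this
  have hge : StronglyMeasurable[past A ghat w0 μ η i] (fun ω => g (e ω)) :=
    hg.comp_stronglyMeasurable (measurable_past_netError Wo i)
  have hgm : AEStronglyMeasurable (fun ω => g (e ω)) P := (hge.mono hm).aestronglyMeasurable
  have hWk (k : Fin N) : MemLp (iterate A ghat w0 μ η i k) 4 P := memLp_iterate hJ hw0' hN i k
  have hW (k : Fin N) (ω : Ω) :
      ‖iterate A ghat w0 μ η i k ω‖ ^ 2 ≤ 2 * ‖e ω‖ ^ 2 + 2 * ‖Wo k‖ ^ 2 := by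
    have h1 : ‖iterate A ghat w0 μ η i k ω‖ ≤ ‖e ω‖ + ‖Wo k‖ := by
      have h2 : e ω k = iterate A ghat w0 μ η i k ω - Wo k := rfl
      have h3 := NetVec.norm_apply_le (e ω) k
      rw [h2] at h3
      linarith [norm_le_norm_add_norm_sub (Wo k) (iterate A ghat w0 μ η i k ω),
        norm_sub_rev (Wo k) (iterate A ghat w0 μ η i k ω)]
    have h4 := pow_le_pow_left₀ (norm_nonneg _) h1 2
    nlinarith [sq_nonneg (‖e ω‖ - ‖Wo k‖)]
  have hgξ (k : Fin N) : Integrable (fun ω => g (e ω) * ‖ξ ω k‖ ^ 2) P := by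
    refine integrable_of_le_pow_four he hξ
      (hgm.mul ((hξ.eval_piLp k).aestronglyMeasurable.norm.pow 2)) (2 * C) fun ω => ?_
    rw [abs_of_nonneg (mul_nonneg (hg0 _) (by positivity))]
    have h1 : ‖ξ ω k‖ ^ 2 ≤ ‖ξ ω‖ ^ 2 := by gcongr; exact NetVec.norm_apply_le _ k
    refine (mul_le_mul (hC _) h1 (by positivity) (by positivity)).trans ?_
    rw [mul_assoc, mul_comm (2 : ℝ), mul_assoc]
    refine mul_le_mul_of_nonneg_left ?_ hC0
    nlinarith [sq_nonneg (‖e ω‖ ^ 2 - ‖ξ ω‖ ^ 2), sq_nonneg (‖ξ ω‖ ^ 2 - 1), sq_nonneg (‖e ω‖ ^ 2)]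
  have hgφ (c d : ℝ) (hc : 0 ≤ c) (hd : 0 ≤ d) {φ : Ω → ℝ} (hφ : AEStronglyMeasurable φ P)
      (hφ0 : ∀ ω, 0 ≤ φ ω) (h : ∀ ω, φ ω ≤ c * ‖e ω‖ ^ 2 + d) :
      Integrable (fun ω => g (e ω) * φ ω) P := by
    refine integrable_of_le_pow_four he hξ (hgm.mul hφ) (C * (2 * (c + d))) fun ω => ?_
    rw [abs_of_nonneg (mul_nonneg (hg0 _) (hφ0 ω))]
    refine (mul_le_mul (hC _) (h ω) (hφ0 ω) (by positivity)).trans ?_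
    rw [mul_assoc, mul_assoc]
    refine mul_le_mul_of_nonneg_left ?_ hC0
    have h1 : c * ‖e ω‖ ^ 2 + d ≤ (c + d) * (1 + ‖e ω‖ ^ 2) := by
      nlinarith [mul_nonneg hd (sq_nonneg ‖e ω‖)]
    have h2 : (1 + ‖e ω‖ ^ 2) * (c * ‖e ω‖ ^ 2 + d)
        ≤ (1 + ‖e ω‖ ^ 2) * ((c + d) * (1 + ‖e ω‖ ^ 2)) := by gcongr
    have h3 : (1 + ‖e ω‖ ^ 2) ^ 2 ≤ 2 * (1 + ‖e ω‖ ^ 4 + ‖ξ ω‖ ^ 4) := by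
      nlinarith [sq_nonneg (‖e ω‖ ^ 2 - 1), sq_nonneg (‖ξ ω‖ ^ 2)]
    have h4 := mul_le_mul_of_nonneg_left h3 (add_nonneg hc hd)
    linarith
  have hφk (k : Fin N) : Integrable (fun ω => g (e ω)
      * (β k ^ 2 * ‖iterate A ghat w0 μ η i k ω‖ ^ 2 + σ k ^ 2)) P := by
    refine hgφ (2 * β k ^ 2) (2 * β k ^ 2 * ‖Wo k‖ ^ 2 + σ k ^ 2) (by positivity) (by positivity)
      (((hWk k).aestronglyMeasurable.norm.pow 2).const_mul _ |>.add_const _)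
      (fun ω => by positivity) fun ω => ?_
    have := mul_le_mul_of_nonneg_left (hW k ω) (sq_nonneg (β k))
    linarith
  have h1 (k : Fin N) : ∫ ω, g (e ω) * ‖ξ ω k‖ ^ 2 ∂P ≤ ∫ ω, g (e ω)
      * (β k ^ 2 * ‖iterate A ghat w0 μ η i k ω‖ ^ 2 + σ k ^ 2) ∂P :=
    integral_mul_le_of_condExp_le hm hge (fun ω => hg0 _)
      (integrable_norm_sq_of_memLp_four (hξ.eval_piLp k)) (hgξ k) (hφk k)
      (hN.second_moment k i _ (measurable_past_iterate i k) (hWk k))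
  have hb0 : 0 ≤ b := le_trans (Finset.sum_nonneg fun k _ => by positivity) hb
  calc ∫ ω, g (e ω) * ‖ξ ω‖ ^ 2 ∂P = ∑ k, ∫ ω, g (e ω) * ‖ξ ω k‖ ^ 2 ∂P := by
        rw [← integral_finsetSum _ fun k _ => hgξ k]
        simp only [NetVec.norm_sq, Finset.mul_sum]
    _ ≤ ∑ k, ∫ ω, g (e ω) * (β k ^ 2 * ‖iterate A ghat w0 μ η i k ω‖ ^ 2 + σ k ^ 2) ∂P :=
        Finset.sum_le_sum fun k _ => h1 k
    _ = ∫ ω, ∑ k, g (e ω) * (β k ^ 2 * ‖iterate A ghat w0 μ η i k ω‖ ^ 2 + σ k ^ 2) ∂P :=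
        (integral_finsetSum _ fun k _ => hφk k).symm
    _ ≤ ∫ ω, g (e ω) * (b * (‖e ω‖ ^ 2 + 1)) ∂P := by
        refine integral_mono (integrable_finsetSum _ fun k _ => hφk k)
          (hgφ b b hb0 hb0 (((he.aestronglyMeasurable.norm.pow 2).add_const 1).const_mul b)
            (fun ω => by positivity) fun ω => by linarith) fun ω => ?_
        simp only
        rw [← Finset.mul_sum]
        refine mul_le_mul_of_nonneg_left ?_ (hg0 _)
        refine le_trans ?_ (mul_le_mul_of_nonneg_right hb (by positivity))
        rw [Finset.sum_mul]
        refine Finset.sum_le_sum fun k _ => ?_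
        have h2 := mul_le_mul_of_nonneg_left (hW k ω) (sq_nonneg (β k))
        have h3 : 0 ≤ 2 * β k ^ 2 * ‖Wo k‖ ^ 2 * ‖e ω‖ ^ 2 + 2 * β k ^ 2 + σ k ^ 2 * ‖e ω‖ ^ 2 := by
          positivity
        linarith

lemma fourth_moment_netNoise_le (hJ : StronglyConvexCosts J lmin lmax)
    (hghat : ∀ k i, Measurable (fun p : Ω × Vec M => ghat k i p.1 p.2))
    (hw0 : ∀ k, Measurable (w0 k) ∧ MemLp (w0 k) 4 P)
    (hN : GradientNoiseConditions P (gradNoise J ghat) (past A ghat w0 μ η) β σ β' σ')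
    (Wo : Fin N → Vec M) (i : ℕ) {b : ℝ}
    (hb : N * ∑ k, (8 * β' k ^ 4 * (1 + ‖Wo k‖ ^ 4) + σ' k ^ 4) ≤ b) :
    ∫ ω, ‖netNoise A J ghat w0 μ η i ω‖ ^ 4 ∂P
      ≤ ∫ ω, b * (‖netError A ghat w0 Wo μ η i ω‖ ^ 4 + 1) ∂P := by
  have hw0' := fun k => (hw0 k).2
  have he := memLp_netError hJ hw0' hN Wo i
  have hξ := memLp_netNoise hJ hw0' hN i
  have hm := past_le (A := A) (μ := μ) (η := η) hghat (fun k => (hw0 k).1) i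
  set e := netError A ghat w0 Wo μ η i with he_def
  set ξ := netNoise A J ghat w0 μ η i with hξ_def
  have hWk (k : Fin N) : MemLp (iterate A ghat w0 μ η i k) 4 P := memLp_iterate hJ hw0' hN i k
  have hW (k : Fin N) (ω : Ω) :
      ‖iterate A ghat w0 μ η i k ω‖ ^ 4 ≤ 8 * ‖e ω‖ ^ 4 + 8 * ‖Wo k‖ ^ 4 := by
    have h1 : ‖iterate A ghat w0 μ η i k ω‖ ≤ ‖e ω‖ + ‖Wo k‖ := by
      have h2 : e ω k = iterate A ghat w0 μ η i k ω - Wo k := rfl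
      have h3 := NetVec.norm_apply_le (e ω) k
      rw [h2] at h3
      linarith [norm_le_norm_add_norm_sub (Wo k) (iterate A ghat w0 μ η i k ω),
        norm_sub_rev (Wo k) (iterate A ghat w0 μ η i k ω)]
    have h4 := pow_le_pow_left₀ (norm_nonneg _) h1 4
    have h5 := add_pow_le (norm_nonneg (e ω)) (norm_nonneg (Wo k)) 4
    norm_num at h5
    linarith
  have i1 (k : Fin N) : Integrable (fun ω => ‖ξ ω k‖ ^ 4) P :=
    integrable_norm_pow_four (hξ.eval_piLp k)
  have i2 (k : Fin N) : Integrable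
      (fun ω => β' k ^ 4 * ‖iterate A ghat w0 μ η i k ω‖ ^ 4 + σ' k ^ 4) P :=
    ((integrable_norm_pow_four (hWk k)).const_mul _).fun_add (integrable_const _)
  have h1 (k : Fin N) : ∫ ω, ‖ξ ω k‖ ^ 4 ∂P
      ≤ ∫ ω, (β' k ^ 4 * ‖iterate A ghat w0 μ η i k ω‖ ^ 4 + σ' k ^ 4) ∂P := by
    rw [← integral_condExp hm]
    exact integral_mono_ae integrable_condExp (i2 k)
      (hN.fourth_moment k i _ (measurable_past_iterate i k) (hWk k))
  calc ∫ ω, ‖ξ ω‖ ^ 4 ∂P ≤ ∫ ω, N * ∑ k, ‖ξ ω k‖ ^ 4 ∂P := by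
        refine integral_mono (integrable_norm_pow_four hξ)
          ((integrable_finsetSum _ fun k _ => i1 k).const_mul _) fun ω => ?_
        have h2 := sq_sum_le_card_mul_sum_sq (s := Finset.univ) (f := fun k => ‖ξ ω k‖ ^ 2)
        rw [← NetVec.norm_sq, Finset.card_univ, Fintype.card_fin] at h2
        simp only [← pow_mul] at h2
        exact h2
    _ = N * ∑ k, ∫ ω, ‖ξ ω k‖ ^ 4 ∂P := by
        rw [integral_const_mul, integral_finsetSum _ fun k _ => i1 k]
    _ ≤ N * ∑ k, ∫ ω, (β' k ^ 4 * ‖iterate A ghat w0 μ η i k ω‖ ^ 4 + σ' k ^ 4) ∂P := by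
        exact mul_le_mul_of_nonneg_left (Finset.sum_le_sum fun k _ => h1 k) (by positivity)
    _ = ∫ ω, N * ∑ k, (β' k ^ 4 * ‖iterate A ghat w0 μ η i k ω‖ ^ 4 + σ' k ^ 4) ∂P := by
        rw [integral_const_mul, integral_finsetSum _ fun k _ => i2 k]
    _ ≤ ∫ ω, b * (‖e ω‖ ^ 4 + 1) ∂P := by
        refine integral_mono ((integrable_finsetSum _ fun k _ => i2 k).const_mul _)
          (((integrable_norm_pow_four he).fun_add (integrable_const _)).const_mul _) fun ω => ?_
        simp only
        refine le_trans ?_ (mul_le_mul_of_nonneg_right hb (by positivity))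
        rw [mul_assoc, Finset.sum_mul]
        refine mul_le_mul_of_nonneg_left (Finset.sum_le_sum fun k _ => ?_) (by positivity)
        have h2 := mul_le_mul_of_nonneg_left (hW k ω) (by positivity : 0 ≤ β' k ^ 4)
        have h3 : 0 ≤ 8 * β' k ^ 4 * ‖Wo k‖ ^ 4 * ‖e ω‖ ^ 4 + 8 * β' k ^ 4
          + σ' k ^ 4 * ‖e ω‖ ^ 4 := by positivity
        linarith

/-- The error process is a noisy recursion, with a noise constant that does not depend on the
step-size. -/
lemma exists_isNoisyRecursion (hA : A.IsSymm) (hJ : StronglyConvexCosts J lmin lmax)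
    (hghat : ∀ k i, Measurable (fun p : Ω × Vec M => ghat k i p.1 p.2))
    (hw0 : ∀ k, Measurable (w0 k) ∧ MemLp (w0 k) 4 P) {Wo : Fin N → Vec M}
    (hW : IsMinOn (regularizedCost A J η) Set.univ Wo) (β σ β' σ' : Fin N → ℝ) :
    ∃ b, 0 ≤ b ∧ ∀ μ,
      GradientNoiseConditions P (gradNoise J ghat) (past A ghat w0 μ η) β σ β' σ' →
      IsNoisyRecursion P (driftStep (netDrift J (η • lapOp A) (WithLp.toLp 2 Wo))
        (netPert J (η • lapOp A) (WithLp.toLp 2 Wo)) μ) (η • lapOp A) μ b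
        (netError A ghat w0 Wo μ η) (netNoise A J ghat w0 μ η) := by
  set b₁ := ∑ k, (2 * β k ^ 2 * (1 + ‖Wo k‖ ^ 2) + σ k ^ 2)
  set b₂ : ℝ := N * ∑ k, (8 * β' k ^ 4 * (1 + ‖Wo k‖ ^ 4) + σ' k ^ 4)
  have hb₁ : 0 ≤ b₁ := Finset.sum_nonneg fun k _ => by positivity
  have hb₂ : 0 ≤ b₂ := mul_nonneg (by positivity) (Finset.sum_nonneg fun k _ => by positivity)
  refine ⟨b₁ + b₂, by positivity, fun μ hN => ?_⟩
  have hw0' := fun k => (hw0 k).2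
  exact
    { memLp_error := memLp_netError hJ hw0' hN Wo
      memLp_noise := memLp_netNoise hJ hw0' hN
      step := netError_succ (netGradient_add_lapOp_eq_zero hA hJ.differentiable hW)
      orthogonal := fun i f hf hC => orthogonal_netNoise hJ hghat hw0 hN Wo i hf hC
      second_moment := fun i g hg hg0 hC =>
        second_moment_netNoise_le hJ hghat hw0 hN Wo i hg hg0 hC (by linarith)
      fourth_moment := fun i => fourth_moment_netNoise_le hJ hghat hw0 hN Wo i (by linarith) }

end Iterates

/-! ### The limiting noise variance -/

section NoiseVariance

variable {M : ℕ} {Ω : Type*} {m : MeasurableSpace Ω} [mΩ : MeasurableSpace Ω] {P : Measure Ω}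
  [IsProbabilityMeasure P]

/-- Bounded convergence for convergence in probability. -/
lemma tendsto_integral_of_tendstoInMeasure {X : ℕ → Ω → ℝ} {c K : ℝ}
    (hX : ∀ i, AEStronglyMeasurable (X i) P) (hK : ∀ i, ∀ᵐ ω ∂P, |X i ω| ≤ K)
    (h : TendstoInMeasure P X atTop (fun _ => c)) :
    Tendsto (fun i => ∫ ω, X i ω ∂P) atTop (𝓝 c) := by
  refine tendsto_of_subseq_tendsto fun ns hns => ?_
  obtain ⟨ms, -, hms⟩ := (h.comp hns).exists_seq_tendsto_ae
  refine ⟨ms, ?_⟩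
  have := tendsto_integral_of_dominated_convergence (μ := P) (fun _ => K)
    (fun n => hX (ns (ms n))) (integrable_const K) (fun n => hK (ns (ms n))) hms
  simpa using this

lemma abs_apply_le_opNorm (B : Matrix (Fin M) (Fin M) ℝ) (a b : Fin M) : |B a b| ≤ opNorm B := by
  have h1 : (Matrix.toEuclideanCLM (n := Fin M) (𝕜 := ℝ) B (EuclideanSpace.single b 1)) a
      = B a b := by
    simp [Matrix.ofLp_toEuclideanCLM]
  have h2 := PiLp.norm_apply_le
    (Matrix.toEuclideanCLM (n := Fin M) (𝕜 := ℝ) B (EuclideanSpace.single b 1)) a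
  rw [h1, Real.norm_eq_abs] at h2
  refine h2.trans (((Matrix.toEuclideanCLM (n := Fin M) (𝕜 := ℝ) B).le_opNorm _).trans ?_)
  simp [opNorm]

lemma abs_mul_apply_le (x : Vec M) (a b : Fin M) : |x a * x b| ≤ ‖x‖ ^ 2 := by
  rw [abs_mul, sq]
  exact mul_le_mul (PiLp.norm_apply_le x a) (PiLp.norm_apply_le x b) (abs_nonneg _) (norm_nonneg _)

lemma integrable_mul_apply {f g : Ω → Vec M} (hf : MemLp f 4 P) (hg : MemLp g 4 P) (a b : Fin M) :
    Integrable (fun ω => f ω a * g ω b) P :=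
  ((hf.eval_piLp a).mono_exponent (by norm_num : (2 : ENNReal) ≤ 4)).integrable_mul
    ((hg.eval_piLp b).mono_exponent (by norm_num : (2 : ENNReal) ≤ 4))

/-- Outside the ball in which the noise covariance is Hölder continuous, the second moments of the
noise are controlled by the mean-square error. The random point is therefore replaced by its
truncation to that ball, at which the Hölder bound applies. -/
lemma abs_integral_mul_sub_le (hm : m ≤ mΩ) {s : Ω → Vec M → Vec M}
    {β σ κ ε θ δ : ℝ} (hκ : 0 ≤ κ) (hε : 0 < ε) (hθ : 0 < θ) (hδ : 0 < δ) {wo : Vec M}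
    (hmem : ∀ w : Ω → Vec M, Measurable[m] w → MemLp w 4 P → MemLp (fun ω => s ω (w ω)) 4 P)
    (hsec : ∀ w : Ω → Vec M, Measurable[m] w → MemLp w 4 P →
      P[fun ω => ‖s ω (w ω)‖ ^ 2 | m] ≤ᵐ[P] fun ω => β ^ 2 * ‖w ω‖ ^ 2 + σ ^ 2)
    (hHol : ∀ w : Ω → Vec M, Measurable[m] w → (∀ ω, ‖w ω - wo‖ ≤ ε) →
      ∀ᵐ ω ∂P, opNorm (noiseCov P s m w ω - noiseCov P s m (fun _ => wo) ω)
        ≤ κ * ‖w ω - wo‖ ^ θ)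
    {W : Ω → Vec M} (hW : Measurable[m] W) (hW4 : MemLp W 4 P) (a b : Fin M) :
    |∫ ω, s ω (W ω) a * s ω (W ω) b ∂P - ∫ ω, s ω wo a * s ω wo b ∂P|
      ≤ κ * δ ^ θ + (κ * (ε ^ θ / δ ^ 2) + (2 * β ^ 2 + (3 * β ^ 2 * ‖wo‖ ^ 2 + 2 * σ ^ 2) / ε ^ 2))
        * ∫ ω, ‖W ω - wo‖ ^ 2 ∂P := by
  classical
  set S : Set Ω := {ω | ‖W ω - wo‖ ≤ ε} with hS
  have hSm : MeasurableSet[m] S := by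
    let _ : MeasurableSpace Ω := m
    exact measurableSet_le (hW.sub_const wo).norm measurable_const
  set w : Ω → Vec M := fun ω => if ω ∈ S then W ω else wo with hw
  have hwm : Measurable[m] w := Measurable.ite hSm hW measurable_const
  have hwε (ω : Ω) : ‖w ω - wo‖ ≤ ε := by
    by_cases h : ω ∈ S
    · simp only [hw, h, if_true]
      exact h
    · simp [hw, h, hε.le]
  have hwW (ω : Ω) : ‖w ω - wo‖ ≤ ‖W ω - wo‖ := by
    by_cases h : ω ∈ S <;> simp [hw, h]
  have hw4 : MemLp w 4 P := by
    refine MemLp.of_bound (hwm.mono hm le_rfl).aestronglyMeasurable (ε + ‖wo‖)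
      (Eventually.of_forall fun ω => ?_)
    linarith [hwε ω, norm_le_norm_add_norm_sub wo (w ω), norm_sub_rev wo (w ω)]
  have hc4 : MemLp (fun _ : Ω => wo) 4 P := memLp_const wo
  have sW := hmem W hW hW4
  have sw := hmem w hwm hw4
  have so := hmem (fun _ => wo) measurable_const hc4
  have e2 : Integrable (fun ω => ‖W ω - wo‖ ^ 2) P :=
    integrable_norm_sq_of_memLp_four (hW4.sub hc4)
  -- the contribution of the complement of `S`
  set f : Ω → ℝ := Sᶜ.indicator 1 with hf
  have hfm : StronglyMeasurable[m] f := stronglyMeasurable_one.indicator hSm.compl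
  have hf0 (ω : Ω) : 0 ≤ f ω := Set.indicator_nonneg (fun _ _ => zero_le_one) ω
  have hfmul {g : Ω → ℝ} (hg : Integrable g P) : Integrable (fun ω => f ω * g ω) P := by
    have h1 : (fun ω => f ω * g ω) = Sᶜ.indicator g := by
      ext ω
      by_cases h : ω ∈ Sᶜ <;> simp [hf, h]
    rw [h1]
    exact hg.indicator (hm _ hSm.compl)
  have q1 : Integrable (fun ω => β ^ 2 * ‖W ω‖ ^ 2 + σ ^ 2) P :=
    ((integrable_norm_sq_of_memLp_four hW4).const_mul _).fun_add (integrable_const _)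
  have q2 : Integrable (fun _ : Ω => β ^ 2 * ‖wo‖ ^ 2 + σ ^ 2) P := integrable_const _
  have n1 := integral_mul_le_of_condExp_le hm hfm hf0 (integrable_norm_sq_of_memLp_four sW)
    (hfmul (integrable_norm_sq_of_memLp_four sW)) (hfmul q1) (hsec W hW hW4)
  have n2 := integral_mul_le_of_condExp_le hm hfm hf0 (integrable_norm_sq_of_memLp_four so)
    (hfmul (integrable_norm_sq_of_memLp_four so)) (hfmul q2)
    (hsec (fun _ => wo) measurable_const hc4)
  have t1 : |∫ ω, s ω (W ω) a * s ω (W ω) b ∂P - ∫ ω, s ω (w ω) a * s ω (w ω) b ∂P|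
      ≤ (2 * β ^ 2 + (3 * β ^ 2 * ‖wo‖ ^ 2 + 2 * σ ^ 2) / ε ^ 2) * ∫ ω, ‖W ω - wo‖ ^ 2 ∂P := by
    rw [← integral_sub (integrable_mul_apply sW sW a b) (integrable_mul_apply sw sw a b)]
    have hpt (ω : Ω) : ‖s ω (W ω) a * s ω (W ω) b - s ω (w ω) a * s ω (w ω) b‖
        ≤ f ω * ‖s ω (W ω)‖ ^ 2 + f ω * ‖s ω wo‖ ^ 2 := by
      by_cases h : ω ∈ S
      · simp [hw, hf, h]
      · have h1 := abs_mul_apply_le (s ω (W ω)) a b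
        have h2 := abs_mul_apply_le (s ω wo) a b
        simp only [hw, hf, h, if_false, Set.mem_compl_iff, not_false_eq_true,
          Set.indicator_of_mem, Pi.one_apply, one_mul]
        exact (norm_sub_le _ _).trans (add_le_add h1 h2)
    refine (norm_integral_le_of_norm_le ((hfmul (integrable_norm_sq_of_memLp_four sW)).fun_add
      (hfmul (integrable_norm_sq_of_memLp_four so))) (Eventually.of_forall hpt)).trans ?_
    rw [integral_add (hfmul (integrable_norm_sq_of_memLp_four sW))
      (hfmul (integrable_norm_sq_of_memLp_four so))]
    refine (add_le_add n1 n2).trans ?_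
    rw [← integral_add (hfmul q1) (hfmul q2), ← integral_const_mul]
    refine integral_mono ((hfmul q1).fun_add (hfmul q2)) (e2.const_mul _) fun ω => ?_
    by_cases h : ω ∈ S
    · simp only [hf, h, Set.mem_compl_iff, not_true_eq_false, not_false_eq_true,
        Set.indicator_of_notMem, zero_mul, add_zero]
      positivity
    · simp only [hf, h, Set.mem_compl_iff, not_false_eq_true,
          Set.indicator_of_mem, Pi.one_apply, one_mul]
      have h1 : ε < ‖W ω - wo‖ := not_le.1 h
      have h2 : ‖W ω‖ ^ 2 ≤ 2 * ‖W ω - wo‖ ^ 2 + 2 * ‖wo‖ ^ 2 := by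
        have h3 : ‖W ω‖ ≤ ‖W ω - wo‖ + ‖wo‖ := by
          linarith [norm_le_norm_add_norm_sub wo (W ω), norm_sub_rev wo (W ω)]
        have h4 := pow_le_pow_left₀ (norm_nonneg _) h3 2
        nlinarith [sq_nonneg (‖W ω - wo‖ - ‖wo‖)]
      have h5 : 3 * β ^ 2 * ‖wo‖ ^ 2 + 2 * σ ^ 2
          ≤ (3 * β ^ 2 * ‖wo‖ ^ 2 + 2 * σ ^ 2) / ε ^ 2 * ‖W ω - wo‖ ^ 2 := by
        rw [div_mul_eq_mul_div, le_div_iff₀ (by positivity)]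
        gcongr
      have h6 := mul_le_mul_of_nonneg_left h2 (sq_nonneg β)
      linarith
  -- the contribution of the truncated point
  have t2 : |∫ ω, s ω (w ω) a * s ω (w ω) b ∂P - ∫ ω, s ω wo a * s ω wo b ∂P|
      ≤ κ * δ ^ θ + κ * (ε ^ θ / δ ^ 2) * ∫ ω, ‖W ω - wo‖ ^ 2 ∂P := by
    rw [← integral_condExp hm, ← integral_condExp hm (f := fun ω => s ω wo a * s ω wo b),
      ← integral_sub integrable_condExp integrable_condExp, ← Real.norm_eq_abs]
    refine (norm_integral_le_of_norm_le ((integrable_const (κ * δ ^ θ)).fun_add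
      (e2.const_mul (κ * (ε ^ θ / δ ^ 2)))) ?_).trans_eq ?_
    · filter_upwards [hHol w hwm hwε] with ω hω
      refine (abs_apply_le_opNorm (noiseCov P s m w ω - noiseCov P s m (fun _ => wo) ω)
        a b).trans (hω.trans ?_)
      rw [mul_assoc, ← mul_add]
      refine mul_le_mul_of_nonneg_left ?_ hκ
      have hx := norm_nonneg (w ω - wo)
      rcases le_total ‖w ω - wo‖ δ with h | h
      · have h1 := Real.rpow_le_rpow hx h hθ.le
        have h2 : 0 ≤ ε ^ θ / δ ^ 2 * ‖W ω - wo‖ ^ 2 := by positivity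
        linarith
      · have h1 := Real.rpow_le_rpow hx (hwε ω) hθ.le
        have h3 : δ ^ 2 ≤ ‖W ω - wo‖ ^ 2 := by
          have := h.trans (hwW ω)
          gcongr
        have h4 : ε ^ θ ≤ ε ^ θ / δ ^ 2 * ‖W ω - wo‖ ^ 2 := by
          rw [div_mul_eq_mul_div, le_div_iff₀ (by positivity)]
          gcongr
        have h5 : 0 ≤ δ ^ θ := by positivity
        linarith
    · rw [integral_add (integrable_const _) (e2.const_mul _),
        integral_const_mul (κ * (ε ^ θ / δ ^ 2))]
      simp
  have h3 := abs_sub_le (∫ ω, s ω (W ω) a * s ω (W ω) b ∂P)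
    (∫ ω, s ω (w ω) a * s ω (w ω) b ∂P) (∫ ω, s ω wo a * s ω wo b ∂P)
  rw [add_mul]
  linarith

end NoiseVariance

section NetworkNoise

variable {N M : ℕ} {Ω : Type*} [mΩ : MeasurableSpace Ω] {P : Measure Ω}
  [IsProbabilityMeasure P]
  {A : Matrix (Fin N) (Fin N) ℝ} {J : Fin N → Vec M → ℝ} {lmin lmax : Fin N → ℝ}
  {ghat : Fin N → ℕ → Ω → Vec M → Vec M} {w0 : Fin N → Ω → Vec M} {μ η : ℝ}
  {β σ β' σ' : Fin N → ℝ} {Wo : Fin N → Vec M} {R : Fin N → Matrix (Fin M) (Fin M) ℝ}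

lemma abs_integral_noise_mul_le
    (hghat : ∀ k i, Measurable (fun p : Ω × Vec M => ghat k i p.1 p.2))
    (hw0 : ∀ k, Measurable (w0 k))
    (hN : GradientNoiseConditions P (gradNoise J ghat) (past A ghat w0 μ η) β σ β' σ')
    (k : Fin N) (wo : Vec M) (a b : Fin M) (i : ℕ) :
    |∫ ω, gradNoise J ghat k (i + 1) ω wo a * gradNoise J ghat k (i + 1) ω wo b ∂P|
      ≤ β k ^ 2 * ‖wo‖ ^ 2 + σ k ^ 2 := by
  have hm := past_le (A := A) (μ := μ) (η := η) hghat hw0 i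
  have hs := hN.memLp k i (fun _ => wo) measurable_const (memLp_const _)
  rw [← Real.norm_eq_abs]
  refine (norm_integral_le_of_norm_le (integrable_norm_sq_of_memLp_four hs)
    (Eventually.of_forall fun ω => abs_mul_apply_le (gradNoise J ghat k (i + 1) ω wo) a b)).trans ?_
  rw [← integral_condExp hm]
  refine (integral_mono_ae integrable_condExp (integrable_const _)
    (hN.second_moment k i (fun _ => wo) measurable_const (memLp_const _))).trans_eq ?_
  simp

lemma tendsto_integral_noise_mul
    (hghat : ∀ k i, Measurable (fun p : Ω × Vec M => ghat k i p.1 p.2))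
    (hw0 : ∀ k, Measurable (w0 k))
    (hN : GradientNoiseConditions P (gradNoise J ghat) (past A ghat w0 μ η) β σ β' σ')
    (hR : IsLimitNoiseCov P (gradNoise J ghat) (past A ghat w0 μ η) Wo R)
    (k : Fin N) (a b : Fin M) :
    Tendsto (fun i => ∫ ω, gradNoise J ghat k (i + 1) ω (Wo k) a
      * gradNoise J ghat k (i + 1) ω (Wo k) b ∂P) atTop (𝓝 (R k a b)) := by
  have hm (i : ℕ) := past_le (A := A) (μ := μ) (η := η) hghat hw0 i
  refine (tendsto_integral_of_tendstoInMeasure (K := β k ^ 2 * ‖Wo k‖ ^ 2 + σ k ^ 2)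
    (fun i => ?_) (fun i => ?_) (hR k a b)).congr fun i => integral_condExp (hm i)
  · exact (stronglyMeasurable_condExp.mono (hm i)).aestronglyMeasurable
  · have hs := hN.memLp k i (fun _ => Wo k) measurable_const (memLp_const _)
    have h1 : P[|fun ω => gradNoise J ghat k (i + 1) ω (Wo k) a
        * gradNoise J ghat k (i + 1) ω (Wo k) b| | past A ghat w0 μ η i]
        ≤ᵐ[P] P[fun ω => ‖gradNoise J ghat k (i + 1) ω (Wo k)‖ ^ 2 | past A ghat w0 μ η i] :=
      condExp_mono (integrable_mul_apply hs hs a b).abs (integrable_norm_sq_of_memLp_four hs)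
        (Eventually.of_forall fun ω => abs_mul_apply_le _ a b)
    filter_upwards [h1, hN.second_moment k i (fun _ => Wo k) measurable_const (memLp_const _),
      abs_condExp_ae_le_condExp_abs (μ := P) (m := past A ghat w0 μ η i)
        (fun ω => gradNoise J ghat k (i + 1) ω (Wo k) a
          * gradNoise J ghat k (i + 1) ω (Wo k) b)] with ω h1 h2 h3
    exact (h3.trans h1).trans h2

/-- The limiting noise covariance inherits the second-moment bound of the noise. The bound depends
on `η` only through the minimizer. -/
lemma abs_limitNoiseCov_le
    (hghat : ∀ k i, Measurable (fun p : Ω × Vec M => ghat k i p.1 p.2))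
    (hw0 : ∀ k, Measurable (w0 k))
    (hN : GradientNoiseConditions P (gradNoise J ghat) (past A ghat w0 μ η) β σ β' σ')
    (hR : IsLimitNoiseCov P (gradNoise J ghat) (past A ghat w0 μ η) Wo R)
    (k : Fin N) (a b : Fin M) : |R k a b| ≤ β k ^ 2 * ‖Wo k‖ ^ 2 + σ k ^ 2 :=
  le_of_tendsto (tendsto_integral_noise_mul hghat hw0 hN hR k a b).abs
    (Eventually.of_forall fun i => abs_integral_noise_mul_le hghat hw0 hN k (Wo k) a b i)

/-- The second moments of the noise of one agent at its iterates are eventually close to the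
limiting covariance, up to a multiple of the mean-square error. -/
lemma eventually_abs_integral_noise_mul_sub_le (hJ : StronglyConvexCosts J lmin lmax)
    (hghat : ∀ k i, Measurable (fun p : Ω × Vec M => ghat k i p.1 p.2))
    (hw0 : ∀ k, Measurable (w0 k) ∧ MemLp (w0 k) 4 P) {κ ε θ : ℝ} (hκ : 0 ≤ κ) (hε : 0 < ε)
    (hθ : 0 < θ) (β σ β' σ' : Fin N → ℝ) (Wo : Fin N → Vec M)
    (R : Fin N → Matrix (Fin M) (Fin M) ℝ) (k : Fin N) (a b : Fin M) {ρ : ℝ} (hρ : 0 < ρ) :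
    ∃ C, ∀ μ,
      GradientNoiseConditions P (gradNoise J ghat) (past A ghat w0 μ η) β σ β' σ' →
      IsLimitNoiseCov P (gradNoise J ghat) (past A ghat w0 μ η) Wo R →
      NoiseCovHolder P (gradNoise J ghat) (past A ghat w0 μ η) Wo κ ε θ →
      ∀ᶠ i in atTop, |∫ ω, netNoise A J ghat w0 μ η i ω k a * netNoise A J ghat w0 μ η i ω k b ∂P
        - R k a b| ≤ ρ + C * ∫ ω, ‖netError A ghat w0 Wo μ η i ω‖ ^ 2 ∂P := by
  obtain ⟨δ, hδ, hκδ⟩ : ∃ δ : ℝ, 0 < δ ∧ κ * δ ^ θ ≤ ρ / 2 := by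
    refine ⟨(ρ / 2 / (κ + 1)) ^ θ⁻¹, by positivity, ?_⟩
    rw [Real.rpow_inv_rpow (by positivity) hθ.ne', mul_div_assoc', div_le_iff₀ (by positivity)]
    nlinarith
  set C := κ * (ε ^ θ / δ ^ 2)
    + (2 * β k ^ 2 + (3 * β k ^ 2 * ‖Wo k‖ ^ 2 + 2 * σ k ^ 2) / ε ^ 2) with hC
  have hC0 : 0 ≤ C := by positivity
  refine ⟨C, fun μ hN hR hH => ?_⟩
  have hw0' := fun k => (hw0 k).2
  have hlim := (tendsto_order.1 ((tendsto_integral_noise_mul hghat (fun k => (hw0 k).1) hN hR k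
    a b).sub_const (R k a b)).abs).2 (ρ / 2) (by simpa using hρ)
  filter_upwards [hlim] with i hi
  have hWk := memLp_iterate hJ hw0' hN i k
  have h1 := abs_integral_mul_sub_le (past_le hghat (fun k => (hw0 k).1) i) hκ hε hθ hδ
    (fun w hw hw4 => hN.memLp k i w hw hw4) (fun w hw hw4 => hN.second_moment k i w hw hw4)
    (fun w hw hwε => hH k i w hw hwε) (measurable_past_iterate i k) hWk a b
  have h2 : ∫ ω, ‖iterate A ghat w0 μ η i k ω - Wo k‖ ^ 2 ∂P
      ≤ ∫ ω, ‖netError A ghat w0 Wo μ η i ω‖ ^ 2 ∂P := by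
    refine integral_mono (integrable_norm_sq_of_memLp_four (hWk.sub (memLp_const _)))
      (integrable_norm_sq_of_memLp_four (memLp_netError hJ hw0' hN Wo i)) fun ω => ?_
    exact pow_le_pow_left₀ (norm_nonneg _)
      (NetVec.norm_apply_le (netError A ghat w0 Wo μ η i ω) k) 2
  have h3 := mul_le_mul_of_nonneg_left h2 hC0
  have h4 := abs_sub_le
    (∫ ω, netNoise A J ghat w0 μ η i ω k a * netNoise A J ghat w0 μ η i ω k b ∂P)
    (∫ ω, gradNoise J ghat k (i + 1) ω (Wo k) a * gradNoise J ghat k (i + 1) ω (Wo k) b ∂P)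
    (R k a b)
  have h5 : |∫ ω, netNoise A J ghat w0 μ η i ω k a * netNoise A J ghat w0 μ η i ω k b ∂P
    - ∫ ω, gradNoise J ghat k (i + 1) ω (Wo k) a * gradNoise J ghat k (i + 1) ω (Wo k) b ∂P|
    ≤ κ * δ ^ θ + C * ∫ ω, ‖iterate A ghat w0 μ η i k ω - Wo k‖ ^ 2 ∂P := h1
  linarith

/-- The limiting noise covariance of the network: block diagonal, because the noises of distinct
agents are uncorrelated. -/
noncomputable def netCov (R : Fin N → Matrix (Fin M) (Fin M) ℝ) : NetVec N M →L[ℝ] NetVec N M :=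
  blockOp fun k => Matrix.toEuclideanCLM (n := Fin M) (𝕜 := ℝ) (R k)

lemma inner_netCov (R : Fin N → Matrix (Fin M) (Fin M) ℝ) (u : NetVec N M) :
    inner ℝ u (netCov R u) = ∑ k, ∑ a, ∑ b, u k a * u k b * R k a b := by
  rw [NetVec.inner_eq]
  refine Finset.sum_congr rfl fun k _ => ?_
  rw [netCov, blockOp_apply, Matrix.inner_toEuclideanCLM]
  simp only [dotProduct, Matrix.mulVec, Finset.mul_sum]
  exact Finset.sum_congr rfl fun a _ => Finset.sum_congr rfl fun b _ => by ring

lemma integral_inner_netNoise_sq (hJ : StronglyConvexCosts J lmin lmax)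
    (hghat : ∀ k i, Measurable (fun p : Ω × Vec M => ghat k i p.1 p.2))
    (hw0 : ∀ k, Measurable (w0 k) ∧ MemLp (w0 k) 4 P)
    (hN : GradientNoiseConditions P (gradNoise J ghat) (past A ghat w0 μ η) β σ β' σ')
    (u : NetVec N M) (i : ℕ) :
    ∫ ω, inner ℝ u (netNoise A J ghat w0 μ η i ω) ^ 2 ∂P
      = ∑ k, ∑ a, ∑ b, u k a * u k b * ∫ ω, netNoise A J ghat w0 μ η i ω k a
        * netNoise A J ghat w0 μ η i ω k b ∂P := by
  have hw0' := fun k => (hw0 k).2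
  have hm := past_le (A := A) (μ := μ) (η := η) hghat (fun k => (hw0 k).1) i
  have hξ := memLp_netNoise hJ hw0' hN i
  set ξ := netNoise A J ghat w0 μ η i with hξ_def
  have hint (k l : Fin N) (a b : Fin M) : Integrable (fun ω => ξ ω k a * ξ ω l b) P :=
    integrable_mul_apply (hξ.eval_piLp k) (hξ.eval_piLp l) a b
  have hexp (ω : Ω) : inner ℝ u (ξ ω) ^ 2
      = ∑ k, ∑ l, ∑ a, ∑ b, u k a * u l b * (ξ ω k a * ξ ω l b) := by
    have h1 : inner ℝ u (ξ ω) = ∑ k, ∑ a, u k a * ξ ω k a := by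
      rw [NetVec.inner_eq]
      refine Finset.sum_congr rfl fun k _ => ?_
      rw [PiLp.inner_apply]
      exact Finset.sum_congr rfl fun a _ => by simp [mul_comm]
    rw [h1, sq, Finset.sum_mul_sum]
    refine Finset.sum_congr rfl fun k _ => Finset.sum_congr rfl fun l _ => ?_
    rw [Finset.sum_mul_sum]
    exact Finset.sum_congr rfl fun a _ => Finset.sum_congr rfl fun b _ => by ring
  simp only [hexp]
  rw [integral_finsetSum _ fun k _ => integrable_finsetSum _ fun l _ => integrable_finsetSum _
    fun a _ => integrable_finsetSum _ fun b _ => (hint k l a b).const_mul _]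
  refine Finset.sum_congr rfl fun k _ => ?_
  rw [integral_finsetSum _ fun l _ => integrable_finsetSum _
    fun a _ => integrable_finsetSum _ fun b _ => (hint k l a b).const_mul _]
  have hl (l : Fin N) : ∫ ω, ∑ a, ∑ b, u k a * u l b * (ξ ω k a * ξ ω l b) ∂P
      = ∑ a, ∑ b, u k a * u l b * ∫ ω, ξ ω k a * ξ ω l b ∂P := by
    rw [integral_finsetSum _
      fun a _ => integrable_finsetSum _ fun b _ => (hint k l a b).const_mul _]
    refine Finset.sum_congr rfl fun a _ => ?_
    rw [integral_finsetSum _ fun b _ => (hint k l a b).const_mul _]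
    exact Finset.sum_congr rfl fun b _ => integral_const_mul _ _
  rw [Finset.sum_eq_single k, hl]
  · intro l _ hlk
    rw [hl]
    refine Finset.sum_eq_zero fun a _ => Finset.sum_eq_zero fun b _ => ?_
    have h0 : ∫ ω, ξ ω k a * ξ ω l b ∂P = 0 := by
      rw [← integral_condExp hm]
      refine (integral_congr_ae (g := fun _ => (0 : ℝ)) (hN.uncorrelated k l i hlk.symm _ _
        (measurable_past_iterate i k) (memLp_iterate hJ hw0' hN i k)
        (measurable_past_iterate i l) (memLp_iterate hJ hw0' hN i l) a b)).trans (by simp)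
    rw [h0, mul_zero]
  · intro h
    exact absurd (Finset.mem_univ k) h

/-- The noise variance along a unit vector `u` is eventually close to `⟨u, R u⟩`, up to a multiple
of the mean-square error. -/
lemma eventually_abs_integral_inner_netNoise_sq_sub_le (hJ : StronglyConvexCosts J lmin lmax)
    (hghat : ∀ k i, Measurable (fun p : Ω × Vec M => ghat k i p.1 p.2))
    (hw0 : ∀ k, Measurable (w0 k) ∧ MemLp (w0 k) 4 P) {κ ε θ : ℝ} (hκ : 0 ≤ κ) (hε : 0 < ε)
    (hθ : 0 < θ) (β σ β' σ' : Fin N → ℝ) (Wo : Fin N → Vec M)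
    (R : Fin N → Matrix (Fin M) (Fin M) ℝ) {u : NetVec N M} (hu : ‖u‖ = 1) {ρ : ℝ} (hρ : 0 < ρ) :
    ∃ C, ∀ μ,
      GradientNoiseConditions P (gradNoise J ghat) (past A ghat w0 μ η) β σ β' σ' →
      IsLimitNoiseCov P (gradNoise J ghat) (past A ghat w0 μ η) Wo R →
      NoiseCovHolder P (gradNoise J ghat) (past A ghat w0 μ η) Wo κ ε θ →
      ∀ᶠ i in atTop, |∫ ω, inner ℝ u (netNoise A J ghat w0 μ η i ω) ^ 2 ∂P
        - inner ℝ u (netCov R u)| ≤ ρ + C * ∫ ω, ‖netError A ghat w0 Wo μ η i ω‖ ^ 2 ∂P := by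
  set ρ' := ρ / (N * (M * M) + 1) with hρ'
  have hρ0 : 0 < ρ' := by positivity
  choose C hC using fun (k : Fin N) (a b : Fin M) => eventually_abs_integral_noise_mul_sub_le
    (A := A) (η := η) hJ hghat hw0 hκ hε hθ β σ β' σ' Wo R k a b hρ0
  refine ⟨∑ k, ∑ a, ∑ b, C k a b, fun μ hN hR hH => ?_⟩
  filter_upwards [eventually_all.2 fun k => eventually_all.2 fun a => eventually_all.2 fun b =>
    hC k a b μ hN hR hH] with i hi
  rw [integral_inner_netNoise_sq hJ hghat hw0 hN, inner_netCov]
  set e₂ := ∫ ω, ‖netError A ghat w0 Wo μ η i ω‖ ^ 2 ∂P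
  simp only [← Finset.sum_sub_distrib, ← mul_sub]
  have hua (k : Fin N) (a : Fin M) : |u k a| ≤ 1 :=
    (PiLp.norm_apply_le (u k) a).trans ((NetVec.norm_apply_le u k).trans_eq hu)
  have h1 : |∑ k, ∑ a, ∑ b, u k a * u k b * (∫ ω, netNoise A J ghat w0 μ η i ω k a
      * netNoise A J ghat w0 μ η i ω k b ∂P - R k a b)| ≤ ∑ k, ∑ a, ∑ b, (ρ' + C k a b * e₂) := by
    refine (Finset.abs_sum_le_sum_abs _ _).trans (Finset.sum_le_sum fun k _ => ?_)
    refine (Finset.abs_sum_le_sum_abs _ _).trans (Finset.sum_le_sum fun a _ => ?_)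
    refine (Finset.abs_sum_le_sum_abs _ _).trans (Finset.sum_le_sum fun b _ => ?_)
    rw [abs_mul, abs_mul]
    refine le_trans ?_ (hi k a b)
    refine mul_le_of_le_one_left (abs_nonneg _) ?_
    exact mul_le_one₀ (hua k a) (abs_nonneg _) (hua k b)
  refine h1.trans ?_
  simp only [Finset.sum_add_distrib, ← Finset.sum_mul]
  have h2 : ∑ _k : Fin N, ∑ _a : Fin M, ∑ _b : Fin M, ρ' ≤ ρ := by
    simp only [Finset.sum_const, Finset.card_univ, Fintype.card_fin, nsmul_eq_mul]
    rw [hρ', ← mul_assoc, ← mul_assoc, mul_div_assoc', div_le_iff₀ (by positivity)]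
    nlinarith
  linarith

end NetworkNoise

/-! ### The spectrum of the Laplacian of a connected network -/

section Spectrum

variable {N M : ℕ} {A : Matrix (Fin N) (Fin N) ℝ} {lam : Fin N → ℝ}
  {v : Fin N → EuclideanSpace ℝ (Fin N)}

lemma IsEigenbasis.sum_mul_eq_ite (hv : IsEigenbasis (laplacian A) lam v) (m n : Fin N) :
    ∑ k, v m k * v n k = if m = n then 1 else 0 := by
  rw [← orthonormal_iff_ite.1 hv.orthonormal m n, PiLp.inner_apply]
  exact Finset.sum_congr rfl fun k _ => by simp [mul_comm]

/-- The columns of an orthogonal matrix are orthonormal as well. -/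
lemma IsEigenbasis.sum_mul_eq_ite' (hv : IsEigenbasis (laplacian A) lam v) (k l : Fin N) :
    ∑ m, v m k * v m l = if k = l then 1 else 0 := by
  have h : (Matrix.of fun m k => v m k) * (Matrix.of fun m k => v m k).transpose = 1 := by
    ext m n
    simpa [Matrix.mul_apply, Matrix.one_apply] using hv.sum_mul_eq_ite m n
  have h' := Matrix.ext_iff.2 (mul_eq_one_comm.1 h) k l
  simpa [Matrix.mul_apply, Matrix.one_apply] using h'

lemma IsEigenbasis.eigenvalue_eq (hA : A.IsSymm) (hv : IsEigenbasis (laplacian A) lam v)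
    (m : Fin N) : lam m = 1 / 2 * ∑ k, ∑ l, A k l * ‖v m k - v m l‖ ^ 2 := by
  rw [← sum_laplacian_inner_eq hA]
  simp only [smul_eq_mul, hv.eigen, RCLike.inner_apply, RCLike.conj_to_real]
  have h := hv.sum_mul_eq_ite m m
  rw [if_pos rfl] at h
  calc lam m = lam m * ∑ k, v m k * v m k := by rw [h, mul_one]
    _ = _ := by rw [Finset.mul_sum]; exact Finset.sum_congr rfl fun k _ => by ring

lemma IsEigenbasis.eigenvalue_nonneg (hA : IsConnectedNetwork A)
    (hv : IsEigenbasis (laplacian A) lam v) (m : Fin N) : 0 ≤ lam m := by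
  rw [hv.eigenvalue_eq hA.symm]
  exact mul_nonneg (by norm_num) (Finset.sum_nonneg fun k _ => Finset.sum_nonneg fun l _ =>
    mul_nonneg (hA.nonneg k l) (by positivity))

/-- On a connected network, the eigenvectors for the eigenvalue zero are constant. -/
lemma IsEigenbasis.apply_eq_of_eigenvalue_eq_zero (hA : IsConnectedNetwork A)
    (hv : IsEigenbasis (laplacian A) lam v) {m : Fin N} (hm : lam m = 0) (k l : Fin N) :
    v m k = v m l := by
  rw [hv.eigenvalue_eq hA.symm] at hm
  have h0 (k l : Fin N) : 0 ≤ A k l * ‖v m k - v m l‖ ^ 2 :=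
    mul_nonneg (hA.nonneg k l) (by positivity)
  have h1 : ∑ k, ∑ l, A k l * ‖v m k - v m l‖ ^ 2 = 0 := by linarith
  have h2 (k l : Fin N) : A k l * ‖v m k - v m l‖ ^ 2 = 0 := by
    have h3 := (Finset.sum_eq_zero_iff_of_nonneg
      fun k _ => Finset.sum_nonneg fun l _ => h0 k l).1 h1 k (Finset.mem_univ k)
    exact (Finset.sum_eq_zero_iff_of_nonneg fun l _ => h0 k l).1 h3 l (Finset.mem_univ l)
  have h3 (k l : Fin N) (hkl : 0 < A k l) : v m k = v m l := by
    rcases mul_eq_zero.1 (h2 k l) with h | h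
    · exact absurd h hkl.ne'
    · exact sub_eq_zero.1 (norm_eq_zero.1 (pow_eq_zero_iff two_ne_zero |>.1 h))
  obtain ⟨p⟩ := hA.connected.preconnected k l
  induction p with
  | nil => rfl
  | cons hadj _ ih =>
    refine Eq.trans ?_ ih
    rcases (SimpleGraph.fromRel_adj _ _ _).1 hadj with ⟨-, h | h⟩
    · exact h3 _ _ h
    · exact (h3 _ _ h).symm

/-- On a connected network, zero is a simple eigenvalue. -/
lemma IsEigenbasis.eq_of_eigenvalue_eq_zero (hA : IsConnectedNetwork A)
    (hv : IsEigenbasis (laplacian A) lam v) {m n : Fin N} (hm : lam m = 0) (hn : lam n = 0) :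
    m = n := by
  by_contra hmn
  have h1 := hv.sum_mul_eq_ite m n
  have h2 := hv.sum_mul_eq_ite m m
  have h3 := hv.sum_mul_eq_ite n n
  have e1 (k : Fin N) := hv.apply_eq_of_eigenvalue_eq_zero hA hm k m
  have e2 (k : Fin N) := hv.apply_eq_of_eigenvalue_eq_zero hA hn k m
  simp only [e1, e2, Finset.sum_const, Finset.card_univ, Fintype.card_fin, nsmul_eq_mul,
    if_neg hmn, if_true] at h1 h2 h3
  rcases mul_eq_zero.1 h1 with h | h
  · rw [h] at h2; simp at h2
  · rcases mul_eq_zero.1 h with h | h <;> simp [h] at h2 h3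

lemma IsEigenbasis.exists_spectral_gap (hA : IsConnectedNetwork A)
    (hv : IsEigenbasis (laplacian A) lam v) : ∃ γ > 0, ∀ m, lam m = 0 ∨ γ ≤ lam m := by
  rcases isEmpty_or_nonempty {m // lam m ≠ 0} with h | h
  · exact ⟨1, one_pos, fun m => Or.inl (not_not.1 fun hm => h.elim ⟨m, hm⟩)⟩
  · obtain ⟨m₀, hm₀⟩ := Finite.exists_min fun m : {m // lam m ≠ 0} => lam m
    refine ⟨lam m₀, (hv.eigenvalue_nonneg hA m₀).lt_of_ne' m₀.2, fun m => ?_⟩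
    by_cases hm : lam m = 0
    · exact Or.inl hm
    · exact Or.inr (hm₀ ⟨m, hm⟩)

end Spectrum

/-! ### The modes of the network space -/

section Modes

variable {N M : ℕ} {A : Matrix (Fin N) (Fin N) ℝ} {lam : Fin N → ℝ}
  {v : Fin N → EuclideanSpace ℝ (Fin N)}

/-- The embedding `v ⊗ I_M` of `ℝ^M` as a mode of the network space. -/
noncomputable def modeEmb (v : EuclideanSpace ℝ (Fin N)) : Vec M →L[ℝ] NetVec N M where
  toFun x := WithLp.toLp 2 fun k => v k • x
  map_add' x y := by ext k : 1; simp
  map_smul' c x := by ext k : 1; simp [smul_comm c]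
  cont := by fun_prop

@[simp] lemma modeEmb_apply (v : EuclideanSpace ℝ (Fin N)) (x : Vec M) (k : Fin N) :
    modeEmb v x k = v k • x := rfl

/-- The projection `vᵀ ⊗ I_M` of the network space onto a mode. -/
noncomputable def modeProj (v : EuclideanSpace ℝ (Fin N)) : NetVec N M →L[ℝ] Vec M where
  toFun y := ∑ k, v k • y k
  map_add' x y := by simp [Finset.sum_add_distrib]
  map_smul' c x := by simp [Finset.smul_sum, smul_comm c]
  cont := by fun_prop

lemma modeProj_apply (v : EuclideanSpace ℝ (Fin N)) (y : NetVec N M) :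
    modeProj v y = ∑ k, v k • y k := rfl

lemma inner_modeEmb (v : EuclideanSpace ℝ (Fin N)) (x : Vec M) (y : NetVec N M) :
    inner ℝ (modeEmb v x) y = inner ℝ x (modeProj v y) := by
  simp [NetVec.inner_eq, modeProj_apply, inner_sum, inner_smul_left, inner_smul_right]

namespace IsEigenbasis

lemma modeProj_modeEmb (hv : IsEigenbasis (laplacian A) lam v) (m n : Fin N) (x : Vec M) :
    modeProj (v m) (modeEmb (v n) x) = if m = n then x else 0 := by
  simp only [modeProj_apply, modeEmb_apply, smul_smul]
  rw [← Finset.sum_smul, hv.sum_mul_eq_ite]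
  split_ifs <;> simp

lemma norm_modeEmb (hv : IsEigenbasis (laplacian A) lam v) (m : Fin N) (x : Vec M) :
    ‖modeEmb (v m) x‖ = ‖x‖ := by
  have h : ‖modeEmb (v m) x‖ ^ 2 = ‖x‖ ^ 2 := by
    rw [← real_inner_self_eq_norm_sq, inner_modeEmb, hv.modeProj_modeEmb, if_pos rfl,
      real_inner_self_eq_norm_sq]
  exact (pow_left_inj₀ (norm_nonneg _) (norm_nonneg _) two_ne_zero).1 h

lemma norm_modeProj_le (hv : IsEigenbasis (laplacian A) lam v) (m : Fin N) (y : NetVec N M) :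
    ‖modeProj (v m) y‖ ≤ ‖y‖ := by
  have h : ‖modeProj (v m) y‖ * ‖modeProj (v m) y‖ ≤ ‖modeProj (v m) y‖ * ‖y‖ := by
    rw [← real_inner_self_eq_norm_mul_norm, ← inner_modeEmb]
    refine (real_inner_le_norm _ _).trans ?_
    rw [hv.norm_modeEmb]
  rcases (norm_nonneg (modeProj (v m) y)).eq_or_lt with h0 | h0
  · rw [← h0]; exact norm_nonneg _
  · exact le_of_mul_le_mul_left h h0

lemma sum_modeEmb_modeProj (hv : IsEigenbasis (laplacian A) lam v) (y : NetVec N M) :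
    ∑ m, modeEmb (v m) (modeProj (v m) y) = y := by
  ext k : 1
  rw [WithLp.ofLp_sum, Finset.sum_apply]
  simp only [modeEmb_apply, modeProj_apply, Finset.smul_sum, smul_smul]
  rw [Finset.sum_comm]
  simp only [← Finset.sum_smul, hv.sum_mul_eq_ite', ite_smul, one_smul, zero_smul,
    Finset.sum_ite_eq, Finset.mem_univ, if_true]

lemma inner_eq_sum_modeProj (hv : IsEigenbasis (laplacian A) lam v) (x y : NetVec N M) :
    inner ℝ x y = ∑ m, inner ℝ (modeProj (v m) x) (modeProj (v m) y) := by
  conv_lhs => rw [← hv.sum_modeEmb_modeProj x]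
  simp only [sum_inner, inner_modeEmb]

lemma lapOp_modeEmb (hv : IsEigenbasis (laplacian A) lam v) (m : Fin N) (x : Vec M) :
    lapOp A (modeEmb (v m) x) = lam m • modeEmb (v m) x := by
  ext k : 1
  change ∑ l, laplacian A k l • v m l • x = lam m • v m k • x
  simp only [smul_smul, ← Finset.sum_smul, hv.eigen]

lemma modeProj_lapOp (hA : A.IsSymm) (hv : IsEigenbasis (laplacian A) lam v) (m : Fin N)
    (y : NetVec N M) : modeProj (v m) (lapOp A y) = lam m • modeProj (v m) y := by
  refine ext_inner_left ℝ fun x => ?_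
  have h := isSymmetric_lapOp hA (modeEmb (v m) x) y
  simp only [ContinuousLinearMap.coe_coe] at h
  rw [← inner_modeEmb, ← h, hv.lapOp_modeEmb, inner_smul_left, inner_smul_right, inner_modeEmb]
  rfl

/-- The orthonormal basis `v_m ⊗ e_a` of the network space. -/
noncomputable def modeBasis (hv : IsEigenbasis (laplacian A) lam v) :
    OrthonormalBasis (Fin N × Fin M) ℝ (NetVec N M) :=
  OrthonormalBasis.mk (v := fun p => modeEmb (v p.1) (EuclideanSpace.single p.2 1))
    (by
      refine orthonormal_iff_ite.2 fun p q => ?_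
      rw [inner_modeEmb, hv.modeProj_modeEmb]
      by_cases h : p.1 = q.1
      · rw [if_pos h, EuclideanSpace.inner_single_left]
        by_cases h2 : p.2 = q.2
        · rw [if_pos (Prod.ext h h2)]; simp [h2]
        · rw [if_neg fun hpq => h2 (congrArg Prod.snd hpq)]; simp [h2]
      · rw [if_neg h, if_neg fun hpq => h (congrArg Prod.fst hpq), inner_zero_right])
    (by
      intro y _
      rw [← hv.sum_modeEmb_modeProj y]
      refine Submodule.sum_mem _ fun m _ => ?_
      rw [← (EuclideanSpace.basisFun (Fin M) ℝ).sum_repr (modeProj (v m) y), map_sum]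
      refine Submodule.sum_mem _ fun a _ => ?_
      rw [map_smul, EuclideanSpace.basisFun_apply]
      exact Submodule.smul_mem _ _ (Submodule.subset_span ⟨(m, a), rfl⟩))

lemma modeBasis_apply (hv : IsEigenbasis (laplacian A) lam v) (p : Fin N × Fin M) :
    hv.modeBasis p = modeEmb (v p.1) (EuclideanSpace.single p.2 1) := by
  rw [modeBasis, OrthonormalBasis.coe_mk]

end IsEigenbasis

end Modes

/-! ### Comparison of the linearized drift with its modes -/

section Coercive

variable {E : Type*} [NormedAddCommGroup E] [InnerProductSpace ℝ E] {T : E →L[ℝ] E} {ν : ℝ}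

lemma mul_norm_le_norm_of_coercive (hT : ∀ x, ν * ‖x‖ ^ 2 ≤ inner ℝ (T x) x) (x : E) :
    ν * ‖x‖ ≤ ‖T x‖ := by
  rcases (norm_nonneg x).eq_or_lt with h | h
  · rw [← h]; simp
  · refine le_of_mul_le_mul_right ?_ h
    calc ν * ‖x‖ * ‖x‖ = ν * ‖x‖ ^ 2 := by ring
      _ ≤ _ := (hT x).trans (real_inner_le_norm _ _)

lemma injective_of_coercive (hν : 0 < ν) (hT : ∀ x, ν * ‖x‖ ^ 2 ≤ inner ℝ (T x) x) :
    Function.Injective T := by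
  refine (injective_iff_map_eq_zero T).2 fun x hx => ?_
  have h := mul_norm_le_norm_of_coercive hT x
  rw [hx, norm_zero] at h
  exact norm_le_zero_iff.1 (nonpos_of_mul_nonpos_right h hν)

end Coercive

section Modes

variable {N M : ℕ} {A : Matrix (Fin N) (Fin N) ℝ} {lam : Fin N → ℝ}
  {v : Fin N → EuclideanSpace ℝ (Fin N)} {B T : NetVec N M →L[ℝ] NetVec N M} {ν η γ Λ : ℝ}

/-- Away from the consensus mode, the solution `q` of `(B + η ℒ) q = p` decays like
`1 / (1 + η)`. -/
lemma one_add_mul_norm_modeProj_le (hA : A.IsSymm) (hv : IsEigenbasis (laplacian A) lam v)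
    (hν : 0 < ν) (hη : 0 ≤ η) (hγ : 0 < γ) (hΛ : 0 ≤ Λ)
    (hTB : T = B + η • lapOp A) (hT : ∀ x, ν * ‖x‖ ^ 2 ≤ inner ℝ (T x) x)
    (hB : ∀ x, ‖B x‖ ≤ Λ * ‖x‖) {n : Fin N} (hn : γ ≤ lam n) (q : NetVec N M) :
    (1 + η) * ‖modeProj (v n) q‖
      ≤ ((1 + Λ / ν) / γ + 1 / ν) * ‖T q‖ := by
  set p := T q with hp
  have h1 : ‖q‖ ≤ 1 / ν * ‖p‖ := by
    rw [one_div, ← div_eq_inv_mul, le_div_iff₀ hν, mul_comm]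
    exact mul_norm_le_norm_of_coercive hT q
  have h2 : (η * lam n) • modeProj (v n) q = modeProj (v n) (p - B q) := by
    rw [hp, hTB, _root_.add_apply, add_sub_cancel_left, _root_.smul_apply, map_smul,
      hv.modeProj_lapOp hA, smul_smul]
  have h3 : η * lam n * ‖modeProj (v n) q‖ ≤ (1 + Λ / ν) * ‖p‖ := by
    calc η * lam n * ‖modeProj (v n) q‖ = ‖(η * lam n) • modeProj (v n) q‖ := by
          rw [norm_smul, Real.norm_of_nonneg (mul_nonneg hη (hγ.le.trans hn))]
      _ ≤ ‖p - B q‖ := by rw [h2]; exact hv.norm_modeProj_le n _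
      _ ≤ ‖p‖ + Λ * ‖q‖ := (norm_sub_le _ _).trans (by linarith [hB q])
      _ ≤ ‖p‖ + Λ * (1 / ν * ‖p‖) := by gcongr
      _ = _ := by ring
  have h4 : η * ‖modeProj (v n) q‖ ≤ (1 + Λ / ν) / γ * ‖p‖ := by
    rw [div_mul_eq_mul_div, le_div_iff₀ hγ]
    refine le_trans ?_ h3
    rw [mul_right_comm]
    gcongr
  have h5 := (hv.norm_modeProj_le n q).trans h1
  linarith

/-- The mode `v_m ⊗ I_M` almost reduces `B + η ℒ`: compressing the operator to the mode changes the
solution of a linear equation by `O(1 / (1 + η))` only. For `λ_m > 0` both solutions are of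
this size. For `λ_m = 0` the defect `g` of the compressed solution is produced by a residual
orthogonal to the mode, and by duality `‖g‖²` pairs that residual with the components of
`(B + η ℒ)⁻¹ g` in the other modes. -/
lemma one_add_mul_norm_sub_modeEmb_le (hA : IsConnectedNetwork A)
    (hv : IsEigenbasis (laplacian A) lam v) (hν : 0 < ν) (hη : 0 ≤ η) (hγ : 0 < γ) (hΛ : 0 ≤ Λ)
    (hgap : ∀ m, lam m = 0 ∨ γ ≤ lam m)
    (hTB : T = B + η • lapOp A) (hsymm : (T : NetVec N M →ₗ[ℝ] NetVec N M).IsSymmetric)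
    (hcoer : ∀ x, ν * ‖x‖ ^ 2 ≤ inner ℝ (B x) x) (hB : ∀ x, ‖B x‖ ≤ Λ * ‖x‖)
    (m : Fin N) {x z : Vec M} {q : NetVec N M} (hx : ‖x‖ = 1)
    (hq : T q = modeEmb (v m) x)
    (hz : modeProj (v m) (B (modeEmb (v m) z)) + (η * lam m) • z = x) :
    (1 + η) * ‖q - modeEmb (v m) z‖ ≤ 2 * Λ / ν * (1 / ν + 1 / γ)
      + N * (2 * Λ / ν) * ((1 + Λ / ν) / γ + 1 / ν) := by
  set C₁ := (1 + Λ / ν) / γ + 1 / ν with hC₁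
  have hC₁0 : 0 ≤ C₁ := by positivity
  have hlam := hv.eigenvalue_nonneg hA m
  have hT (y : NetVec N M) : ν * ‖y‖ ^ 2 ≤ inner ℝ (T y) y := by
    rw [hTB, _root_.add_apply, inner_add_left, _root_.smul_apply, inner_smul_left]
    have := mul_nonneg hη (inner_lapOp_nonneg hA y)
    simp only [RCLike.conj_to_real]
    linarith [hcoer y]
  set g := q - modeEmb (v m) z with hg
  -- the size of the compressed solution
  have hz1 : (ν + η * lam m) * ‖z‖ ≤ 1 := by
    have h1 : ν * ‖z‖ ^ 2 + η * lam m * ‖z‖ ^ 2 ≤ ‖z‖ := by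
      have h2 := hcoer (modeEmb (v m) z)
      rw [hv.norm_modeEmb, real_inner_comm, inner_modeEmb, eq_sub_of_add_eq hz, inner_sub_right,
        inner_smul_right, real_inner_self_eq_norm_sq] at h2
      have h3 := real_inner_le_norm z x
      rw [hx, mul_one] at h3
      linarith
    rcases (norm_nonneg z).eq_or_lt with h | h
    · rw [← h]; simp
    · refine le_of_mul_le_mul_right ?_ h
      linarith
  have hz2 : ‖z‖ ≤ 1 / ν := by
    rw [le_div_iff₀ hν]
    have : 0 ≤ η * lam m * ‖z‖ := by positivity
    linarith
  -- the residual and its bound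
  have hρ : T g = modeEmb (v m) (modeProj (v m) (B (modeEmb (v m) z))) - B (modeEmb (v m) z) := by
    rw [hg, map_sub, hq, hTB, _root_.add_apply, _root_.smul_apply, hv.lapOp_modeEmb, ← hz,
      map_add, map_smul, smul_smul]
    abel
  have hρ1 : ‖T g‖ ≤ 2 * Λ * ‖z‖ := by
    have h1 := hB (modeEmb (v m) z)
    rw [hv.norm_modeEmb] at h1
    rw [hρ]
    refine (norm_sub_le _ _).trans ?_
    rw [hv.norm_modeEmb]
    linarith [hv.norm_modeProj_le m (B (modeEmb (v m) z))]
  have hρ2 : modeProj (v m) (T g) = 0 := by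
    rw [hρ, map_sub, hv.modeProj_modeEmb, if_pos rfl, sub_self]
  rcases hgap m with hm | hm
  · -- the consensus mode
    obtain ⟨h, hh⟩ : ∃ h, T h = g :=
      LinearMap.surjective_of_injective (f := (T : NetVec N M →ₗ[ℝ] NetVec N M))
        (injective_of_coercive hν hT) g
    have h1 : ‖g‖ ^ 2 = ∑ n, inner ℝ (modeProj (v n) (T g)) (modeProj (v n) h) := by
      rw [← hv.inner_eq_sum_modeProj, ← real_inner_self_eq_norm_sq]
      exact ((hsymm g h).trans (by rw [ContinuousLinearMap.coe_coe, hh])).symm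
    have h2 (n : Fin N) : (1 + η) * inner ℝ (modeProj (v n) (T g)) (modeProj (v n) h)
        ≤ 2 * Λ / ν * C₁ * ‖g‖ := by
      by_cases hnm : n = m
      · rw [hnm, hρ2, inner_zero_left, mul_zero]; positivity
      · have hn : γ ≤ lam n := (hgap n).resolve_left
          fun hn => hnm (hv.eq_of_eigenvalue_eq_zero hA hn hm)
        have h3 := one_add_mul_norm_modeProj_le hA.symm hv hν hη hγ hΛ hTB hT hB hn h
        rw [hh, ← hC₁] at h3
        have h4 : ‖modeProj (v n) (T g)‖ ≤ 2 * Λ / ν := by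
          refine (hv.norm_modeProj_le n _).trans (hρ1.trans ?_)
          calc 2 * Λ * ‖z‖ ≤ 2 * Λ * (1 / ν) := by gcongr
            _ = _ := by ring
        calc (1 + η) * inner ℝ (modeProj (v n) (T g)) (modeProj (v n) h)
            ≤ (1 + η) * (‖modeProj (v n) (T g)‖ * ‖modeProj (v n) h‖) := by
              gcongr; exact real_inner_le_norm _ _
          _ = ‖modeProj (v n) (T g)‖ * ((1 + η) * ‖modeProj (v n) h‖) := by ring
          _ ≤ 2 * Λ / ν * (C₁ * ‖g‖) := by gcongr
          _ = _ := by ring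
    have h3 : (1 + η) * ‖g‖ * ‖g‖ ≤ N * (2 * Λ / ν) * C₁ * ‖g‖ := by
      calc (1 + η) * ‖g‖ * ‖g‖ = (1 + η) * ‖g‖ ^ 2 := by ring
        _ = ∑ n, (1 + η) * inner ℝ (modeProj (v n) (T g)) (modeProj (v n) h) := by
          rw [h1, Finset.mul_sum]
        _ ≤ ∑ _n : Fin N, 2 * Λ / ν * C₁ * ‖g‖ := Finset.sum_le_sum fun n _ => h2 n
        _ = _ := by simp; ring
    have h4 : 0 ≤ 2 * Λ / ν * (1 / ν + 1 / γ) := by positivity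
    have h5 : 0 ≤ N * (2 * Λ / ν) * C₁ := by positivity
    rcases (norm_nonneg g).eq_or_lt with h0 | h0
    · rw [← h0, mul_zero]; linarith
    · linarith [le_of_mul_le_mul_right h3 h0]
  · have h1 : (1 + η) * ‖z‖ ≤ 1 / ν + 1 / γ := by
      have h2 : η * ‖z‖ ≤ 1 / γ := by
        rw [le_div_iff₀ hγ]
        have h3 : η * ‖z‖ * γ ≤ η * ‖z‖ * lam m := by gcongr
        have h4 : 0 ≤ ν * ‖z‖ := by positivity
        linarith
      linarith
    have h2 : ‖g‖ ≤ 2 * Λ / ν * ‖z‖ := by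
      rw [div_mul_eq_mul_div, le_div_iff₀ hν, mul_comm]
      exact (mul_norm_le_norm_of_coercive hT g).trans hρ1
    have h3 : (1 + η) * ‖g‖ ≤ 2 * Λ / ν * (1 / ν + 1 / γ) := by
      calc (1 + η) * ‖g‖ ≤ (1 + η) * (2 * Λ / ν * ‖z‖) := by gcongr
        _ = 2 * Λ / ν * ((1 + η) * ‖z‖) := by ring
        _ ≤ _ := by gcongr
    have h5 : 0 ≤ N * (2 * Λ / ν) * C₁ := by positivity
    linarith

lemma abs_inner_modeEmb_netCov_le (hv : IsEigenbasis (laplacian A) lam v)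
    {R : Fin N → Matrix (Fin M) (Fin M) ℝ} {r : ℝ} (hR : ∀ k a b, |R k a b| ≤ r)
    (m : Fin N) (a : Fin M) (y : NetVec N M) :
    |inner ℝ (modeEmb (v m) (EuclideanSpace.single a 1)) (netCov R y)| ≤ N * M * r * ‖y‖ := by
  have hv1 (k : Fin N) : |v m k| ≤ 1 :=
    (PiLp.norm_apply_le (v m) k).trans (hv.orthonormal.1 m).le
  have h1 : inner ℝ (modeEmb (v m) (EuclideanSpace.single a 1)) (netCov R y)
      = ∑ k, ∑ b, v m k * (R k a b * y k b) := by
    rw [NetVec.inner_eq]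
    refine Finset.sum_congr rfl fun k _ => ?_
    rw [modeEmb_apply, inner_smul_left, EuclideanSpace.inner_single_left, ← Finset.mul_sum]
    simp [netCov, Matrix.ofLp_toEuclideanCLM, Matrix.mulVec, dotProduct]
  rw [h1]
  calc |∑ k, ∑ b, v m k * (R k a b * y k b)| ≤ ∑ _k : Fin N, ∑ _b : Fin M, r * ‖y‖ := by
        refine (Finset.abs_sum_le_sum_abs _ _).trans (Finset.sum_le_sum fun k _ =>
          (Finset.abs_sum_le_sum_abs _ _).trans (Finset.sum_le_sum fun b _ => ?_))
        have h2 : |y k b| ≤ ‖y‖ := (PiLp.norm_apply_le (y k) b).trans (NetVec.norm_apply_le y k)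
        have hr : 0 ≤ r := (abs_nonneg _).trans (hR k a b)
        rw [abs_mul, abs_mul]
        calc |v m k| * (|R k a b| * |y k b|) ≤ 1 * (r * ‖y‖) := by
              gcongr
              · exact hv1 k
              · exact hR k a b
          _ = r * ‖y‖ := one_mul _
    _ = _ := by simp; ring

/-- The compression of a block diagonal operator to a mode. -/
lemma modeProj_blockOp_modeEmb (w : EuclideanSpace ℝ (Fin N)) (D : Fin N → Matrix (Fin M) (Fin M) ℝ)
    (x : Vec M) :
    modeProj w (blockOp (fun k => Matrix.toEuclideanCLM (n := Fin M) (𝕜 := ℝ) (D k)) (modeEmb w x))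
      = Matrix.toEuclideanCLM (n := Fin M) (𝕜 := ℝ) (∑ k, w k ^ 2 • D k) x := by
  rw [modeProj_apply, map_sum, _root_.sum_apply]
  refine Finset.sum_congr rfl fun k _ => ?_
  rw [blockOp_apply, modeEmb_apply, map_smul, smul_smul, map_smul, _root_.smul_apply, sq]

end Modes

section ModeSum

variable {N M : ℕ} {A : Matrix (Fin N) (Fin N) ℝ} {J : Fin N → Vec M → ℝ} {lmin lmax : Fin N → ℝ}
  {lam : Fin N → ℝ} {v : Fin N → EuclideanSpace ℝ (Fin N)}

/-- The steady state of the linearized error recursion, written in an eigenbasis of the linearized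
drift, agrees with the sum over the Laplacian modes up to `O(1 / (1 + η))`. -/
lemma exists_abs_sum_sub_modeSum_le (hA : IsConnectedNetwork A)
    (hv : IsEigenbasis (laplacian A) lam v) (hJ : StronglyConvexCosts J lmin lmax) :
    ∃ C, 0 ≤ C ∧ ∀ η, 0 ≤ η → ∀ Wo : Fin N → Vec M, ∀ R : Fin N → Matrix (Fin M) (Fin M) ℝ, ∀ r,
      (∀ k a b, |R k a b| ≤ r) → ∀ {ι : Type} [Fintype ι] (u : OrthonormalBasis ι ℝ (NetVec N M))
      (θ : ι → ℝ), (∀ j, netHessian J (η • lapOp A) (WithLp.toLp 2 Wo) (u j) = θ j • u j) →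
      |∑ j, inner ℝ (u j) (netCov R (u j)) / θ j
        - modeSum lam v η (fun k => hessian (J k) (Wo k)) R| ≤ C * r / (1 + η) := by
  obtain ⟨ν, hν, hνk⟩ := hJ.exists_uniform_lower
  obtain ⟨γ, hγ, hgap⟩ := hv.exists_spectral_gap hA
  set Λ := ∑ k, (|lmax k| + 1) with hΛ_def
  have hΛ : 0 ≤ Λ := Finset.sum_nonneg fun k _ => by positivity
  set C₂ := 2 * Λ / ν * (1 / ν + 1 / γ) + N * (2 * Λ / ν) * ((1 + Λ / ν) / γ + 1 / ν) with hC₂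
  have hC₂0 : 0 ≤ C₂ := by positivity
  refine ⟨∑ _p : Fin N × Fin M, N * M * C₂, Finset.sum_nonneg fun _ _ => by positivity, ?_⟩
  intro η hη Wo R r hR ι _ u θ hu
  set B : NetVec N M →L[ℝ] NetVec N M := blockOp fun k => fderiv ℝ (gradient (J k)) (Wo k) with hB
  set T := netHessian J (η • lapOp A) (WithLp.toLp 2 Wo) with hTdef
  have hTB : T = B + η • lapOp A := rfl
  have hS (x : NetVec N M) : 0 ≤ inner ℝ ((η • lapOp A : NetVec N M →L[ℝ] NetVec N M) x) x := by
    rw [_root_.smul_apply, inner_smul_left]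
    exact mul_nonneg hη (inner_lapOp_nonneg hA x)
  have hSsymm : ((η • lapOp A : NetVec N M →L[ℝ] NetVec N M) :
      NetVec N M →ₗ[ℝ] NetVec N M).IsSymmetric :=
    (isSymmetric_lapOp hA.symm).smul (by simp)
  have hsymm := hJ.isSymmetric_netHessian hSsymm (WithLp.toLp 2 Wo)
  have hT := hJ.inner_netHessian_ge hνk hS (WithLp.toLp 2 Wo)
  rw [← hTdef] at hsymm
  have hBcoer (x : NetVec N M) : ν * ‖x‖ ^ 2 ≤ inner ℝ (B x) x := by
    have h := hJ.inner_netHessian_ge (S := 0) hνk (fun y => by simp) (WithLp.toLp 2 Wo) x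
    rwa [netHessian, add_zero] at h
  have hBnorm (x : NetVec N M) : ‖B x‖ ≤ Λ * ‖x‖ := by
    refine NetVec.norm_le_of_forall hΛ fun k => ?_
    refine (ContinuousLinearMap.le_of_opNorm_le _ (hJ.norm_fderiv_le k (Wo k)) (x k)).trans ?_
    exact mul_le_mul_of_nonneg_right (Finset.single_le_sum
      (f := fun k => |lmax k| + 1) (fun k _ => by positivity) (Finset.mem_univ k)) (norm_nonneg _)
  -- the inverse of the linearized drift
  set G := LinearEquiv.ofInjectiveEndo (T : NetVec N M →ₗ[ℝ] NetVec N M)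
    (injective_of_coercive hν hT) with hG
  have hTG (x : NetVec N M) : T (G.symm x) = x := G.apply_symm_apply x
  have hθ (j : ι) : θ j ≠ 0 := by
    intro h0
    have h := injective_of_coercive hν hT ((hu j).trans (by rw [h0, zero_smul, map_zero]))
    exact u.orthonormal.ne_zero j h
  have hGu (j : ι) : G.symm (u j) = (θ j)⁻¹ • u j := by
    refine injective_of_coercive hν hT ?_
    rw [hTG, map_smul, hu, smul_smul, inv_mul_cancel₀ (hθ j), one_smul]
  have htrace : ∑ j, inner ℝ (u j) (netCov R (u j)) / θ j = ∑ m, ∑ a,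
      inner ℝ (modeEmb (v m) (EuclideanSpace.single a 1))
        (netCov R (G.symm (modeEmb (v m) (EuclideanSpace.single a 1)))) := by
    have h1 := LinearMap.trace_eq_sum_inner
      ((netCov R : NetVec N M →ₗ[ℝ] NetVec N M) ∘ₗ (G.symm : NetVec N M →ₗ[ℝ] NetVec N M)) u
    rw [LinearMap.trace_eq_sum_inner _ hv.modeBasis, Fintype.sum_prod_type] at h1
    simp only [LinearMap.comp_apply, LinearEquiv.coe_coe, ContinuousLinearMap.coe_coe, hGu,
      map_smul, inner_smul_right, hv.modeBasis_apply] at h1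
    rw [h1]
    exact Finset.sum_congr rfl fun j _ => div_eq_inv_mul _ _
  -- the compression of the linearized drift to a mode
  set Tm : Fin N → Matrix (Fin M) (Fin M) ℝ := fun m =>
    ∑ k, (v m k) ^ 2 • hessian (J k) (Wo k) + (η * lam m) • (1 : Matrix (Fin M) (Fin M) ℝ) with hTm
  have hTm_apply (m : Fin N) (x : Vec M) : Matrix.toEuclideanCLM (n := Fin M) (𝕜 := ℝ) (Tm m) x
      = modeProj (v m) (B (modeEmb (v m) x)) + (η * lam m) • x := by
    have h := modeProj_blockOp_modeEmb (v m) (fun k => hessian (J k) (Wo k)) x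
    simp only [toEuclideanCLM_hessian] at h
    rw [hB, h, hTm, map_add, toEuclideanCLM_smul_one]
    rfl
  have hTm_unit (m : Fin N) : IsUnit (Tm m) := by
    have hc (x : Vec M) : ν * ‖x‖ ^ 2
        ≤ inner ℝ (Matrix.toEuclideanCLM (n := Fin M) (𝕜 := ℝ) (Tm m) x) x := by
      have h1 := hBcoer (modeEmb (v m) x)
      rw [hv.norm_modeEmb, real_inner_comm, inner_modeEmb, real_inner_comm] at h1
      rw [hTm_apply, inner_add_left, inner_smul_left, real_inner_self_eq_norm_sq]
      have h2 : 0 ≤ η * lam m * ‖x‖ ^ 2 :=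
        mul_nonneg (mul_nonneg hη (hv.eigenvalue_nonneg hA m)) (sq_nonneg _)
      simp only [RCLike.conj_to_real]
      linarith
    refine Matrix.mulVec_injective_iff_isUnit.1 fun x y hxy => ?_
    have h := injective_of_coercive hν hc (a₁ := WithLp.toLp 2 x) (a₂ := WithLp.toLp 2 y)
      (by rw [Matrix.toEuclideanCLM_toLp, Matrix.toEuclideanCLM_toLp, hxy])
    exact WithLp.toLp_injective 2 h
  set z : Fin N → Fin M → Vec M := fun m a =>
    Matrix.toEuclideanCLM (n := Fin M) (𝕜 := ℝ) (Tm m)⁻¹ (EuclideanSpace.single a 1) with hz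
  have hTz (m : Fin N) (a : Fin M) : modeProj (v m) (B (modeEmb (v m) (z m a)))
      + (η * lam m) • z m a = EuclideanSpace.single a 1 := by
    rw [← hTm_apply, hz, ← mul_apply_eq_comp, ← map_mul,
      Matrix.mul_nonsing_inv _ ((Matrix.isUnit_iff_isUnit_det _).1 (hTm_unit m)), map_one]
    rfl
  have hmode : modeSum lam v η (fun k => hessian (J k) (Wo k)) R = ∑ m, ∑ a,
      inner ℝ (modeEmb (v m) (EuclideanSpace.single a 1)) (netCov R (modeEmb (v m) (z m a))) := by
    refine Finset.sum_congr rfl fun m _ => ?_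
    rw [Matrix.trace_mul_comm, Matrix.trace]
    refine Finset.sum_congr rfl fun a _ => ?_
    rw [inner_modeEmb, netCov, modeProj_blockOp_modeEmb, hz, ← mul_apply_eq_comp,
      ← map_mul, EuclideanSpace.inner_single_left]
    simp only [map_one, one_mul, Matrix.ofLp_toEuclideanCLM, PiLp.ofLp_single,
      Matrix.mulVec_single_one, Matrix.col_apply, Matrix.diag_apply]
    rfl
  rw [htrace, hmode, ← Finset.sum_sub_distrib]
  simp only [← Finset.sum_sub_distrib, ← inner_sub_right, ← map_sub]
  rw [← Fintype.sum_prod_type (f := fun p : Fin N × Fin M =>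
    inner ℝ (modeEmb (v p.1) (EuclideanSpace.single p.2 1))
      (netCov R (G.symm (modeEmb (v p.1) (EuclideanSpace.single p.2 1))
        - modeEmb (v p.1) (z p.1 p.2))))]
  rw [Finset.sum_mul, Finset.sum_div]
  refine (Finset.abs_sum_le_sum_abs _ _).trans (Finset.sum_le_sum fun p _ => ?_)
  refine (abs_inner_modeEmb_netCov_le hv hR p.1 p.2 _).trans ?_
  have h1 := one_add_mul_norm_sub_modeEmb_le hA hv hν hη hγ hΛ hgap hTB hsymm hBcoer hBnorm p.1
    (x := EuclideanSpace.single p.2 1) (by simp) (hTG _) (hTz p.1 p.2)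
  have hr : 0 ≤ r := (abs_nonneg _).trans (hR p.1 p.2 p.2)
  rw [← hC₂, mul_comm, ← le_div_iff₀ (by linarith)] at h1
  calc N * M * r * ‖G.symm (modeEmb (v p.1) (EuclideanSpace.single p.2 1))
          - modeEmb (v p.1) (z p.1 p.2)‖ ≤ N * M * r * (C₂ / (1 + η)) := by gcongr
    _ = _ := by ring

end ModeSum

/-! ### The network mean-square deviation -/

section Performance

variable {N M : ℕ} {Ω : Type*} [MeasurableSpace Ω] {P : Measure Ω}
  {A : Matrix (Fin N) (Fin N) ℝ} {J : Fin N → Vec M → ℝ} {lmin lmax lam : Fin N → ℝ}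
  {v : Fin N → EuclideanSpace ℝ (Fin N)}
  {ghat : Fin N → ℕ → Ω → Vec M → Vec M} {w0 : Fin N → Ω → Vec M} {η μ : ℝ}

/-- Small step-sizes satisfy the condition on the combination matrix. -/
lemma exists_combinationCondition (A : Matrix (Fin N) (Fin N) ℝ) (lam : Fin N → ℝ)
    (hη : 0 ≤ η) : ∃ μ₀ > 0, ∀ μ, 0 < μ → μ < μ₀ → CombinationCondition A lam μ η := by
  set D := ∑ m, |lam m| + ∑ k, |∑ l, A k l| with hD
  have h1 : 0 ≤ ∑ m, |lam m| := Finset.sum_nonneg fun m _ => abs_nonneg _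
  have h2 : 0 ≤ ∑ k, |∑ l, A k l| := Finset.sum_nonneg fun k _ => abs_nonneg _
  have hD0 : 0 ≤ D := by positivity
  refine ⟨1 / (1 + η * D), by positivity, fun μ hμ hμ₀ => ?_⟩
  have hμη : 0 ≤ μ * η := by positivity
  have h3 : μ * η * D ≤ 1 := by
    rw [lt_div_iff₀ (by positivity)] at hμ₀
    linarith
  have h4 {x : ℝ} (hx : x ≤ D) : μ * η * x ≤ 1 :=
    (mul_le_mul_of_nonneg_left hx hμη).trans h3
  refine ⟨hμη, fun m => ?_, fun k => h4 ?_⟩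
  · have h5 := Finset.single_le_sum (f := fun m => |lam m|) (fun m _ => abs_nonneg _)
      (Finset.mem_univ m)
    have h6 := h4 (x := lam m) (by linarith [le_abs_self (lam m)])
    linarith
  · have h5 := Finset.single_le_sum (f := fun k => |∑ l, A k l|) (fun k _ => abs_nonneg _)
      (Finset.mem_univ k)
    linarith [le_abs_self (∑ l, A k l)]

lemma lintegral_error_eq (hμ : 0 < μ) {Wo : Fin N → Vec M} {i : ℕ}
    (he : Integrable (fun ω => ‖netError A ghat w0 Wo μ η i ω‖ ^ 2) P) :
    ENNReal.ofReal (1 / μ) *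
        ∫⁻ ω, ENNReal.ofReal (1 / (N : ℝ) * ∑ k, ‖Wo k - iterate A ghat w0 μ η i k ω‖ ^ 2) ∂P
      = ENNReal.ofReal ((∫ ω, ‖netError A ghat w0 Wo μ η i ω‖ ^ 2 ∂P) / μ / N) := by
  have h1 (ω : Ω) : 1 / (N : ℝ) * ∑ k, ‖Wo k - iterate A ghat w0 μ η i k ω‖ ^ 2
      = 1 / (N : ℝ) * ‖netError A ghat w0 Wo μ η i ω‖ ^ 2 := by
    rw [NetVec.norm_sq]
    exact congrArg _ (Finset.sum_congr rfl fun k _ => by rw [norm_sub_rev]; rfl)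
  simp only [h1]
  rw [← ofReal_integral_eq_lintegral_ofReal (he.const_mul _)
    (Eventually.of_forall fun ω => by positivity), ← ENNReal.ofReal_mul (by positivity),
    integral_const_mul]
  congr 1
  ring

/-- The mean-square deviation exists as soon as the scaled mean-square error is eventually close to
a constant for small step-sizes. -/
lemma hasMSD_of_eventually {Wo : Fin N → Vec M} {μ₀ s : ℝ} (hμ₀ : 0 < μ₀)
    (hint : ∀ μ, 0 < μ → μ < μ₀ → ∀ i,
      Integrable (fun ω => ‖netError A ghat w0 Wo μ η i ω‖ ^ 2) P)
    (h : ∀ ε > 0, ∃ μ₁ > 0, ∀ μ, 0 < μ → μ < μ₁ → ∀ᶠ i in atTop,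
      |(∫ ω, ‖netError A ghat w0 Wo μ η i ω‖ ^ 2 ∂P) / μ - s| ≤ ε) :
    HasMSD P A ghat w0 Wo η (s / N) := by
  have hs : 0 ≤ s := by
    refine le_of_forall_pos_le_add fun ε hε => ?_
    obtain ⟨μ₁, hμ₁, H⟩ := h ε hε
    obtain ⟨i, hi⟩ := (H (μ₁ / 2) (by positivity) (by linarith)).exists
    have h1 : 0 ≤ (∫ ω, ‖netError A ghat w0 Wo (μ₁ / 2) η i ω‖ ^ 2 ∂P) / (μ₁ / 2) :=
      div_nonneg (integral_nonneg fun ω => by positivity) (by positivity)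
    linarith [(abs_le.1 hi).2]
  have key (ε : ℝ) (hε : 0 < ε) : ∀ᶠ μ in 𝓝[>] (0 : ℝ),
      ENNReal.ofReal ((s - ε) / N) ≤ scaledSteadyStateMSE P A ghat w0 Wo η μ ∧
        scaledSteadyStateMSE P A ghat w0 Wo η μ ≤ ENNReal.ofReal ((s + ε) / N) := by
    obtain ⟨μ₁, hμ₁, H⟩ := h ε hε
    filter_upwards [Ioo_mem_nhdsGT (lt_min hμ₀ hμ₁)] with μ hμ
    have h1 := H μ hμ.1 (hμ.2.trans_le (min_le_right _ _))
    have h2 := hint μ hμ.1 (hμ.2.trans_le (min_le_left _ _))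
    simp only [scaledSteadyStateMSE, fun i => lintegral_error_eq hμ.1 (h2 i)]
    constructor
    · refine le_limsup_of_frequently_le (h1.mono fun i hi => ?_).frequently
      refine ENNReal.ofReal_le_ofReal (div_le_div_of_nonneg_right ?_ (by positivity))
      linarith [(abs_le.1 hi).1]
    · refine limsup_le_of_le (h := h1.mono fun i hi => ?_)
      refine ENNReal.ofReal_le_ofReal (div_le_div_of_nonneg_right ?_ (by positivity))
      linarith [(abs_le.1 hi).2]
  have hcont (g : ℝ → ℝ) (hg : Continuous g) (hg0 : g 0 = s / N) :
      Tendsto (fun ε => ENNReal.ofReal (g ε)) (𝓝[>] 0) (𝓝 (ENNReal.ofReal (s / N))) := by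
    rw [← hg0]
    exact ((ENNReal.continuous_ofReal.comp hg).tendsto 0).mono_left nhdsWithin_le_nhds
  refine ⟨by positivity, tendsto_order.2 ⟨fun a ha => ?_, fun a ha => ?_⟩⟩
  · obtain ⟨ε, h1, hε⟩ := (((hcont (fun ε => (s - ε) / N) (by fun_prop) (by simp)).eventually
      (lt_mem_nhds ha)).and self_mem_nhdsWithin).exists
    filter_upwards [key ε hε] with μ hμ using h1.trans_le hμ.1
  · obtain ⟨ε, h1, hε⟩ := (((hcont (fun ε => (s + ε) / N) (by fun_prop) (by simp)).eventually
      (gt_mem_nhds ha)).and self_mem_nhdsWithin).exists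
    filter_upwards [key ε hε] with μ hμ using hμ.2.trans_lt h1

end Performance
end MultitaskDiffusion

open MultitaskDiffusion

theorem theorem1 {N M : ℕ} {Ω : Type*} [MeasurableSpace Ω]
    (P : MeasureTheory.Measure Ω) [MeasureTheory.IsProbabilityMeasure P]
    -- the network, its Laplacian eigenvalues and eigenvectors
    (A : Matrix (Fin N) (Fin N) ℝ) (hA : MultitaskDiffusion.IsConnectedNetwork A)
    (lam : Fin N → ℝ) (v : Fin N → EuclideanSpace ℝ (Fin N))
    (hv : MultitaskDiffusion.IsEigenbasis (MultitaskDiffusion.laplacian A) lam v)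
    -- the individual costs
    (J : Fin N → MultitaskDiffusion.Vec M → ℝ) (lmin lmax : Fin N → ℝ)
    (hJ : MultitaskDiffusion.StronglyConvexCosts J lmin lmax)
    -- the stochastic gradients and the initialization
    (ghat : Fin N → ℕ → Ω → MultitaskDiffusion.Vec M → MultitaskDiffusion.Vec M)
    (hghat : ∀ k i, Measurable (fun p : Ω × MultitaskDiffusion.Vec M => ghat k i p.1 p.2))
    (w0 : Fin N → Ω → MultitaskDiffusion.Vec M)
    (hw0 : ∀ k, Measurable (w0 k) ∧ MeasureTheory.MemLp (w0 k) 4 P)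
    -- the constants in the moment conditions on the gradient noise
    (β σ β' σ' : Fin N → ℝ) :
    -- the constant in the error term depends neither on `η` nor on `μ`
    ∃ C : ℝ, ∀ η : ℝ, 0 ≤ η →
      -- the minimizer of the regularized cost
      ∀ Wo : Fin N → MultitaskDiffusion.Vec M,
        IsMinOn (MultitaskDiffusion.regularizedCost A J η) Set.univ Wo →
      MultitaskDiffusion.HessianLocallyLipschitz J Wo →
      -- the gradient noise conditions, for all step-sizes that satisfy the condition on the
      -- combination matrix
      (∀ μ : ℝ, 0 < μ → MultitaskDiffusion.CombinationCondition A lam μ η →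
        MultitaskDiffusion.GradientNoiseConditions P (MultitaskDiffusion.gradNoise J ghat)
          (MultitaskDiffusion.past A ghat w0 μ η) β σ β' σ') →
      -- the limiting noise covariances at the minimizer
      ∀ R : Fin N → Matrix (Fin M) (Fin M) ℝ,
      (∀ μ : ℝ, 0 < μ → MultitaskDiffusion.CombinationCondition A lam μ η →
        MultitaskDiffusion.IsLimitNoiseCov P (MultitaskDiffusion.gradNoise J ghat)
          (MultitaskDiffusion.past A ghat w0 μ η) Wo R) →
      -- smoothness of the noise covariances near the minimizer
      (∃ κ ε θ : ℝ, 0 ≤ κ ∧ 0 < ε ∧ 0 < θ ∧ θ ≤ 4 ∧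
        ∀ μ : ℝ, 0 < μ → MultitaskDiffusion.CombinationCondition A lam μ η →
          MultitaskDiffusion.NoiseCovHolder P (MultitaskDiffusion.gradNoise J ghat)
            (MultitaskDiffusion.past A ghat w0 μ η) Wo κ ε θ) →
      -- the network MSD is `μ * c`
      ∃ c : ℝ, MultitaskDiffusion.HasMSD P A ghat w0 Wo η c ∧
        ∀ μ : ℝ, 0 < μ →
          |μ * c - μ / (2 * (N : ℝ)) * MultitaskDiffusion.modeSum lam v η
              (fun k => MultitaskDiffusion.hessian (J k) (Wo k)) R|
            ≤ C * μ / (1 + η) := by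
  obtain ⟨ν, hν0, hν⟩ := hJ.exists_uniform_lower
  obtain ⟨C₀, hC₀, hcomp⟩ := exists_abs_sum_sub_modeSum_le hA hv hJ
  -- a bound for the limiting covariances that does not depend on `η`
  set r := ∑ k, (β k ^ 2 * (‖netGradient J 0‖ / ν) ^ 2 + σ k ^ 2) with hr
  refine ⟨C₀ * r / (2 * N), ?_⟩
  intro η hη Wo hW hlip hN R hR ⟨κ, ε, θ, hκ, hε, hθ, _, hH⟩
  obtain ⟨μ₀, hμ₀, hcc⟩ := exists_combinationCondition A lam hη
  have hRr (k : Fin N) (a b : Fin M) : |R k a b| ≤ r := by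
    have h1 := hcc (μ₀ / 2) (by positivity) (by linarith)
    have h2 : ‖Wo k‖ ≤ ‖netGradient J 0‖ / ν :=
      (NetVec.norm_apply_le (WithLp.toLp 2 Wo) k).trans (hJ.norm_minimizer_le hA hν0 hν hη hW)
    calc |R k a b| ≤ β k ^ 2 * ‖Wo k‖ ^ 2 + σ k ^ 2 :=
          abs_limitNoiseCov_le hghat (fun k => (hw0 k).1) (hN _ (by positivity) h1)
            (hR _ (by positivity) h1) k a b
      _ ≤ β k ^ 2 * (‖netGradient J 0‖ / ν) ^ 2 + σ k ^ 2 := by gcongr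
      _ ≤ r := Finset.single_le_sum
          (f := fun k => β k ^ 2 * (‖netGradient J 0‖ / ν) ^ 2 + σ k ^ 2)
          (fun k _ => by positivity) (Finset.mem_univ k)
  set S : NetVec N M →L[ℝ] NetVec N M := η • lapOp A with hSdef
  have hS0 (x : NetVec N M) : 0 ≤ inner ℝ (S x) x := by
    rw [hSdef, _root_.smul_apply, inner_smul_left]
    exact mul_nonneg hη (inner_lapOp_nonneg hA x)
  have hS : (S : NetVec N M →ₗ[ℝ] NetVec N M).IsSymmetric :=
    (isSymmetric_lapOp hA.symm).smul (by simp)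
  obtain ⟨K, hdrift⟩ := hJ.exists_isDrift hν0 hν hS0 hlip
  obtain ⟨b, hb, hrec⟩ := exists_isNoisyRecursion hA.symm hJ hghat hw0 hW β σ β' σ'
  have hH₀ := hJ.isSymmetric_netHessian hS (WithLp.toLp 2 Wo)
  -- an eigenbasis of the linearized drift
  set u := hH₀.eigenvectorBasis rfl with hu
  set τ := hH₀.eigenvalues rfl with hτ
  have huτ (j) : netHessian J S (WithLp.toLp 2 Wo) (u j) = τ j • u j :=
    hH₀.apply_eigenvectorBasis rfl j
  have hτ0 (j) : 0 < τ j := by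
    have h1 := hJ.inner_netHessian_ge hν hS0 (WithLp.toLp 2 Wo) (u j)
    rw [huτ, inner_smul_left, real_inner_self_eq_norm_sq, u.orthonormal.1 j] at h1
    simp only [RCLike.conj_to_real] at h1
    linarith
  have hlim (δ : ℝ) (hδ : 0 < δ) := hdrift.eventually_abs_integral_norm_sq_sub_le hH₀ hS hb hμ₀
    (fun μ h0 h1 => hrec μ (hN μ h0 (hcc μ h0 h1))) u hτ0 huτ
    (r := fun j => inner ℝ (u j) (netCov R (u j)))
    (fun j ρ hρ => by
      obtain ⟨C, hC⟩ := eventually_abs_integral_inner_netNoise_sq_sub_le (A := A) (η := η) hJ hghat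
        hw0 hκ hε hθ β σ β' σ' Wo R (u.orthonormal.1 j) hρ
      exact ⟨C, fun μ h0 h1 => hC μ (hN μ h0 (hcc μ h0 h1)) (hR μ h0 (hcc μ h0 h1))
        (hH μ h0 (hcc μ h0 h1))⟩) hδ
  refine ⟨_, hasMSD_of_eventually hμ₀ (fun μ h0 h1 i =>
    integrable_norm_sq_of_memLp_four ((hrec μ (hN μ h0 (hcc μ h0 h1))).memLp_error i)) hlim,
    fun μ hμ => ?_⟩
  have h1 := hcomp η hη Wo R r hRr u τ huτ
  have hN0 : (0 : ℝ) < N := by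
    obtain ⟨k⟩ := hA.connected.nonempty
    exact_mod_cast k.pos
  have h2 : ∑ j, inner ℝ (u j) (netCov R (u j)) / (2 * τ j)
      = 1 / 2 * ∑ j, inner ℝ (u j) (netCov R (u j)) / τ j := by
    rw [Finset.mul_sum]
    exact Finset.sum_congr rfl fun j _ => by
      have := (hτ0 j).ne'
      field_simp
  rw [h2]
  set X := ∑ j, inner ℝ (u j) (netCov R (u j)) / τ j
  set Y := modeSum lam v η (fun k => hessian (J k) (Wo k)) R
  have h3 : μ * (1 / 2 * X / N) - μ / (2 * N) * Y = μ / (2 * N) * (X - Y) := by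
    field_simp
  rw [h3, abs_mul, abs_of_nonneg (by positivity)]
  calc μ / (2 * N) * |X - Y| ≤ μ / (2 * N) * (C₀ * r / (1 + η)) := by gcongr
    _ = _ := by field_simp
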